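/- Let $p,T>0$, $0<\alpha\le 1$, $\Omega=(0,p)\times(-T,T)$, $\Omega^+=\Omega\cap\{t>0\}$, $\Omega^-=\Omega\cap\{t<0\}$. Let $f\in C^1(\overline\Omega)$ be real-valued with $f(0,t)=f(p,t)=0$ for $-T\le t\le T$, with (weak) derivative $\partial^2 f/\partial t^2\in L_2(\Omega)$, and with $\partial f/\partial x$ Hölder continuous in $x$ with exponent $\alpha$, uniformly in $t$. For $n=1,2,\dots$ put $\lambda_n=n\pi/p$, $X_n(x)=\sqrt{2/p}\,\sin\lambda_nx$, $f_n(t)=\int_0^pf(x,t)X_n(x)\,dx$, and $$A_n=\frac{(1-\lambda_n^2)f_n(0)-f_n'(0)}{\lambda_n^2(\lambda_n^2+1)},\quad B_n=\frac{2f_n(0)-f_n'(0)}{\lambda_n^2+1},\quad D_n=\frac{2\lambda_n^2f_n(0)+f_n'(0)}{\lambda_n^2+1},\quad E_n=\frac{(2\lambda_n^2+1)f_n'(0)-2\lambda_n^2f_n(0)}{\lambda_n(\lambda_n^2+1)}.$$ ($f_n'$ is absolutely continuous and $f_n''$ denotes its almost everywhere derivative.) Then the series $$u^+(x,t)=\sum_{n\ge1}X_n(x)\Big[A_n\cos\lambda_nt+\frac{B_n}{\lambda_n}\sin\lambda_nt+\frac1{\lambda_n}\int_0^tf_n(\tau)\sin\lambda_n(t-\tau)\,d\tau\Big],$$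 $$u^+_t=\sum_{n\ge1}X_n(x)\Big[-\lambda_nA_n\sin\lambda_nt+B_n\cos\lambda_nt+\int_0^tf_n(\tau)\cos\lambda_n(t-\tau)\,d\tau\Big],$$ $$u^+_{tt}=\sum_{n\ge1}X_n(x)\Big[D_n\cos\lambda_nt+E_n\sin\lambda_nt+\frac1{\lambda_n}\int_0^tf_n''(\tau)\sin\lambda_n(t-\tau)\,d\tau\Big],$$ $$u^+_{xx}=\sum_{n\ge1}X_n(x)\Big[D_n\cos\lambda_nt-f_n(t)+E_n\sin\lambda_nt+\frac1{\lambda_n}\int_0^tf_n''(\tau)\sin\lambda_n(t-\tau)\,d\tau\Big]$$ converge absolutely and uniformly on $\overline{\Omega^+}$, and the series $$u^-(x,t)=\sum_{n\ge1}X_n(x)\Big[A_ne^{\lambda_n^2t}-\int_t^0f_n(\tau)e^{\lambda_n^2(t-\tau)}\,d\tau\Big],\qquad u^-_t=\sum_{n\ge1}X_n(x)\Big[B_ne^{\lambda_n^2t}-\int_t^0f_n'(\tau)e^{\lambda_n^2(t-\tau)}\,d\tau\Big],$$ $$u^-_{xx}=\sum_{n\ge1}X_n(x)\Big[-B_ne^{\lambda_n^2t}+f_n(t)+\int_t^0f_n'(\tau)e^{\lambda_n^2(t-\tau)}\,d\tau\Big],\qquad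 u^-_{tt}=\sum_{n\ge1}X_n(x)\Big[D_ne^{\lambda_n^2t}-\int_t^0f_n''(\tau)e^{\lambda_n^2(t-\tau)}\,d\tau\Big]$$ converge absolutely and uniformly on $\overline{\Omega^-}$; in $\Omega^+$ and $\Omega^-$ respectively, the derivative series are the indicated derivatives of $u^\pm$. The function $u$ equal to $u^+$ for $t\ge0$ and to $u^-$ for $t<0$ is a solution of the following problem: $u\in C(\overline\Omega)$; $u,u_x,u_{xx},u_t,u_{tt}$ exist and are continuous in $\Omega$; $u_{tt}-u_{xx}=f$ in $\Omega^+$ and $u_t+u_{xx}=f$ in $\Omega^-$; $u(0,t)=u(p,t)=0$ for $-T<t<T$; and for $0<x<p$ $$u(x,+0)=u(x,-0),\qquad u_t(x,+0)=u_t(x,-0),\qquad u_{tt}(x,+0)=u_{tt}(x,-0).$$ Moreover $u$ satisfies $$\lim_{x\to0}x\,u_x(x,t)=0,\qquad\lim_{x\to p}(p-x)\,u_x(x,t)=0\qquad(-T<t<T),$$ and every solution of the problem that satisfies these two limit conditions equals $u$ on $\overline\Omega$. -/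

import Mathlib

open Set Filter Topology MeasureTheory

namespace MixedProblem

noncomputable section

/-! ### Domains -/

/-- The open rectangle `Ω = (0, p) × (-T, T)`. -/
def Omega (p T : ℝ) : Set (ℝ × ℝ) := Ioo 0 p ×ˢ Ioo (-T) T

/-- The upper half `Ω⁺ = Ω ∩ {t > 0}`. -/
def OmegaPlus (p T : ℝ) : Set (ℝ × ℝ) := Omega p T ∩ {z | 0 < z.2}

/-- The lower half `Ω⁻ = Ω ∩ {t < 0}`. -/
def OmegaMinus (p T : ℝ) : Set (ℝ × ℝ) := Omega p T ∩ {z | z.2 < 0}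

/-- The closed rectangle `[0, p] × [-T, T]`. -/
def ClosedOmega (p T : ℝ) : Set (ℝ × ℝ) := Icc 0 p ×ˢ Icc (-T) T

/-- The closed upper half-rectangle `[0, p] × [0, T]`. -/
def ClosedOmegaPlus (p T : ℝ) : Set (ℝ × ℝ) := Icc 0 p ×ˢ Icc 0 T

/-- The closed lower half-rectangle `[0, p] × [-T, 0]`. -/
def ClosedOmegaMinus (p T : ℝ) : Set (ℝ × ℝ) := Icc 0 p ×ˢ Icc (-T) 0

/-! ### Partial derivatives and function classes -/

/-- The partial derivative in the first variable `x`. -/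
def dX (u : ℝ → ℝ → ℝ) : ℝ → ℝ → ℝ := fun x t => deriv (fun s => u s t) x

/-- The partial derivative in the second variable `t`. -/
def dT (u : ℝ → ℝ → ℝ) : ℝ → ℝ → ℝ := fun x t => deriv (fun s => u x s) t

/-- Class `C^{2,2}_{x,t}(S)`, for an open set `S`: the derivatives `u_x`, `u_xx`, `u_t`, `u_tt`
exist at every point of `S`, and they and `u` are continuous on `S`. -/
structure IsC22 (S : Set (ℝ × ℝ)) (u : ℝ → ℝ → ℝ) : Prop where
  diff_x : ∀ x t, (x, t) ∈ S → DifferentiableAt ℝ (fun s => u s t) x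
  diff_xx : ∀ x t, (x, t) ∈ S → DifferentiableAt ℝ (fun s => dX u s t) x
  diff_t : ∀ x t, (x, t) ∈ S → DifferentiableAt ℝ (fun s => u x s) t
  diff_tt : ∀ x t, (x, t) ∈ S → DifferentiableAt ℝ (fun s => dT u x s) t
  cont : ContinuousOn (fun z : ℝ × ℝ => u z.1 z.2) S
  cont_x : ContinuousOn (fun z : ℝ × ℝ => dX u z.1 z.2) S
  cont_xx : ContinuousOn (fun z : ℝ × ℝ => dX (dX u) z.1 z.2) S
  cont_t : ContinuousOn (fun z : ℝ × ℝ => dT u z.1 z.2) S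
  cont_tt : ContinuousOn (fun z : ℝ × ℝ => dT (dT u) z.1 z.2) S

/-- Class `C¹` on the closed rectangle: `f` is continuous there, has both first partial
derivatives in the open rectangle, and these extend continuously to the closed rectangle. -/
structure IsC1Closed (p T : ℝ) (f : ℝ → ℝ → ℝ) : Prop where
  cont : ContinuousOn (fun z : ℝ × ℝ => f z.1 z.2) (ClosedOmega p T)
  diff_x : ∀ x t, (x, t) ∈ Omega p T → DifferentiableAt ℝ (fun s => f s t) x
  diff_t : ∀ x t, (x, t) ∈ Omega p T → DifferentiableAt ℝ (fun s => f x s) t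
  ext_x : ∃ g : ℝ × ℝ → ℝ, ContinuousOn g (ClosedOmega p T) ∧
    ∀ x t, (x, t) ∈ Omega p T → g (x, t) = dX f x t
  ext_t : ∃ g : ℝ × ℝ → ℝ, ContinuousOn g (ClosedOmega p T) ∧
    ∀ x t, (x, t) ∈ Omega p T → g (x, t) = dT f x t

/-- `g` is the weak (distributional) derivative `∂²f/∂t²` on the open set `S`. -/
def IsWeakDTT (S : Set (ℝ × ℝ)) (f : ℝ → ℝ → ℝ) (g : ℝ × ℝ → ℝ) : Prop :=
  ∀ φ : ℝ → ℝ → ℝ, ContDiff ℝ (⊤ : ℕ∞) (fun z : ℝ × ℝ => φ z.1 z.2) →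
    HasCompactSupport (fun z : ℝ × ℝ => φ z.1 z.2) →
    tsupport (fun z : ℝ × ℝ => φ z.1 z.2) ⊆ S →
    ∫ z in S, f z.1 z.2 * dT (dT φ) z.1 z.2 = ∫ z in S, g z * φ z.1 z.2

/-- `∂²f/∂t² ∈ L₂(Ω)`. -/
def DTTMemL2 (p T : ℝ) (f : ℝ → ℝ → ℝ) : Prop :=
  ∃ g : ℝ × ℝ → ℝ, MemLp g 2 (volume.restrict (Omega p T)) ∧ IsWeakDTT (Omega p T) f g

/-- `∂f/∂x` is Hölder continuous in `x` with exponent `α`, uniformly in `t`. (For `f` of class `C¹`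
on the closed rectangle the inequality extends to the closed rectangle by continuity.) -/
def DXHolder (p T α : ℝ) (f : ℝ → ℝ → ℝ) : Prop :=
  ∃ C : ℝ, ∀ t ∈ Ioo (-T) T, ∀ x ∈ Ioo 0 p, ∀ y ∈ Ioo 0 p,
    |dX f x t - dX f y t| ≤ C * |x - y| ^ α

/-! ### The boundary value problem -/

/-- `w(x, +0) = w(x, -0)` for `0 < x < p`: both one-sided limits exist and are equal. -/
def Matches (p : ℝ) (w : ℝ → ℝ → ℝ) : Prop :=
  ∀ x ∈ Ioo 0 p, ∃ L : ℝ, Tendsto (fun t => w x t) (𝓝[>] 0) (𝓝 L) ∧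
    Tendsto (fun t => w x t) (𝓝[<] 0) (𝓝 L)

/-- `u` is a solution of the boundary value problem with three conjugation conditions. -/
structure IsSolution (p T : ℝ) (f u : ℝ → ℝ → ℝ) : Prop where
  cont : ContinuousOn (fun z : ℝ × ℝ => u z.1 z.2) (ClosedOmega p T)
  c22 : IsC22 (Omega p T) u
  eq_plus : ∀ x t, (x, t) ∈ OmegaPlus p T → dT (dT u) x t - dX (dX u) x t = f x t
  eq_minus : ∀ x t, (x, t) ∈ OmegaMinus p T → dT u x t + dX (dX u) x t = f x t
  left : ∀ t ∈ Ioo (-T) T, u 0 t = 0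
  right : ∀ t ∈ Ioo (-T) T, u p t = 0
  conj_u : Matches p u
  conj_ut : Matches p (dT u)
  conj_utt : Matches p (dT (dT u))

/-- `x u_x → 0` as `x → 0` and `(p - x) u_x → 0` as `x → p`, for every `t`. -/
def EdgeCondition (p T : ℝ) (u : ℝ → ℝ → ℝ) : Prop :=
  ∀ t ∈ Ioo (-T) T, Tendsto (fun x => x * dX u x t) (𝓝[>] 0) (𝓝 0) ∧
    Tendsto (fun x => (p - x) * dX u x t) (𝓝[<] p) (𝓝 0)

/-! ### Fourier data -/

/-- `λ_n = n π / p`. -/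
def lam (p : ℝ) (n : ℕ) : ℝ := n * Real.pi / p

/-- `X_n(x) = √(2/p) sin (λ_n x)`. -/
def X (p : ℝ) (n : ℕ) (x : ℝ) : ℝ := Real.sqrt (2 / p) * Real.sin (lam p n * x)

/-- `f_n(t) = ∫₀ᵖ f(x, t) X_n(x) dx`. -/
def fn (p : ℝ) (f : ℝ → ℝ → ℝ) (n : ℕ) (t : ℝ) : ℝ := ∫ x in (0 : ℝ)..p, f x t * X p n x

/-- `f_n'`. -/
def fn1 (p : ℝ) (f : ℝ → ℝ → ℝ) (n : ℕ) (t : ℝ) : ℝ := deriv (fn p f n) t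

/-- `f_n''`; under the hypotheses used here `f_n'` is absolutely continuous and this exists for
almost every `t`. -/
def fn2 (p : ℝ) (f : ℝ → ℝ → ℝ) (n : ℕ) (t : ℝ) : ℝ := deriv (fn1 p f n) t

/-! ### Terms of the series (for `n ≥ 1`) -/

/-- The `n`-th term of the series for `u⁺`. -/
def termPlus (p : ℝ) (f : ℝ → ℝ → ℝ) (n : ℕ) (x t : ℝ) : ℝ :=
  X p n x *
    (((1 - lam p n ^ 2) * fn p f n 0 - fn1 p f n 0) / (lam p n ^ 2 * (lam p n ^ 2 + 1)) *
        Real.cos (lam p n * t)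
      + (2 * fn p f n 0 - fn1 p f n 0) / (lam p n * (lam p n ^ 2 + 1)) * Real.sin (lam p n * t)
      + 1 / lam p n * ∫ τ in (0 : ℝ)..t, fn p f n τ * Real.sin (lam p n * (t - τ)))

/-- The `n`-th term of the series for `u⁻`. -/
def termMinus (p : ℝ) (f : ℝ → ℝ → ℝ) (n : ℕ) (x t : ℝ) : ℝ :=
  X p n x *
    (((1 - lam p n ^ 2) * fn p f n 0 - fn1 p f n 0) / (lam p n ^ 2 * (lam p n ^ 2 + 1)) *
        Real.exp (lam p n ^ 2 * t)
      - ∫ τ in t..(0 : ℝ), fn p f n τ * Real.exp (lam p n ^ 2 * (t - τ)))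

/-- The `n`-th term of the series for `∂u⁺/∂t`. -/
def termPlusT (p : ℝ) (f : ℝ → ℝ → ℝ) (n : ℕ) (x t : ℝ) : ℝ :=
  X p n x *
    (((lam p n ^ 2 - 1) * fn p f n 0 + fn1 p f n 0) / (lam p n * (lam p n ^ 2 + 1)) *
        Real.sin (lam p n * t)
      + (2 * fn p f n 0 - fn1 p f n 0) / (lam p n ^ 2 + 1) * Real.cos (lam p n * t)
      + ∫ τ in (0 : ℝ)..t, fn p f n τ * Real.cos (lam p n * (t - τ)))

/-- The `n`-th term of the series for `∂u⁻/∂t`. -/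
def termMinusT (p : ℝ) (f : ℝ → ℝ → ℝ) (n : ℕ) (x t : ℝ) : ℝ :=
  X p n x *
    ((2 * fn p f n 0 - fn1 p f n 0) / (lam p n ^ 2 + 1) * Real.exp (lam p n ^ 2 * t)
      - ∫ τ in t..(0 : ℝ), fn1 p f n τ * Real.exp (lam p n ^ 2 * (t - τ)))

/-- The `n`-th term of the series for `∂²u⁺/∂t²`. -/
def termPlusTT (p : ℝ) (f : ℝ → ℝ → ℝ) (n : ℕ) (x t : ℝ) : ℝ :=
  X p n x *
    ((2 * lam p n ^ 2 * fn p f n 0 + fn1 p f n 0) / (lam p n ^ 2 + 1) * Real.cos (lam p n * t)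
      + ((2 * lam p n ^ 2 + 1) * fn1 p f n 0 - 2 * lam p n ^ 2 * fn p f n 0) /
          (lam p n * (lam p n ^ 2 + 1)) * Real.sin (lam p n * t)
      + 1 / lam p n * ∫ τ in (0 : ℝ)..t, fn2 p f n τ * Real.sin (lam p n * (t - τ)))

/-- The `n`-th term of the series for `∂²u⁺/∂x²`. -/
def termPlusXX (p : ℝ) (f : ℝ → ℝ → ℝ) (n : ℕ) (x t : ℝ) : ℝ :=
  X p n x *
    ((2 * lam p n ^ 2 * fn p f n 0 + fn1 p f n 0) / (lam p n ^ 2 + 1) * Real.cos (lam p n * t)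
      - fn p f n t
      + ((2 * lam p n ^ 2 + 1) * fn1 p f n 0 - 2 * lam p n ^ 2 * fn p f n 0) /
          (lam p n * (lam p n ^ 2 + 1)) * Real.sin (lam p n * t)
      + 1 / lam p n * ∫ τ in (0 : ℝ)..t, fn2 p f n τ * Real.sin (lam p n * (t - τ)))

/-- The `n`-th term of the series for `∂²u⁻/∂x²`. -/
def termMinusXX (p : ℝ) (f : ℝ → ℝ → ℝ) (n : ℕ) (x t : ℝ) : ℝ :=
  X p n x *
    ((fn1 p f n 0 - 2 * fn p f n 0) / (lam p n ^ 2 + 1) * Real.exp (lam p n ^ 2 * t)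
      + fn p f n t
      + ∫ τ in t..(0 : ℝ), fn1 p f n τ * Real.exp (lam p n ^ 2 * (t - τ)))

/-- The `n`-th term of the series for `∂²u⁻/∂t²`. -/
def termMinusTT (p : ℝ) (f : ℝ → ℝ → ℝ) (n : ℕ) (x t : ℝ) : ℝ :=
  X p n x *
    ((2 * lam p n ^ 2 * fn p f n 0 + fn1 p f n 0) / (lam p n ^ 2 + 1) *
        Real.exp (lam p n ^ 2 * t)
      - ∫ τ in t..(0 : ℝ), fn2 p f n τ * Real.exp (lam p n ^ 2 * (t - τ)))

/-! ### Sums of the series -/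

/-- The sum `∑_{n ≥ 1} F_n(x, t)`. -/
def seriesSum (F : ℕ → ℝ → ℝ → ℝ) (x t : ℝ) : ℝ := ∑' k : ℕ, F (k + 1) x t

/-- The series `∑_{n ≥ 1} F_n(x, t)` converges absolutely and uniformly on `S`: it converges
absolutely at each point, and the partial sums of `∑ F_n` and of `∑ |F_n|` converge uniformly. -/
structure ConvergesAbsUnif (F : ℕ → ℝ → ℝ → ℝ) (S : Set (ℝ × ℝ)) : Prop where
  abs : ∀ z ∈ S, Summable (fun k : ℕ => |F (k + 1) z.1 z.2|)
  unif : TendstoUniformlyOn (fun (N : ℕ) (z : ℝ × ℝ) => ∑ k ∈ Finset.range N, F (k + 1) z.1 z.2)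
    (fun z => seriesSum F z.1 z.2) atTop S
  unif_abs : TendstoUniformlyOn
    (fun (N : ℕ) (z : ℝ × ℝ) => ∑ k ∈ Finset.range N, |F (k + 1) z.1 z.2|)
    (fun z => ∑' k : ℕ, |F (k + 1) z.1 z.2|) atTop S

/-- The function `u⁺`. -/
def uPlus (p : ℝ) (f : ℝ → ℝ → ℝ) : ℝ → ℝ → ℝ := seriesSum (termPlus p f)

/-- The function `u⁻`. -/
def uMinus (p : ℝ) (f : ℝ → ℝ → ℝ) : ℝ → ℝ → ℝ := seriesSum (termMinus p f)

/-- The function `u` equal to `u⁺` for `t > 0` and to `u⁻` for `t < 0` (at `t = 0` the two series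
coincide term by term). -/
def uSol (p : ℝ) (f : ℝ → ℝ → ℝ) (x t : ℝ) : ℝ :=
  if 0 ≤ t then uPlus p f x t else uMinus p f x t

/-- On the open set `S` the function `u` has first and second derivatives in `t` and in `x`, and
`u_t`, `u_tt`, `u_xx` are `v`, `w`, `y`. -/
def HasDerivatives (S : Set (ℝ × ℝ)) (u v w y : ℝ → ℝ → ℝ) : Prop :=
  ∀ x t, (x, t) ∈ S →
    HasDerivAt (fun s => u x s) (v x t) t ∧
    HasDerivAt (fun s => v x s) (w x t) t ∧
    DifferentiableAt ℝ (fun s => u s t) x ∧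
    HasDerivAt (fun s => dX u s t) (y x t) x

end

end MixedProblem

open MixedProblem

/-! ### Parameter integrals and series with a summable majorant -/

namespace MixedProblem

/-! Existence is separation of variables. For u = ∑ X_n u_n the equations become u_n'' + λ_n² u_n =
f_n for t > 0 and u_n' - λ_n² u_n = f_n for t < 0. They leave three free constants, and matching
u_n, u_n', u_n'' at t = 0 fixes all three: it gives (λ_n² + λ_n⁴) u_n(0) = (1 - λ_n²) f_n(0) -
f_n'(0), hence A_n, and the factor on the left never vanishes.

Convergence is delicate only for u_xx and u_tt, where a factor λ_n² appears. Integration by parts in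
time trades it for f_n' and f_n'' (`ModeData.mul_convSin`, `ModeData.mul_convExp`). What remains is
bounded by a constant times sup |f_n| + f_n'(0)² + 1/λ_n² + ∫ f_n'² + ∫ f_n''². The first summand is
O(n^(-1-α)): one integration by parts in x, then the Hölder condition (`exists_summable_bound_fn`).
The squares are summable by Bessel's inequality, for t = 0 or integrated over t
(`exists_modeBounds`). Here f_n' must be the primitive of the sine coefficient of the weak
derivative of f, which is du Bois-Reymond's lemma after testing with X_n(x) η(t)
(`fn1_eq_integral`). The termwise equations sum to f because f is the sum of its sine series
(`hasSum_sineSeries`), and the two halves join smoothly because the time factors agree at t = 0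
(`modes_zero`, `hasDerivAt_of_hasDerivAt_punctured`).

For uniqueness, let w be the difference of two solutions. Its sine moments over [ε, p - ε] satisfy
the same ordinary differential equations, with an extra term containing only the values of w at x =
ε and x = p - ε, because the sine kills w_x there. Matching at t = 0 differentiates this term, so
w_t(x, 0) → 0 is needed at the two corners, where regularity is given only inside Ω. D'Alembert's
formula supplies it: near a corner w_t(x, 0) is a difference of two values of a function that is
continuous on an interior vertical line (`IsNullSolution.tendsto_wt_zero_left`). As ε → 0 all extra
terms vanish, so the moment at t = 0 is zero (`IsNullSolution.moment_zero_zero`), then every moment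
is zero, and w is the sum of a vanishing sine series (`IsNullSolution.eq_zero`). -/

theorem continuousOn_intervalIntegral_param {a b : ℝ} (hab : a ≤ b) {I : Set ℝ} {F : ℝ → ℝ → ℝ}
    (hF : ContinuousOn (fun z : ℝ × ℝ => F z.1 z.2) (Icc a b ×ˢ I)) :
    ContinuousOn (fun t => ∫ x in a..b, F x t) I := by
  rw [continuousOn_iff_continuous_domRestrict]
  -- Clamping x to [a, b] makes the integrand continuous for all real x without changing the
  -- integral.
  have h : Continuous (Function.uncurry fun (t : I) (x : ℝ) => F (projIcc a b hab x) t) := by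
    refine hF.comp_continuous
      (f := fun z : I × ℝ => ((projIcc a b hab z.2 : ℝ), (z.1 : ℝ))) (by fun_prop) ?_
    intro z
    exact ⟨(projIcc a b hab z.2).2, z.1.2⟩
  refine (intervalIntegral.continuous_parametric_intervalIntegral_of_continuous'
    (μ := volume) h a b).congr ?_
  intro t
  refine intervalIntegral.integral_congr fun x hx => ?_
  rw [uIcc_of_le hab] at hx
  simp only [projIcc_of_mem hab hx]

/-- Domination by the maximum of |G| over the compact set [a, b] × (closed ball around t). The
derivative is required only for x in the open interval, since the end points form a null set; this
fits functions that are differentiable only inside the rectangle. -/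
theorem hasDerivAt_intervalIntegral_param {a b : ℝ} (hab : a ≤ b) {I : Set ℝ} (hI : IsOpen I)
    {F G : ℝ → ℝ → ℝ}
    (hF : ContinuousOn (fun z : ℝ × ℝ => F z.1 z.2) (Icc a b ×ˢ I))
    (hG : ContinuousOn (fun z : ℝ × ℝ => G z.1 z.2) (Icc a b ×ˢ I))
    (hd : ∀ x ∈ Ioo a b, ∀ t ∈ I, HasDerivAt (F x) (G x t) t) {t : ℝ} (ht : t ∈ I) :
    HasDerivAt (fun t => ∫ x in a..b, F x t) (∫ x in a..b, G x t) t := by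
  obtain ⟨δ, hδ, hball⟩ := Metric.nhds_basis_closedBall.mem_iff.1 (hI.mem_nhds ht)
  obtain ⟨C, hC⟩ := (isCompact_Icc.prod (isCompact_closedBall t δ)).exists_bound_of_continuousOn
    (hG.mono (prod_mono_right hball) : ContinuousOn _ (Icc a b ×ˢ Metric.closedBall t δ))
  have slice : ∀ {H : ℝ → ℝ → ℝ}, ContinuousOn (fun z : ℝ × ℝ => H z.1 z.2) (Icc a b ×ˢ I) →
      ∀ s ∈ I, ContinuousOn (fun x => H x s) (Icc a b) := fun hH s hs =>
    hH.comp (f := fun x => (x, s)) (by fun_prop) fun x hx => ⟨hx, hs⟩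
  have hmeas : ∀ {H : ℝ → ℝ → ℝ}, ContinuousOn (fun z : ℝ × ℝ => H z.1 z.2) (Icc a b ×ˢ I) →
      ∀ s ∈ I, AEStronglyMeasurable (fun x => H x s) (volume.restrict (uIoc a b)) := by
    intro H hH s hs
    rw [uIoc_of_le hab]
    exact ((slice hH s hs).mono Ioc_subset_Icc_self).aestronglyMeasurable measurableSet_Ioc
  refine (intervalIntegral.hasDerivAt_integral_of_dominated_loc_of_deriv_le
    (F := fun s x => F x s) (F' := fun s x => G x s) (bound := fun _ => C)
    (Metric.closedBall_mem_nhds t hδ) ?_ ?_ ?_ ?_ ?_ ?_).2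
  · filter_upwards [hI.mem_nhds ht] with s hs using hmeas hF s hs
  · exact ContinuousOn.intervalIntegrable (by rw [uIcc_of_le hab]; exact slice hF t ht)
  · exact hmeas hG t ht
  · refine Eventually.of_forall fun x hx s hs => ?_
    rw [uIoc_of_le hab] at hx
    exact hC (x, s) ⟨Ioc_subset_Icc_self hx, hs⟩
  · exact intervalIntegrable_const
  · have : ∀ᵐ x : ℝ, x ≠ b := by simp [ae_iff, measure_singleton]
    filter_upwards [this] with x hxb hx s hs
    rw [uIoc_of_le hab] at hx
    exact hd x ⟨hx.1, lt_of_le_of_ne hx.2 hxb⟩ s (hball hs)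

theorem ConvergesAbsUnif.of_bound {F : ℕ → ℝ → ℝ → ℝ} {S : Set (ℝ × ℝ)} {m : ℕ → ℝ}
    (hm : Summable m) (h : ∀ k, ∀ z ∈ S, |F (k + 1) z.1 z.2| ≤ m k) : ConvergesAbsUnif F S where
  abs z hz := Summable.of_nonneg_of_le (fun _ => abs_nonneg _) (fun k => h k z hz) hm
  unif := tendstoUniformlyOn_tsum_nat (f := fun k (z : ℝ × ℝ) => F (k + 1) z.1 z.2) hm
    fun k z hz => h k z hz
  unif_abs := tendstoUniformlyOn_tsum_nat (f := fun k (z : ℝ × ℝ) => |F (k + 1) z.1 z.2|) hm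
    fun k z hz => by simpa using h k z hz

theorem continuousOn_seriesSum {F : ℕ → ℝ → ℝ → ℝ} {S : Set (ℝ × ℝ)} {m : ℕ → ℝ}
    (hm : Summable m) (h : ∀ k, ∀ z ∈ S, |F (k + 1) z.1 z.2| ≤ m k)
    (hc : ∀ k, ContinuousOn (fun z : ℝ × ℝ => F (k + 1) z.1 z.2) S) :
    ContinuousOn (fun z : ℝ × ℝ => seriesSum F z.1 z.2) S :=
  continuousOn_tsum hc hm fun k z hz => h k z hz

/-! ### The sine system: orthonormality, Bessel's inequality, pointwise expansion -/

section SineSystem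

variable {p : ℝ}

theorem lam_pos (hp : 0 < p) (k : ℕ) : 0 < lam p (k + 1) := by
  unfold lam; positivity

theorem lam_succ_ge (hp : 0 < p) (k : ℕ) : Real.pi / p ≤ lam p (k + 1) := by
  unfold lam
  rw [mul_div_assoc]
  refine le_mul_of_one_le_left (by positivity) ?_
  push_cast
  linarith [(Nat.cast_nonneg k : (0 : ℝ) ≤ k)]

theorem lam_mul_right (hp : 0 < p) (n : ℕ) : lam p n * p = n * Real.pi := by
  unfold lam; field_simp

@[fun_prop]
theorem continuous_X (n : ℕ) : Continuous (X p n) := by unfold X; fun_prop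

theorem abs_X_le (n : ℕ) (x : ℝ) : |X p n x| ≤ √(2 / p) := by
  unfold X
  rw [abs_mul, abs_of_nonneg (Real.sqrt_nonneg _)]
  exact mul_le_of_le_one_right (Real.sqrt_nonneg _) (Real.abs_sin_le_one _)

@[simp] theorem X_zero (n : ℕ) : X p n 0 = 0 := by simp [X]

theorem X_right (hp : 0 < p) (n : ℕ) : X p n p = 0 := by
  simp [X, lam_mul_right hp, Real.sin_nat_mul_pi]

/-- The derivative of `X p n`. -/
noncomputable def dXn (p : ℝ) (n : ℕ) (x : ℝ) : ℝ := √(2 / p) * (lam p n * Real.cos (lam p n * x))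

@[fun_prop]
theorem continuous_dXn (n : ℕ) : Continuous (dXn p n) := by unfold dXn; fun_prop

theorem hasDerivAt_X (n : ℕ) (x : ℝ) : HasDerivAt (X p n) (dXn p n x) x := by
  have := ((hasDerivAt_id x).const_mul (lam p n)).sin.const_mul √(2 / p)
  refine this.congr_deriv ?_
  simp only [dXn, id]; ring

theorem hasDerivAt_dXn (n : ℕ) (x : ℝ) : HasDerivAt (dXn p n) (-lam p n ^ 2 * X p n x) x := by
  have := (((hasDerivAt_id x).const_mul (lam p n)).cos.const_mul (lam p n)).const_mul √(2 / p)
  refine this.congr_deriv ?_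
  simp only [X, id]; ring

theorem abs_dXn_le (hp : 0 < p) (k : ℕ) (x : ℝ) :
    |dXn p (k + 1) x| ≤ √(2 / p) * lam p (k + 1) := by
  unfold dXn
  rw [abs_mul, abs_of_nonneg (Real.sqrt_nonneg _), abs_mul, abs_of_pos (lam_pos hp k)]
  gcongr
  exact mul_le_of_le_one_right (lam_pos hp k).le (Real.abs_cos_le_one _)

theorem integral_X_mul_X (hp : 0 < p) (j k : ℕ) :
    ∫ x in (0 : ℝ)..p, X p (j + 1) x * X p (k + 1) x = if j = k then 1 else 0 := by
  have hcos : ∀ m : ℤ, m ≠ 0 → ∫ x in (0 : ℝ)..p, Real.cos (m * Real.pi / p * x) = 0 := by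
    intro m hm
    have hm' : (m : ℝ) * Real.pi / p ≠ 0 := by
      have : (m : ℝ) ≠ 0 := by exact_mod_cast hm
      positivity
    rw [intervalIntegral.integral_comp_mul_left (fun y => Real.cos y) hm', integral_cos]
    have : (m : ℝ) * Real.pi / p * p = m * Real.pi := by field_simp
    simp [this, Real.sin_int_mul_pi]
  -- Product-to-sum formula. The indices start at 1, so the sum frequency j + k + 2 is never zero,
  -- and the difference frequency is zero only for j = k.
  have hprod : ∀ x, X p (j + 1) x * X p (k + 1) x =
      1 / p * (Real.cos (((j : ℤ) - k : ℤ) * Real.pi / p * x)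
        - Real.cos (((j : ℤ) + k + 2 : ℤ) * Real.pi / p * x)) := by
    intro x
    have h2 : √(2 / p) * √(2 / p) = 2 / p := Real.mul_self_sqrt (by positivity)
    have e1 : (((j : ℤ) - k : ℤ) : ℝ) * Real.pi / p * x = lam p (j + 1) * x - lam p (k + 1) * x := by
      simp only [lam]; push_cast; ring
    have e2 : (((j : ℤ) + k + 2 : ℤ) : ℝ) * Real.pi / p * x
        = lam p (j + 1) * x + lam p (k + 1) * x := by
      simp only [lam]; push_cast; ring
    rw [e1, e2, Real.cos_sub, Real.cos_add]
    simp only [X]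
    linear_combination (Real.sin (lam p (j + 1) * x) * Real.sin (lam p (k + 1) * x)) * h2
  simp only [hprod]
  rw [intervalIntegral.integral_const_mul, intervalIntegral.integral_sub
    (Continuous.intervalIntegrable (by fun_prop) _ _)
    (Continuous.intervalIntegrable (by fun_prop) _ _), hcos ((j : ℤ) + k + 2) (by omega)]
  split_ifs with h
  · subst h
    simp [hp.ne']
  · rw [hcos _ (by omega)]; simp

/-- Bessel's inequality for the sine system on `(0, p)`. -/
theorem sum_sq_sineCoeff_le (hp : 0 < p) {h : ℝ → ℝ}
    (hh : MemLp h 2 (volume.restrict (Ioc 0 p))) (N : ℕ) :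
    ∑ k ∈ Finset.range N, (∫ x in (0 : ℝ)..p, h x * X p (k + 1) x) ^ 2
      ≤ ∫ x in (0 : ℝ)..p, h x ^ 2 := by
  set c : ℕ → ℝ := fun k => ∫ x in (0 : ℝ)..p, h x * X p (k + 1) x
  have hint : IntervalIntegrable h volume 0 p :=
    (intervalIntegrable_iff_integrableOn_Ioc_of_le hp.le).2
      (hh.integrable (by norm_num))
  have hsq : IntervalIntegrable (fun x => h x ^ 2) volume 0 p :=
    (intervalIntegrable_iff_integrableOn_Ioc_of_le hp.le).2 hh.integrable_sq
  set P : ℝ → ℝ := fun x => ∑ k ∈ Finset.range N, c k * X p (k + 1) x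
  have hPc : Continuous P := by fun_prop
  have hhP : ∫ x in (0 : ℝ)..p, h x * P x = ∑ k ∈ Finset.range N, c k ^ 2 := by
    simp only [P, Finset.mul_sum]
    rw [intervalIntegral.integral_finsetSum]
    · refine Finset.sum_congr rfl fun k _ => ?_
      rw [sq, ← intervalIntegral.integral_const_mul]
      exact intervalIntegral.integral_congr fun x _ => by ring
    · intro k _
      exact hint.mul_continuousOn (by fun_prop)
  have hPP : ∫ x in (0 : ℝ)..p, P x * P x = ∑ k ∈ Finset.range N, c k ^ 2 := by
    have e : ∀ x, P x * P x = ∑ k ∈ Finset.range N, ∑ j ∈ Finset.range N,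
        c k * c j * (X p (k + 1) x * X p (j + 1) x) := by
      intro x
      simp only [P, Finset.sum_mul_sum]
      exact Finset.sum_congr rfl fun k _ => Finset.sum_congr rfl fun j _ => by ring
    simp only [e]
    rw [intervalIntegral.integral_finsetSum
      (fun k _ => Continuous.intervalIntegrable (by fun_prop) _ _)]
    refine Finset.sum_congr rfl fun k hk => ?_
    rw [intervalIntegral.integral_finsetSum
      (fun k _ => Continuous.intervalIntegrable (by fun_prop) _ _)]
    simp only [intervalIntegral.integral_const_mul, integral_X_mul_X hp]
    simp [Finset.mem_range.1 hk, sq]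
  -- The squared distance from h to its partial sum P expands to ∫ h² minus the sum of the squared
  -- coefficients.
  have hnn : 0 ≤ ∫ x in (0 : ℝ)..p, (h x - P x) ^ 2 :=
    intervalIntegral.integral_nonneg hp.le fun x _ => sq_nonneg _
  have hexp : ∫ x in (0 : ℝ)..p, (h x - P x) ^ 2
      = (∫ x in (0 : ℝ)..p, h x ^ 2) - 2 * (∫ x in (0 : ℝ)..p, h x * P x)
        + ∫ x in (0 : ℝ)..p, P x * P x := by
    rw [← intervalIntegral.integral_const_mul, ← intervalIntegral.integral_sub hsq
      ((hint.mul_continuousOn (by fun_prop)).const_mul 2), ← intervalIntegral.integral_add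
      (hsq.sub ((hint.mul_continuousOn (by fun_prop)).const_mul 2))
      (Continuous.intervalIntegrable (by fun_prop) _ _)]
    exact intervalIntegral.integral_congr fun x _ => by ring
  rw [hexp, hhP, hPP] at hnn
  linarith

open Complex in
/-- A continuous function on `[0, p]` that vanishes at the end points and has summable sine
coefficients is the sum of its sine series. -/
theorem hasSum_sineSeries (hp : 0 < p) {h : ℝ → ℝ} (hc : ContinuousOn h (Icc 0 p))
    (h0 : h 0 = 0) (h1 : h p = 0)
    (hs : Summable fun k : ℕ => |∫ x in (0 : ℝ)..p, h x * X p (k + 1) x|)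
    {x : ℝ} (hx : x ∈ Icc 0 p) :
    HasSum (fun k : ℕ => (∫ y in (0 : ℝ)..p, h y * X p (k + 1) y) * X p (k + 1) x) (h x) := by
  have : Fact (0 < 2 * p) := ⟨by positivity⟩
  -- The odd extension of h, written without cases: for each sign of x one of the two terms is h 0 =
  -- 0. Since h p = 0, it takes equal values at -p and p and is continuous on the circle of length
  -- 2p.
  set H : ℝ → ℂ := fun x => ((h (max x 0) - h (max (-x) 0) : ℝ) : ℂ)
  have hHpos : ∀ x, 0 ≤ x → H x = h x := by
    intro x hx; simp [H, hx, h0]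
  have hHneg : ∀ x, 0 ≤ x → H (-x) = -h x := by
    intro x hx; simp [H, hx, h0]
  have hHc : ContinuousOn H (Icc (-p) (-p + 2 * p)) := by
    refine continuous_ofReal.comp_continuousOn (ContinuousOn.sub ?_ ?_)
    · refine hc.comp (f := fun x => max x 0) (by fun_prop) fun x hx => ⟨le_max_right _ _, ?_⟩
      exact max_le (by linarith [hx.2]) hp.le
    · refine hc.comp (f := fun x => max (-x) 0) (by fun_prop) fun x hx => ⟨le_max_right _ _, ?_⟩
      exact max_le (by linarith [hx.1]) hp.le
  have hHend : H (-p) = H (-p + 2 * p) := by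
    rw [show -p + 2 * p = p by ring, hHneg p hp.le, hHpos p hp.le, h1]; simp
  set Fc : C(AddCircle (2 * p), ℂ) :=
    ⟨AddCircle.liftIoc (2 * p) (-p) H, AddCircle.liftIoc_continuous hHend hHc⟩
  set s : ℤ → ℝ := fun k => ∫ x in (0 : ℝ)..p, h x * Real.sin (k * Real.pi / p * x)
  have hcH : ContinuousOn H (uIcc 0 p) := hHc.mono (by
    rw [uIcc_of_le hp.le]; exact Icc_subset_Icc (by linarith) (by linarith))
  have hcH' : ContinuousOn H (uIcc (-p) 0) := hHc.mono (by
    rw [uIcc_of_le (by linarith)]; exact Icc_subset_Icc (by linarith) (by linarith))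
  -- By oddness, folding the integral over [-p, p] onto [0, p] leaves only the sine part of the
  -- exponential.
  have hcoeff : ∀ k : ℤ, fourierCoeff Fc k = -I / p * s k := by
    intro k
    change fourierCoeff (AddCircle.liftIoc (2 * p) (-p) H) k = _
    rw [fourierCoeff_eq_intervalIntegral _ _ (-p)]
    have hlift : ∫ x in (-p)..(-p + 2 * p), (fourier (-k) (x : AddCircle (2 * p)) : ℂ) •
          AddCircle.liftIoc (2 * p) (-p) H x
        = ∫ x in (-p)..p, (fourier (-k) (x : AddCircle (2 * p)) : ℂ) • H x := by
      rw [show -p + 2 * p = p by ring, intervalIntegral.integral_of_le (by linarith),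
        intervalIntegral.integral_of_le (by linarith)]
      refine setIntegral_congr_fun measurableSet_Ioc fun x hx => ?_
      simp only [AddCircle.liftIoc_coe_apply (a := -p) (p := 2 * p) (f := H)
        (show x ∈ Ioc (-p) (-p + 2 * p) by convert hx using 2; ring)]
    have hfe : ∀ x : ℝ, (fourier (-k) (x : AddCircle (2 * p)) : ℂ)
        = exp (-(k * Real.pi / p * x : ℝ) * I) := by
      intro x
      rw [fourier_coe_apply]
      congr 1
      push_cast
      have : (p : ℂ) ≠ 0 := by exact_mod_cast hp.ne'
      field_simp
    have hfe' : ∀ a b : ℝ, (fun x : ℝ => (fourier (-k) (x : AddCircle (2 * p)) : ℂ) • H x)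
        = fun x : ℝ => exp (-(k * Real.pi / p * x : ℝ) * I) * H x := by
      intro a b; funext x; rw [hfe, smul_eq_mul]
    have key : ∫ x in (-p)..p, (fourier (-k) (x : AddCircle (2 * p)) : ℂ) • H x
        = -(2 * I) * s k := by
      rw [hfe' 0 0, ← intervalIntegral.integral_add_adjacent_intervals (b := 0)
        (ContinuousOn.intervalIntegrable (by fun_prop))
        (ContinuousOn.intervalIntegrable (by fun_prop))]
      have hneg : ∫ x in (-p)..0, exp (-(k * Real.pi / p * x : ℝ) * I) * H x
          = ∫ x in (0 : ℝ)..p, exp ((k * Real.pi / p * x : ℝ) * I) * (-h x) := by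
        have := intervalIntegral.integral_comp_neg (a := 0) (b := p)
          (fun x : ℝ => exp (-(k * Real.pi / p * x : ℝ) * I) * H x)
        rw [neg_zero] at this
        rw [← this]
        refine intervalIntegral.integral_congr fun x hx => ?_
        rw [uIcc_of_le hp.le] at hx
        simp only [hHneg x hx.1]
        congr 2
        push_cast; ring
      have hpos : ∫ x in (0 : ℝ)..p, exp (-(k * Real.pi / p * x : ℝ) * I) * H x
          = ∫ x in (0 : ℝ)..p, exp (-(k * Real.pi / p * x : ℝ) * I) * h x := by
        refine intervalIntegral.integral_congr fun x hx => ?_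
        rw [uIcc_of_le hp.le] at hx
        simp only [hHpos x hx.1]
      have hcr : ContinuousOn (fun x => (h x : ℂ)) (uIcc 0 p) := by
        rw [uIcc_of_le hp.le]; exact continuous_ofReal.comp_continuousOn hc
      rw [hneg, hpos, ← intervalIntegral.integral_add
        (ContinuousOn.intervalIntegrable (by fun_prop))
        (ContinuousOn.intervalIntegrable (by fun_prop)), ← intervalIntegral.integral_ofReal,
        ← intervalIntegral.integral_const_mul]
      refine intervalIntegral.integral_congr fun x _ => ?_
      simp only [ofReal_mul, ofReal_sin]
      rw [Complex.sin]
      push_cast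
      ring_nf
      simp only [I_sq]
      ring
    rw [hlift, key]
    have : (p : ℂ) ≠ 0 := by exact_mod_cast hp.ne'
    simp only [real_smul]
    push_cast
    field_simp
  have hsneg : ∀ k : ℤ, s (-k) = -s k := by
    intro k
    simp only [s]
    rw [← intervalIntegral.integral_neg]
    refine intervalIntegral.integral_congr fun x _ => ?_
    simp only [Int.cast_neg, neg_mul, neg_div, Real.sin_neg, mul_neg]
  have hsX : ∀ k : ℕ, ∫ x in (0 : ℝ)..p, h x * X p (k + 1) x = √(2 / p) * s (k + 1 : ℤ) := by
    intro k
    simp only [s]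
    rw [← intervalIntegral.integral_const_mul]
    refine intervalIntegral.integral_congr fun x _ => ?_
    simp only [X, lam]; push_cast; ring
  have h2p : 0 < √(2 / p) := Real.sqrt_pos.2 (by positivity)
  have hsn : Summable fun k : ℕ => s k := by
    rw [← summable_nat_add_iff 1]
    have : Summable fun k : ℕ => (√(2 / p))⁻¹ * ∫ x in (0 : ℝ)..p, h x * X p (k + 1) x :=
      hs.of_abs.mul_left _
    refine this.congr fun k => ?_
    rw [hsX, ← mul_assoc, inv_mul_cancel₀ h2p.ne']
    push_cast; ring
  have hsum : Summable (fourierCoeff Fc) := by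
    have e : fourierCoeff Fc = fun k => -I / p * ((s k : ℝ) : ℂ) := funext hcoeff
    rw [e]
    refine Summable.mul_left _ ?_
    refine Summable.of_nat_of_neg (f := fun k : ℤ => ((s k : ℝ) : ℂ)) ?_ ?_
    · exact_mod_cast hsn
    · simp only [hsneg]
      exact_mod_cast hsn.neg
  have hF := has_pointwise_sum_fourier_series_of_summable hsum (x : AddCircle (2 * p))
  have hFx : Fc (x : AddCircle (2 * p)) = h x := by
    change AddCircle.liftIoc (2 * p) (-p) H x = _
    rw [AddCircle.liftIoc_coe_apply ⟨by linarith [hx.1], by linarith [hx.2]⟩, hHpos x hx.1]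
  rw [hFx] at hF
  -- Pairing the frequencies k and -k turns the Fourier series into a sine series. The frequency 0
  -- contributes nothing because `s 0 = 0`, and the index is then shifted to start at 1.
  have hN := hF.nat_add_neg
  have hs0 : s 0 = 0 := by simp [s]
  simp only [hcoeff, hs0] at hN
  have hN' := (hasSum_nat_add_iff' 1).2 hN
  simp only [Finset.range_one, Finset.sum_singleton, Nat.cast_zero, neg_zero, hs0] at hN'
  rw [← Complex.hasSum_ofReal]
  convert! hN' using 1
  · funext k
    rw [hsX k]
    have hpc : (p : ℂ) ≠ 0 := by exact_mod_cast hp.ne'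
    have h2 : ((√(2 / p) : ℝ) : ℂ) * (√(2 / p) : ℝ) = 2 / p := by
      rw [← ofReal_mul, Real.mul_self_sqrt (by positivity)]; push_cast; rfl
    have e : ∀ m : ℤ, (fourier m (x : AddCircle (2 * p)) : ℂ)
        = cexp ((m * Real.pi / p * x : ℝ) * I) := by
      intro m
      rw [fourier_coe_apply]
      congr 1
      push_cast
      field_simp
    rw [e, e, hsneg]
    have hlam : lam p (k + 1) * x = ((k + 1 : ℕ) : ℤ) * Real.pi / p * x := by
      simp only [lam]; push_cast; ring
    have hlam' : ((-((k + 1 : ℕ) : ℤ) : ℤ) : ℝ) * Real.pi / p * x = -(lam p (k + 1) * x) := by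
      rw [hlam]; push_cast; ring
    rw [hlam', ← hlam]
    simp only [X, ofReal_mul, ofReal_sin]
    rw [Complex.sin]
    push_cast
    linear_combination (↑(s (↑k + 1)) * (cexp (-(lam p (k + 1) * x) * I)
      - cexp (lam p (k + 1) * x * I)) * I / 2) * h2
  · simp

end SineSystem

/-! ### Decay and square summability of the sine coefficients -/

section Coefficients

variable {p T α : ℝ}

/-- The cosine integral of an `α`-Hölder function is `O(n ^ (-α))`. -/
theorem abs_integral_mul_cos_le (hp : 0 < p) (hα : 0 < α) {h : ℝ → ℝ}
    (hc : ContinuousOn h (Icc 0 p)) {C : ℝ} (hC0 : 0 ≤ C)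
    (hC : ∀ x ∈ Ioo 0 p, ∀ y ∈ Ioo 0 p, |h x - h y| ≤ C * |x - y| ^ α) (k : ℕ) :
    |∫ x in (0 : ℝ)..p, h x * Real.cos (lam p (k + 1) * x)| ≤ C * p * (p / (k + 1 : ℕ)) ^ α := by
  set n : ℕ := k + 1
  have hn : (0 : ℝ) < n := by positivity
  -- Half a period of cos (λ_n x): it divides [0, p] into n pieces, over each of which the cosine
  -- integrates to zero.
  set d : ℝ := p / n
  have hd : 0 < d := by positivity
  have hnd : n * d = p := by simp only [d]; field_simp
  set l := lam p n
  have hl : 0 < l := lam_pos hp k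
  have hld : l * d = Real.pi := by simp only [l, lam, d]; field_simp
  have hmono : ∀ j : ℕ, j ≤ n → (j : ℝ) * d ≤ p := fun j hj => by
    rw [← hnd]; gcongr
  have hsub : ∀ j < n, Icc ((j : ℝ) * d) ((j + 1 : ℕ) * d) ⊆ Icc 0 p := fun j hj =>
    Icc_subset_Icc (by positivity) (hmono _ hj)
  have hlt : ∀ j : ℕ, (j : ℝ) * d ≤ (j + 1 : ℕ) * d := fun j => by gcongr; simp
  have hint : ∀ j < n, IntervalIntegrable (fun x => h x * Real.cos (l * x)) volume
      ((j : ℝ) * d) ((j + 1 : ℕ) * d) := by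
    intro j hj
    refine ContinuousOn.intervalIntegrable ?_
    rw [uIcc_of_le (hlt j)]
    exact (hc.mono (hsub j hj)).mul (by fun_prop)
  have hpiece : ∀ j < n, |∫ x in ((j : ℝ) * d)..((j + 1 : ℕ) * d), h x * Real.cos (l * x)|
      ≤ C * d ^ α * d := by
    intro j hj
    -- As the cosine has mean zero on the piece, the constant h m may be subtracted. The midpoint
    -- serves because it lies in the open interval, where the Hölder bound is available.
    set m : ℝ := (j + 1 / 2) * d
    have hm : m ∈ Ioo 0 p := by
      refine ⟨by positivity, lt_of_lt_of_le ?_ (hmono _ hj)⟩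
      simp only [m]; push_cast; gcongr; norm_num
    have hcos : ∫ x in ((j : ℝ) * d)..((j + 1 : ℕ) * d), Real.cos (l * x) = 0 := by
      rw [intervalIntegral.integral_comp_mul_left (fun y => Real.cos y) hl.ne', integral_cos]
      have e : ∀ i : ℕ, l * (i * d) = i * Real.pi := fun i => by rw [← hld]; ring
      simp only [e, Real.sin_nat_mul_pi]; simp
    have heq : ∫ x in ((j : ℝ) * d)..((j + 1 : ℕ) * d), h x * Real.cos (l * x)
        = ∫ x in ((j : ℝ) * d)..((j + 1 : ℕ) * d), (h x - h m) * Real.cos (l * x) := by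
      simp only [sub_mul]
      rw [intervalIntegral.integral_sub (hint j hj)
        (Continuous.intervalIntegrable (by fun_prop) _ _), intervalIntegral.integral_const_mul, hcos]
      simp
    rw [heq, ← Real.norm_eq_abs]
    have hle : d = |((j + 1 : ℕ) : ℝ) * d - j * d| := by
      rw [abs_of_nonneg (by linarith [hlt j])]; push_cast; ring
    have hbd := intervalIntegral.norm_integral_le_of_norm_le_const_ae
      (a := (j : ℝ) * d) (b := (j + 1 : ℕ) * d) (C := C * d ^ α)
      (f := fun x => (h x - h m) * Real.cos (l * x)) ?_
    · rwa [← hle] at hbd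
    have hne : ∀ᵐ x : ℝ, x ≠ p := by simp [ae_iff, measure_singleton]
    filter_upwards [hne] with x hxp hx
    rw [uIoc_of_le (hlt j)] at hx
    have hx0 : x ∈ Ioo 0 p := ⟨lt_of_le_of_lt (by positivity) hx.1,
      lt_of_le_of_ne (hx.2.trans (hmono _ hj)) hxp⟩
    rw [Real.norm_eq_abs, abs_mul]
    calc |h x - h m| * |Real.cos (l * x)| ≤ |h x - h m| * 1 := by
          gcongr; exact Real.abs_cos_le_one _
      _ ≤ C * |x - m| ^ α := by rw [mul_one]; exact hC x hx0 m hm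
      _ ≤ C * d ^ α := by
          gcongr
          have h1 := hx.1
          have h2 := hx.2
          push_cast at h2
          simp only [m]
          rw [abs_le]; constructor <;> nlinarith
  have hsum := intervalIntegral.sum_integral_adjacent_intervals
    (a := fun j : ℕ => (j : ℝ) * d) hint
  simp only [Nat.cast_zero, zero_mul, hnd] at hsum
  rw [← hsum]
  refine (Finset.abs_sum_le_sum_abs _ _).trans ?_
  refine (Finset.sum_le_sum fun j hj => hpiece j (Finset.mem_range.1 hj)).trans ?_
  rw [Finset.sum_const, Finset.card_range, nsmul_eq_mul]
  apply le_of_eq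
  rw [← hnd]; ring

/-- One integration by parts gains 1/λ_n, the boundary terms vanishing with h 0 and h p. The cosine
coefficient of the Hölder function h' gains n^(-α), so the exponent 1 + α exceeds 1 and the bounds
are summable. -/
theorem abs_sineCoeff_le (hp : 0 < p) (hα : 0 < α) {h h' : ℝ → ℝ}
    (hc : ContinuousOn h (Icc 0 p)) (h0 : h 0 = 0) (h1 : h p = 0)
    (hd : ∀ x ∈ Ioo 0 p, HasDerivAt h (h' x) x) (hc' : ContinuousOn h' (Icc 0 p))
    {C : ℝ} (hC0 : 0 ≤ C)
    (hC : ∀ x ∈ Ioo 0 p, ∀ y ∈ Ioo 0 p, |h' x - h' y| ≤ C * |x - y| ^ α) (k : ℕ) :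
    |∫ x in (0 : ℝ)..p, h x * X p (k + 1) x|
      ≤ √(2 / p) * (p / Real.pi) * C * p * p ^ α * (1 / ((k + 1 : ℕ) : ℝ) ^ (1 + α)) := by
  have hl := lam_pos hp k
  set l := lam p (k + 1)
  have hparts : ∫ x in (0 : ℝ)..p, h x * X p (k + 1) x
      = √(2 / p) / l * ∫ x in (0 : ℝ)..p, h' x * Real.cos (l * x) := by
    have hi : IntervalIntegrable h' volume 0 p :=
      ContinuousOn.intervalIntegrable (by rwa [uIcc_of_le hp.le])
    have hv : ∀ x, HasDerivAt (fun x => -(√(2 / p) / l * Real.cos (l * x))) (X p (k + 1) x) x := by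
      intro x
      have := ((((hasDerivAt_id x).const_mul l).cos).const_mul (√(2 / p) / l)).neg
      refine this.congr_deriv ?_
      simp only [X, id]
      field_simp [hl.ne']
      rw [mul_comm]
    have := intervalIntegral.integral_mul_deriv_eq_deriv_mul_of_hasDerivAt (a := 0) (b := p)
      (u := h) (v := fun x => -(√(2 / p) / l * Real.cos (l * x))) (u' := h') (v' := X p (k + 1))
      (by rwa [uIcc_of_le hp.le]) (by fun_prop)
      (by rw [min_eq_left hp.le, max_eq_right hp.le]; exact hd) (fun x _ => hv x)
      hi (Continuous.intervalIntegrable (by fun_prop) _ _)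
    rw [this, h0, h1, ← intervalIntegral.integral_const_mul, zero_mul, zero_mul, sub_zero,
      zero_sub, ← intervalIntegral.integral_neg]
    exact intervalIntegral.integral_congr fun x _ => by ring
  have hb := abs_integral_mul_cos_le hp hα hc' hC0 hC k
  rw [hparts, abs_mul, abs_of_nonneg (by positivity)]
  refine (mul_le_mul_of_nonneg_left hb (by positivity)).trans (le_of_eq ?_)
  have hn : (0 : ℝ) < ((k + 1 : ℕ) : ℝ) := by positivity
  rw [Real.div_rpow hp.le hn.le, Real.rpow_add hn, Real.rpow_one]
  simp only [l, lam]
  field_simp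

variable {f : ℝ → ℝ → ℝ}

theorem slice_continuousOn {g : ℝ → ℝ → ℝ}
    (hg : ContinuousOn (fun z : ℝ × ℝ => g z.1 z.2) (ClosedOmega p T)) {t : ℝ}
    (ht : t ∈ Icc (-T) T) : ContinuousOn (fun x => g x t) (Icc 0 p) :=
  hg.comp (f := fun x => (x, t)) (by fun_prop) fun _ hx => ⟨hx, ht⟩

theorem continuousOn_fn (hp : 0 < p) {g : ℝ → ℝ → ℝ}
    (hg : ContinuousOn (fun z : ℝ × ℝ => g z.1 z.2) (ClosedOmega p T)) (n : ℕ) :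
    ContinuousOn (fn p g n) (Icc (-T) T) :=
  continuousOn_intervalIntegral_param (F := fun x t => g x t * X p n x) hp.le
    (hg.mul (by fun_prop))

theorem hasDerivAt_fn (hp : 0 < p) (hf : IsC1Closed p T f) {g : ℝ × ℝ → ℝ}
    (hg : ContinuousOn g (ClosedOmega p T)) (hgf : ∀ x t, (x, t) ∈ Omega p T → g (x, t) = dT f x t)
    (n : ℕ) {t : ℝ} (ht : t ∈ Ioo (-T) T) :
    HasDerivAt (fn p f n) (fn p (fun x t => g (x, t)) n t) t := by
  have hsub : Icc (0 : ℝ) p ×ˢ Ioo (-T) T ⊆ ClosedOmega p T := prod_mono_right Ioo_subset_Icc_self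
  refine hasDerivAt_intervalIntegral_param hp.le isOpen_Ioo
    (F := fun x t => f x t * X p n x) (G := fun x t => g (x, t) * X p n x)
    ((hf.cont.mono hsub).mul (by fun_prop)) ((hg.mono hsub).mul (by fun_prop)) ?_ ht
  intro x hx s hs
  rw [hgf x s ⟨hx, hs⟩]
  exact (hf.diff_t x s ⟨hx, hs⟩).hasDerivAt.mul_const _

/-- The sine coefficients of `f` are summable, uniformly in `t`. -/
theorem exists_summable_bound_fn (hp : 0 < p) (hT : 0 < T) (hα : 0 < α) (hf : IsC1Closed p T f)
    (hf0 : ∀ t ∈ Icc (-T) T, f 0 t = 0 ∧ f p t = 0) (hfx : DXHolder p T α f) :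
    ∃ m : ℕ → ℝ, Summable m ∧ ∀ k, ∀ t ∈ Icc (-T) T, |fn p f (k + 1) t| ≤ m k := by
  obtain ⟨C, hC⟩ := hfx
  obtain ⟨g, hg, hgf⟩ := hf.ext_x
  refine ⟨fun k => √(2 / p) * (p / Real.pi) * |C| * p * p ^ α *
    (1 / ((k + 1 : ℕ) : ℝ) ^ (1 + α)), ?_, fun k => ?_⟩
  · refine Summable.mul_left _ ?_
    exact (summable_nat_add_iff 1).2 (Real.summable_one_div_nat_rpow.2 (by linarith))
  · have hopen : ∀ t ∈ Ioo (-T) T, |fn p f (k + 1) t| ≤ √(2 / p) * (p / Real.pi) * |C| * p * p ^ α *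
        (1 / ((k + 1 : ℕ) : ℝ) ^ (1 + α)) := by
      intro t ht
      have ht' := Ioo_subset_Icc_self ht
      refine abs_sineCoeff_le hp hα (h' := fun x => g (x, t)) (slice_continuousOn hf.cont ht')
        (hf0 t ht').1 (hf0 t ht').2 ?_ ?_ (abs_nonneg C) ?_ k
      · intro x hx
        rw [hgf x t ⟨hx, ht⟩]
        exact (hf.diff_x x t ⟨hx, ht⟩).hasDerivAt
      · exact slice_continuousOn (g := fun x t => g (x, t)) hg ht'
      · intro x hx y hy
        rw [hgf x t ⟨hx, ht⟩, hgf y t ⟨hy, ht⟩]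
        exact (hC t ht x hx y hy).trans (by gcongr; exact le_abs_self C)
    intro t ht
    -- The derivative of f is given only for |t| < T; the bound reaches t = ±T by continuity of the
    -- coefficient.
    have hcl : t ∈ closure (Ioo (-T) T) := by rwa [closure_Ioo (by linarith)]
    refine ContinuousWithinAt.closure_le hcl (f := fun t => |fn p f (k + 1) t|)
      ?_ continuousWithinAt_const hopen
    exact ((continuousOn_fn hp hf.cont (k + 1)).abs t ht).mono Ioo_subset_Icc_self

/-- Bessel's inequality on each slice, with a bound independent of t. Applied to ∂f/∂t at t = 0, it
makes the numbers f_n'(0) square summable. -/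
theorem exists_sum_sq_fn_le (hp : 0 < p) {g : ℝ → ℝ → ℝ}
    (hg : ContinuousOn (fun z : ℝ × ℝ => g z.1 z.2) (ClosedOmega p T)) :
    ∃ C, ∀ N, ∀ t ∈ Icc (-T) T, ∑ k ∈ Finset.range N, fn p g (k + 1) t ^ 2 ≤ C := by
  obtain ⟨C, hC⟩ := (isCompact_Icc.prod isCompact_Icc).exists_bound_of_continuousOn hg
  refine ⟨C ^ 2 * p, fun N t ht => ?_⟩
  have hs := slice_continuousOn hg ht
  have hb : ∀ x ∈ Icc 0 p, ‖g x t‖ ≤ C := fun x hx => hC (x, t) ⟨hx, ht⟩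
  have hmem : MemLp (fun x => g x t) 2 (volume.restrict (Ioc 0 p)) := by
    refine MemLp.of_bound ((hs.mono Ioc_subset_Icc_self).aestronglyMeasurable measurableSet_Ioc) C ?_
    exact (ae_restrict_iff' measurableSet_Ioc).2
      (Eventually.of_forall fun x hx => hb x (Ioc_subset_Icc_self hx))
  refine (sum_sq_sineCoeff_le hp hmem N).trans ?_
  calc ∫ x in (0 : ℝ)..p, g x t ^ 2 ≤ ∫ x in (0 : ℝ)..p, C ^ 2 := by
        refine intervalIntegral.integral_mono_on hp.le ?_ intervalIntegrable_const fun x hx => ?_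
        · exact ContinuousOn.intervalIntegrable (by rw [uIcc_of_le hp.le]; exact hs.pow 2)
        · exact sq_le_sq' (by linarith [neg_abs_le (g x t), hb x hx, Real.norm_eq_abs (g x t)])
            ((le_abs_self _).trans (hb x hx))
    _ = C ^ 2 * p := by simp; ring

end Coefficients

/-! ### Integration by parts for primitives, and du Bois-Reymond's lemma -/

section AbsolutelyContinuous

/-- Integration by parts for the primitive of an integrable function. -/
theorem integral_primitive_mul_deriv {c t : ℝ} {ψ ψ' S S' : ℝ → ℝ}
    (hψ' : IntervalIntegrable ψ' volume c t)
    (hψ : ∀ s ∈ uIcc c t, ψ s = ψ c + ∫ τ in c..s, ψ' τ)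
    (hS : ∀ s, HasDerivAt S (S' s) s) (hS' : Continuous S') :
    ∫ τ in c..t, ψ τ * S' τ = ψ t * S t - ψ c * S c - ∫ τ in c..t, ψ' τ * S τ := by
  set Φ : ℝ → ℝ := fun s => ∫ τ in c..s, ψ' τ
  have hSd : deriv S = S' := funext fun s => (hS s).deriv
  have hSac : AbsolutelyContinuousOnInterval S c t := by
    have : ContDiff ℝ 1 S := contDiff_one_iff_deriv.2
      ⟨fun s => (hS s).differentiableAt, by rwa [hSd]⟩
    exact this.contDiffOn.absolutelyContinuousOnInterval
  have hΦac : AbsolutelyContinuousOnInterval Φ c t :=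
    hψ'.absolutelyContinuousOnInterval_intervalIntegral left_mem_uIcc
  have h := hΦac.integral_mul_deriv_eq_deriv_mul hSac
  rw [hSd] at h
  -- The primitive Φ has derivative ψ' only almost everywhere, which is enough under the integral.
  have hd : ∫ τ in c..t, deriv Φ τ * S τ = ∫ τ in c..t, ψ' τ * S τ := by
    refine intervalIntegral.integral_congr_ae ?_
    filter_upwards [hψ'.ae_hasDerivAt_integral] with s hs hst
    rw [(hs (uIoc_subset_uIcc hst) c left_mem_uIcc).deriv]
  have hSint : ∫ τ in c..t, S' τ = S t - S c :=
    intervalIntegral.integral_eq_sub_of_hasDerivAt (fun s _ => hS s) (hS'.intervalIntegrable _ _)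
  have he : ∫ τ in c..t, ψ τ * S' τ = ∫ τ in c..t, (ψ c * S' τ + Φ τ * S' τ) := by
    refine intervalIntegral.integral_congr fun s hs => ?_
    simp only [hψ s hs, Φ]; ring
  rw [he, intervalIntegral.integral_add
    ((hS'.intervalIntegrable _ _).const_mul _) ((hS'.intervalIntegrable _ _).continuousOn_mul
      hΦac.continuousOn), h, hd, intervalIntegral.integral_const_mul, hSint,
    hψ t right_mem_uIcc]
  simp only [Φ, intervalIntegral.integral_same]
  ring

open scoped ContDiff in
/-- The lemma of du Bois-Reymond. -/
theorem exists_eqOn_const_of_integral_mul_deriv_eq_zero {a b : ℝ} (hab : a < b) {h : ℝ → ℝ}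
    (hc : ContinuousOn h (Ioo a b)) (hi : IntegrableOn h (Ioo a b))
    (H : ∀ η : ℝ → ℝ, ContDiff ℝ ∞ η → HasCompactSupport η → tsupport η ⊆ Ioo a b →
      ∫ t in Ioo a b, h t * deriv η t = 0) :
    ∃ c, ∀ t ∈ Ioo a b, h t = c := by
  -- The outer radius (b - a)/4 keeps the support inside (a, b). The normalised bump r has integral
  -- 1, and the constant sought is ∫ h r.
  let ρ : ContDiffBump ((a + b) / 2) := ⟨(b - a) / 8, (b - a) / 4, by linarith, by linarith⟩
  set r : ℝ → ℝ := ρ.normed volume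
  have hr : ContDiff ℝ ∞ r := ρ.contDiff_normed
  have hr1 : ∫ t, r t = 1 := ρ.integral_normed
  have hrs : tsupport r ⊆ Ioo a b := by
    rw [ρ.tsupport_normed_eq, Real.closedBall_eq_Icc]
    exact Icc_subset_Ioo (by simp only [ρ]; linarith) (by simp only [ρ]; linarith)
  have hrc : HasCompactSupport r := ρ.hasCompactSupport_normed
  have hmulint : ∀ {ζ : ℝ → ℝ}, Continuous ζ → HasCompactSupport ζ →
      IntegrableOn (fun t => h t * ζ t) (Ioo a b) := by
    intro ζ hζ hζc
    obtain ⟨C, hC⟩ := hζ.bounded_above_of_compact_support hζc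
    exact Integrable.mul_bdd (c := C) hi hζ.aestronglyMeasurable (Eventually.of_forall hC)
  set c := ∫ t in Ioo a b, h t * r t
  have key : ∀ ζ : ℝ → ℝ, ContDiff ℝ ∞ ζ → HasCompactSupport ζ → tsupport ζ ⊆ Ioo a b →
      ∫ t in Ioo a b, h t * ζ t = (∫ t, ζ t) * c := by
    intro ζ hζ hζc hζs
    set m := ∫ t, ζ t
    -- Subtracting m r makes the integral zero, so that θ is the derivative of a test function and
    -- the hypothesis `H` applies to its primitive η.
    set θ : ℝ → ℝ := fun t => ζ t - m * r t
    have hθ : ContDiff ℝ ∞ θ := hζ.sub (contDiff_const.mul hr)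
    have hθc : Continuous θ := hθ.continuous
    have hζi : Integrable ζ := hζ.continuous.integrable_of_hasCompactSupport hζc
    have hri : Integrable r := hr.continuous.integrable_of_hasCompactSupport hrc
    have hθ0 : ∫ t, θ t = 0 := by
      rw [integral_sub hζi (hri.const_mul m), integral_const_mul, hr1]; simp [m]
    set K := tsupport ζ ∪ tsupport r
    have hK : IsCompact K := hζc.isCompact.union hrc.isCompact
    have hKs : K ⊆ Ioo a b := union_subset hζs hrs
    have hKne : K.Nonempty := by
      refine ⟨(a + b) / 2, Or.inr ?_⟩
      rw [ρ.tsupport_normed_eq]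
      exact Metric.mem_closedBall_self ρ.rOut_pos.le
    set a' := sInf K
    set b' := sSup K
    have ha' := hKs (hK.sInf_mem hKne)
    have hb' := hKs (hK.sSup_mem hKne)
    have hKI : K ⊆ Icc a' b' := fun x hx => ⟨csInf_le hK.bddBelow hx, le_csSup hK.bddAbove hx⟩
    have hθs : ∀ t, t ∉ Icc a' b' → θ t = 0 := by
      intro t ht
      have h1 : t ∉ K := fun h => ht (hKI h)
      have h2 : ζ t = 0 := image_eq_zero_of_notMem_tsupport fun h => h1 (Or.inl h)
      have h3 : r t = 0 := image_eq_zero_of_notMem_tsupport fun h => h1 (Or.inr h)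
      simp [θ, h2, h3]
    set η : ℝ → ℝ := fun t => ∫ s in a..t, θ s
    have hηd : ∀ t, HasDerivAt η (θ t) t := fun t =>
      intervalIntegral.integral_hasDerivAt_right (hθc.intervalIntegrable _ _)
        hθc.aestronglyMeasurable.stronglyMeasurableAtFilter hθc.continuousAt
    have hηderiv : deriv η = θ := funext fun t => (hηd t).deriv
    have hη : ContDiff ℝ ∞ η := contDiff_infty_iff_deriv.2
      ⟨fun t => (hηd t).differentiableAt, by rwa [hηderiv]⟩
    -- To the left of the support nothing has been integrated yet; to the right the whole integral
    -- of θ has been, and it is zero.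
    have hη0 : ∀ t, t ∉ Icc a' b' → η t = 0 := by
      intro t ht
      rw [mem_Icc, not_and_or, not_le, not_le] at ht
      rcases ht with ht | ht
      · simp only [η]
        rw [intervalIntegral.integral_zero_ae]
        refine Eventually.of_forall fun s hs => hθs s fun hs' => ?_
        have h1 := hs.2
        have h2 : max a t < a' := max_lt ha'.1 ht
        exact absurd hs'.1 (by linarith)
      · simp only [η]
        rw [intervalIntegral.integral_eq_integral_of_support_subset, hθ0]
        intro s hs
        by_contra hns
        refine hs (hθs s fun hs' => hns ⟨lt_of_lt_of_le ha'.1 hs'.1, hs'.2.trans ht.le⟩)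
    have hηsupp : tsupport η ⊆ Icc a' b' := by
      refine closure_minimal (fun t ht => ?_) isClosed_Icc
      by_contra hns
      exact ht (hη0 t hns)
    have := H η hη (HasCompactSupport.of_support_subset_isCompact isCompact_Icc
      (subset_closure.trans hηsupp)) (hηsupp.trans (Icc_subset_Ioo ha'.1 hb'.2))
    rw [hηderiv] at this
    have e : ∀ t, h t * θ t = h t * ζ t - m * (h t * r t) := fun t => by simp only [θ]; ring
    simp only [e] at this
    rw [integral_sub (hmulint hζ.continuous hζc)
      (Integrable.const_mul (hmulint hr.continuous hrc) m), integral_const_mul] at this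
    linarith
  refine ⟨c, ?_⟩
  -- By `key`, h - c is orthogonal to every test function, hence zero almost everywhere; continuity
  -- of h then removes the exceptional set.
  have hae : ∀ᵐ t, t ∈ Ioo a b → h t - c = 0 := by
    refine isOpen_Ioo.ae_eq_zero_of_integral_contDiff_smul_eq_zero ?_ ?_
    · exact (hi.sub (integrableOn_const measure_Ioo_lt_top.ne)).locallyIntegrableOn
    · intro ζ hζ hζc hζs
      have hζi : Integrable ζ := hζ.continuous.integrable_of_hasCompactSupport hζc
      have hz : ∀ t, t ∉ Ioo a b → ζ t • (h t - c) = 0 := fun t ht => by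
        rw [image_eq_zero_of_notMem_tsupport fun h => ht (hζs h), zero_smul]
      have hz' : ∀ t, t ∉ Ioo a b → ζ t = 0 := fun t ht =>
        image_eq_zero_of_notMem_tsupport fun h => ht (hζs h)
      rw [← setIntegral_eq_integral_of_forall_compl_eq_zero hz]
      have e : ∀ t, ζ t • (h t - c) = h t * ζ t - c * ζ t := fun t => by
        rw [smul_eq_mul]; ring
      simp only [e]
      rw [integral_sub (hmulint hζ.continuous hζc) (hζi.integrableOn.const_mul c),
        key ζ hζ hζc hζs, integral_const_mul, setIntegral_eq_integral_of_forall_compl_eq_zero hz']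
      ring
  have hae' : h =ᵐ[volume.restrict (Ioo a b)] fun _ => c := by
    refine (ae_restrict_iff' measurableSet_Ioo).2 ?_
    filter_upwards [hae] with t ht hts
    exact sub_eq_zero.1 (ht hts)
  exact fun t ht => Measure.eqOn_open_of_ae_eq hae' isOpen_Ioo hc continuousOn_const ht

end AbsolutelyContinuous

/-! ### The weak second derivative in t and its sine coefficients -/

section WeakDerivative

open scoped ContDiff

variable {p T : ℝ}

/-- X_n(x) η(t) is not compactly supported in Ω, so it must be cut off in x before it can serve as a
test function. The cut-off χ_j vanishes within 1/(j + 1) of either end point and equals 1 at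
distance at least 2/(j + 1) from both. -/
theorem exists_cutoff_seq (p : ℝ) : ∃ χ : ℕ → ℝ → ℝ, (∀ j, ContDiff ℝ ∞ (χ j)) ∧
    (∀ j, HasCompactSupport (χ j)) ∧ (∀ j, tsupport (χ j) ⊆ Ioo 0 p) ∧
    (∀ j x, |χ j x| ≤ 1) ∧ ∀ x ∈ Ioo 0 p, Tendsto (fun j => χ j x) atTop (𝓝 1) := by
  set S := Real.smoothTransition
  refine ⟨fun j x => S ((j + 1) * x - 1) * S ((j + 1) * (p - x) - 1), ?_⟩
  have hsupp : ∀ j : ℕ, tsupport (fun x => S (((j : ℝ) + 1) * x - 1) * S ((j + 1) * (p - x) - 1)) ⊆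
      Icc (1 / ((j : ℝ) + 1)) (p - 1 / ((j : ℝ) + 1)) := by
    intro j
    have hj : (0 : ℝ) < (j : ℝ) + 1 := by positivity
    refine closure_minimal (fun x hx => ?_) isClosed_Icc
    rw [Function.mem_support] at hx
    have h1 : ¬ (((j : ℝ) + 1) * x - 1 ≤ 0) := fun h =>
      hx (by simp [S, Real.smoothTransition.zero_of_nonpos h])
    have h2 : ¬ (((j : ℝ) + 1) * (p - x) - 1 ≤ 0) := fun h =>
      hx (by simp [S, Real.smoothTransition.zero_of_nonpos h])
    have h3 : 1 / ((j : ℝ) + 1) ≤ x := by rw [div_le_iff₀ hj]; linarith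
    have h4 : 1 / ((j : ℝ) + 1) ≤ p - x := by rw [div_le_iff₀ hj]; linarith
    exact ⟨h3, by linarith⟩
  refine ⟨fun j => ?_, fun j => ?_, fun j => ?_, fun j x => ?_, fun x hx => ?_⟩
  · exact (Real.smoothTransition.contDiff.comp (by fun_prop)).mul
      (Real.smoothTransition.contDiff.comp (by fun_prop))
  · exact HasCompactSupport.of_support_subset_isCompact isCompact_Icc
      (subset_closure.trans (hsupp j))
  · refine (hsupp j).trans (Icc_subset_Ioo ?_ ?_)
    · positivity
    · have : (0 : ℝ) < 1 / ((j : ℝ) + 1) := by positivity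
      linarith
  · rw [abs_of_nonneg (mul_nonneg (Real.smoothTransition.nonneg _) (Real.smoothTransition.nonneg _))]
    exact mul_le_one₀ (Real.smoothTransition.le_one _) (Real.smoothTransition.nonneg _)
      (Real.smoothTransition.le_one _)
  · refine tendsto_const_nhds.congr' ?_
    have h1 : Tendsto (fun j : ℕ => ((j : ℝ) + 1) * x) atTop atTop :=
      (tendsto_atTop_add_const_right _ _ tendsto_natCast_atTop_atTop).atTop_mul_const hx.1
    have h2 : Tendsto (fun j : ℕ => ((j : ℝ) + 1) * (p - x)) atTop atTop :=
      (tendsto_atTop_add_const_right _ _ tendsto_natCast_atTop_atTop).atTop_mul_const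
        (sub_pos.2 hx.2)
    filter_upwards [h1.eventually_ge_atTop 2, h2.eventually_ge_atTop 2] with j hj1 hj2
    simp only [S]
    rw [Real.smoothTransition.one_of_one_le (by linarith),
      Real.smoothTransition.one_of_one_le (by linarith), mul_one]

theorem restrict_Omega (p T : ℝ) : (volume : Measure (ℝ × ℝ)).restrict (Omega p T)
    = (volume.restrict (Ioo 0 p)).prod (volume.restrict (Ioo (-T) T)) := by
  rw [Measure.prod_restrict]; rfl

theorem integral_Ioo_mul_X (hp : 0 < p) (g : ℝ → ℝ → ℝ) (n : ℕ) (t : ℝ) :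
    ∫ x in Ioo 0 p, g x t * X p n x = fn p g n t := by
  rw [fn, intervalIntegral.integral_of_le hp.le, integral_Ioc_eq_integral_Ioo]

theorem setIntegral_Omega_mul (hp : 0 < p) {F : ℝ × ℝ → ℝ} (hF : IntegrableOn F (Omega p T))
    (n : ℕ) {η : ℝ → ℝ} (hη : Continuous η) {C : ℝ} (hC : ∀ t, ‖η t‖ ≤ C) :
    ∫ z in Omega p T, F z * (X p n z.1 * η z.2)
      = ∫ t in Ioo (-T) T, fn p (fun x t => F (x, t)) n t * η t := by
  have hint : IntegrableOn (fun z : ℝ × ℝ => F z * (X p n z.1 * η z.2)) (Omega p T) := by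
    refine Integrable.mul_bdd (c := √(2 / p) * C) hF
      (Continuous.aestronglyMeasurable (by fun_prop)) (Eventually.of_forall fun z => ?_)
    rw [norm_mul]
    exact mul_le_mul (abs_X_le n _) (hC _) (norm_nonneg _) (Real.sqrt_nonneg _)
  rw [IntegrableOn, restrict_Omega] at hint
  rw [restrict_Omega, integral_prod_symm _ hint]
  refine integral_congr_ae (Eventually.of_forall fun t => ?_)
  simp only [← integral_Ioo_mul_X hp, ← mul_assoc, integral_mul_const]

/-- The weak equation is tested with X_n(x) χ_j(x) η(t). Only t-derivatives are taken, so the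
cut-off is never differentiated; |χ_j| ≤ 1 allows dominated convergence, and Fubini reduces both
sides to integrals in t. -/
theorem integral_fn_mul_deriv_deriv (hp : 0 < p) {f : ℝ → ℝ → ℝ} {g : ℝ × ℝ → ℝ}
    (hf : IntegrableOn (fun z : ℝ × ℝ => f z.1 z.2) (Omega p T)) (hg : IntegrableOn g (Omega p T))
    (hw : IsWeakDTT (Omega p T) f g) (n : ℕ) {η : ℝ → ℝ} (hη : ContDiff ℝ ∞ η)
    (hηc : HasCompactSupport η) (hηs : tsupport η ⊆ Ioo (-T) T) :
    ∫ t in Ioo (-T) T, fn p f n t * deriv (deriv η) t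
      = ∫ t in Ioo (-T) T, fn p (fun x t => g (x, t)) n t * η t := by
  obtain ⟨χ, hχ, hχc, hχs, hχ1, hχl⟩ := exists_cutoff_seq p
  have hη1 : ContDiff ℝ ∞ (deriv η) := (contDiff_infty_iff_deriv.1 hη).2
  have hη2 : ContDiff ℝ ∞ (deriv (deriv η)) := (contDiff_infty_iff_deriv.1 hη1).2
  obtain ⟨C, hC⟩ := hη.continuous.bounded_above_of_compact_support hηc
  obtain ⟨C2, hC2⟩ := hη2.continuous.bounded_above_of_compact_support hηc.deriv.deriv
  have hXs : ContDiff ℝ ∞ (X p n) := by unfold X; fun_prop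
  have hj : ∀ j, ∫ z in Omega p T, f z.1 z.2 * (X p n z.1 * χ j z.1 * deriv (deriv η) z.2)
      = ∫ z in Omega p T, g z * (X p n z.1 * χ j z.1 * η z.2) := by
    intro j
    have hsub : tsupport (fun z : ℝ × ℝ => X p n z.1 * χ j z.1 * η z.2)
        ⊆ tsupport (χ j) ×ˢ tsupport η := by
      refine closure_minimal (fun z hz => ?_) (isClosed_closure.prod isClosed_closure)
      rw [Function.mem_support] at hz
      refine ⟨subset_closure fun h => hz ?_, subset_closure fun h => hz ?_⟩ <;> simp [h]
    have := hw (fun x t => X p n x * χ j x * η t) ?_ ?_ ?_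
    · have e : ∀ x t, dT (dT fun x t => X p n x * χ j x * η t) x t
          = X p n x * χ j x * deriv (deriv η) t := by
        intro x t
        simp only [dT, deriv_const_mul_field']
      simpa only [e] using this
    · exact ((hXs.comp contDiff_fst).mul ((hχ j).comp contDiff_fst)).mul (hη.comp contDiff_snd)
    · exact HasCompactSupport.of_support_subset_isCompact ((hχc j).isCompact.prod hηc.isCompact)
        (subset_closure.trans hsub)
    · exact hsub.trans (prod_mono (hχs j) hηs)
  have hlim : ∀ {F : ℝ × ℝ → ℝ} {ζ : ℝ → ℝ} {B : ℝ}, IntegrableOn F (Omega p T) → Continuous ζ →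
      (∀ t, ‖ζ t‖ ≤ B) →
      Tendsto (fun j => ∫ z in Omega p T, F z * (X p n z.1 * χ j z.1 * ζ z.2)) atTop
        (𝓝 (∫ z in Omega p T, F z * (X p n z.1 * ζ z.2))) := by
    intro F ζ B hF hζ hB
    refine tendsto_integral_of_dominated_convergence (fun z => ‖F z‖ * (√(2 / p) * B))
      ?_ (hF.norm.mul_const _) ?_ ?_
    · intro j
      have := (hχ j).continuous
      exact hF.aestronglyMeasurable.mul (Continuous.aestronglyMeasurable (by fun_prop))
    · intro j
      refine Eventually.of_forall fun z => ?_
      rw [norm_mul, norm_mul, norm_mul]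
      gcongr
      · calc ‖X p n z.1‖ * ‖χ j z.1‖ ≤ √(2 / p) * 1 :=
            mul_le_mul (abs_X_le n _) (hχ1 j _) (norm_nonneg _) (Real.sqrt_nonneg _)
          _ = _ := mul_one _
      · exact hB _
    · refine (ae_restrict_iff' (measurableSet_Ioo.prod measurableSet_Ioo)).2
        (Eventually.of_forall fun z hz => ?_)
      have := ((hχl z.1 hz.1).const_mul (X p n z.1)).mul_const (ζ z.2)
      rw [mul_one] at this
      exact this.const_mul _
  have h1 := hlim hf hη2.continuous hC2
  have h2 := hlim hg hη.continuous hC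
  simp only [hj] at h1
  have := tendsto_nhds_unique h1 h2
  rwa [setIntegral_Omega_mul hp hf n hη2.continuous hC2,
    setIntegral_Omega_mul hp hg n hη.continuous hC] at this

/-- The sine coefficients of a square integrable function on `Ω` are square integrable in `t`, and
Bessel's inequality holds. -/
theorem memLp_fn_of_memLp (hp : 0 < p) {g : ℝ × ℝ → ℝ}
    (hg : MemLp g 2 (volume.restrict (Omega p T))) :
    (∀ k, MemLp (fn p (fun x t => g (x, t)) (k + 1)) 2 (volume.restrict (Ioo (-T) T))) ∧
    ∃ C, ∀ N, (∑ k ∈ Finset.range N,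
      ∫ t in Ioo (-T) T, fn p (fun x t => g (x, t)) (k + 1) t ^ 2) ≤ C := by
  rw [restrict_Omega] at hg
  have hsq := hg.integrable_sq
  -- By Fubini almost every slice g(·, t) is square integrable, and Bessel's inequality applies to
  -- it. Integrating over t then gives the bound by ∫∫ g².
  have hbessel : ∀ᵐ t ∂(volume.restrict (Ioo (-T) T)), ∀ N,
      ∑ k ∈ Finset.range N, fn p (fun x t => g (x, t)) (k + 1) t ^ 2
        ≤ ∫ x in Ioo 0 p, g (x, t) ^ 2 := by
    filter_upwards [hsq.prod_left_ae, hg.aestronglyMeasurable.prodMk_right] with t ht htm N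
    have hm : MemLp (fun x => g (x, t)) 2 (volume.restrict (Ioc 0 p)) := by
      rw [Measure.restrict_congr_set Ioo_ae_eq_Ioc.symm]
      exact (memLp_two_iff_integrable_sq htm).2 ht
    have := sum_sq_sineCoeff_le hp hm N
    rwa [intervalIntegral.integral_of_le hp.le, integral_Ioc_eq_integral_Ioo] at this
  have hI := hsq.integral_prod_right
  have hmeas : ∀ n, AEStronglyMeasurable (fn p (fun x t => g (x, t)) n)
      (volume.restrict (Ioo (-T) T)) := by
    intro n
    have : AEStronglyMeasurable (fun z : ℝ × ℝ => g z * X p n z.1)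
        ((volume.restrict (Ioo 0 p)).prod (volume.restrict (Ioo (-T) T))) :=
      hg.aestronglyMeasurable.mul (Continuous.aestronglyMeasurable (by fun_prop))
    refine this.prod_swap.integral_prod_right'.congr (Eventually.of_forall fun t => ?_)
    exact integral_Ioo_mul_X hp (fun x t => g (x, t)) n t
  have hL2 : ∀ k, Integrable (fun t => fn p (fun x t => g (x, t)) (k + 1) t ^ 2)
      (volume.restrict (Ioo (-T) T)) := by
    intro k
    refine Integrable.mono' hI ((hmeas (k + 1)).pow 2) ?_
    filter_upwards [hbessel] with t ht
    rw [Real.norm_of_nonneg (sq_nonneg _)]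
    exact (Finset.single_le_sum (f := fun k => fn p (fun x t => g (x, t)) (k + 1) t ^ 2)
      (fun _ _ => sq_nonneg _) (Finset.self_mem_range_succ k)).trans (ht (k + 1))
  refine ⟨fun k => (memLp_two_iff_integrable_sq (hmeas _)).2 (hL2 k),
    ∫ t in Ioo (-T) T, ∫ x in Ioo 0 p, g (x, t) ^ 2, fun N => ?_⟩
  rw [← integral_finsetSum _ fun k _ => hL2 k]
  refine integral_mono_ae (integrable_finsetSum _ fun k _ => hL2 k) hI ?_
  filter_upwards [hbessel] with t ht using ht N

/-- The derivative of the sine coefficients of `f` is absolutely continuous. -/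
theorem fn1_eq_integral (hp : 0 < p) (hT : 0 < T) {f : ℝ → ℝ → ℝ} (hf : IsC1Closed p T f)
    {g : ℝ × ℝ → ℝ} (hg : MemLp g 2 (volume.restrict (Omega p T)))
    (hw : IsWeakDTT (Omega p T) f g) (k : ℕ) {t : ℝ} (ht : t ∈ Ioo (-T) T) :
    fn1 p f (k + 1) t = fn1 p f (k + 1) 0
      + ∫ τ in (0 : ℝ)..t, fn p (fun x t => g (x, t)) (k + 1) τ := by
  obtain ⟨q, hq, hqf⟩ := hf.ext_t
  set n := k + 1
  set φ := fn p f n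
  set G := fn p (fun x t => g (x, t)) n
  set φ' := fn p (fun x t => q (x, t)) n
  have hd : ∀ t ∈ Ioo (-T) T, HasDerivAt φ (φ' t) t := fun t ht => hasDerivAt_fn hp hf hq hqf n ht
  have hφc : ContinuousOn φ (Icc (-T) T) := continuousOn_fn hp hf.cont n
  have hφ'c : ContinuousOn φ' (Icc (-T) T) := continuousOn_fn (g := fun x t => q (x, t)) hp hq n
  have hTT : -T ≤ T := by linarith
  have hfin : IsFiniteMeasure (volume.restrict (Omega p T)) := by
    rw [restrict_Omega]; infer_instance
  have hfint : IntegrableOn (fun z : ℝ × ℝ => f z.1 z.2) (Omega p T) :=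
    (hf.cont.integrableOn_compact (isCompact_Icc.prod isCompact_Icc)).mono_set
      (prod_mono Ioo_subset_Icc_self Ioo_subset_Icc_self)
  have hGi : IntervalIntegrable G volume (-T) T :=
    (intervalIntegrable_iff_integrableOn_Ioo_of_le hTT).2
      (((memLp_fn_of_memLp hp hg).1 k).integrable (by norm_num))
  have h0 : (0 : ℝ) ∈ uIcc (-T) T := by rw [uIcc_of_le hTT]; exact ⟨by linarith, hT.le⟩
  set Γ : ℝ → ℝ := fun t => ∫ τ in (0 : ℝ)..t, G τ
  have hΓc : ContinuousOn Γ (Icc (-T) T) := by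
    have := intervalIntegral.continuousOn_primitive_interval' hGi h0
    rwa [uIcc_of_le hTT] at this
  have hci : IntegrableOn (fun t => φ' t - Γ t) (Ioo (-T) T) :=
    ((hφ'c.sub hΓc).integrableOn_Icc).mono_set Ioo_subset_Icc_self
  -- Tested against η', both φ' and the primitive Γ of G yield -∫ G η: one by parts and the weak
  -- equation, the other by parts for a primitive. Hence φ' - Γ is constant by du Bois-Reymond's
  -- lemma, and its value is read off at t = 0.
  have hzero : ∀ η : ℝ → ℝ, ContDiff ℝ ∞ η → HasCompactSupport η → tsupport η ⊆ Ioo (-T) T →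
      ∫ t in Ioo (-T) T, (φ' t - Γ t) * deriv η t = 0 := by
    intro η hη hηc hηs
    have hη1 : ContDiff ℝ ∞ (deriv η) := (contDiff_infty_iff_deriv.1 hη).2
    have hη2 : ContDiff ℝ ∞ (deriv (deriv η)) := (contDiff_infty_iff_deriv.1 hη1).2
    have hweak := integral_fn_mul_deriv_deriv hp hfint (hg.integrable (by norm_num)) hw n hη hηc hηs
    rw [← integral_Ioc_eq_integral_Ioo, ← intervalIntegral.integral_of_le hTT,
      ← integral_Ioc_eq_integral_Ioo, ← intervalIntegral.integral_of_le hTT] at hweak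
    rw [← integral_Ioc_eq_integral_Ioo, ← intervalIntegral.integral_of_le hTT]
    have hend : ∀ s, s ∉ Ioo (-T) T → η s = 0 ∧ deriv η s = 0 := fun s hs =>
      ⟨image_eq_zero_of_notMem_tsupport fun h => hs (hηs h),
        image_eq_zero_of_notMem_tsupport fun h => hs (hηs (tsupport_deriv_subset h))⟩
    have hφ'i : IntervalIntegrable φ' volume (-T) T :=
      ContinuousOn.intervalIntegrable (by rwa [uIcc_of_le hTT])
    have hp1 : ∫ s in (-T)..T, φ s * deriv (deriv η) s = - ∫ s in (-T)..T, φ' s * deriv η s := by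
      rw [intervalIntegral.integral_mul_deriv_eq_deriv_mul_of_hasDerivAt (u := φ) (v := deriv η)
        (u' := φ') (v' := deriv (deriv η)) (by rwa [uIcc_of_le hTT]) hη1.continuous.continuousOn
        (by rw [min_eq_left hTT, max_eq_right hTT]; exact hd)
        (fun s _ => (hη1.differentiable (by simp)).differentiableAt.hasDerivAt)
        hφ'i (hη2.continuous.intervalIntegrable _ _), (hend T (by simp)).2,
        (hend (-T) (by simp)).2]
      ring
    have hΓ' : ∀ s ∈ uIcc (-T) T, Γ s = Γ (-T) + ∫ τ in (-T)..s, G τ := by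
      intro s hs
      have h1 : IntervalIntegrable G volume 0 (-T) := hGi.mono_set (uIcc_subset_uIcc h0 left_mem_uIcc)
      have h2 : IntervalIntegrable G volume (-T) s := hGi.mono_set (uIcc_subset_uIcc left_mem_uIcc hs)
      exact (intervalIntegral.integral_add_adjacent_intervals h1 h2).symm
    have hp2 : ∫ s in (-T)..T, Γ s * deriv η s = - ∫ s in (-T)..T, G s * η s := by
      rw [integral_primitive_mul_deriv hGi hΓ'
        (fun s => (hη.differentiable (by simp)).differentiableAt.hasDerivAt) hη1.continuous,
        (hend T (by simp)).1, (hend (-T) (by simp)).1]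
      ring
    simp only [sub_mul]
    rw [intervalIntegral.integral_sub, hp2]
    · rw [hp1] at hweak
      linarith
    · exact hφ'i.mul_continuousOn hη1.continuous.continuousOn
    · refine ContinuousOn.intervalIntegrable ?_
      rw [uIcc_of_le hTT]
      exact hΓc.mul hη1.continuous.continuousOn
  obtain ⟨c, hc⟩ := exists_eqOn_const_of_integral_mul_deriv_eq_zero
    (h := fun t => φ' t - Γ t) (by linarith : -T < T)
    ((hφ'c.sub hΓc).mono Ioo_subset_Icc_self) hci hzero
  have e : ∀ t ∈ Ioo (-T) T, fn1 p f n t = φ' t := fun t ht => (hd t ht).deriv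
  have h00 : (0 : ℝ) ∈ Ioo (-T) T := ⟨by linarith, hT⟩
  have h1 := hc t ht
  have h2 := hc 0 h00
  rw [e t ht, e 0 h00]
  simp only [Γ, intervalIntegral.integral_same] at h1 h2
  linarith

end WeakDerivative

/-! ### The time factors: derivatives and integration by parts in t -/

section Modes

/-- A function `φ` on `[-T, T]` with absolutely continuous derivative `φ₁` on `(-T, T)`, such that
`φ₁` and `φ₂ = φ₁'` are square integrable. -/
structure ModeData (T : ℝ) (φ φ₁ φ₂ : ℝ → ℝ) : Prop where
  pos : 0 < T
  cont : ContinuousOn φ (Icc (-T) T)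
  int₁ : IntervalIntegrable φ₁ volume (-T) T
  int₂ : IntervalIntegrable φ₂ volume (-T) T
  sq₁ : IntervalIntegrable (fun t => φ₁ t ^ 2) volume (-T) T
  sq₂ : IntervalIntegrable (fun t => φ₂ t ^ 2) volume (-T) T
  prim : ∀ t ∈ Ioo (-T) T, φ t = φ 0 + ∫ τ in (0 : ℝ)..t, φ₁ τ
  prim₁ : ∀ t ∈ Ioo (-T) T, φ₁ t = φ₁ 0 + ∫ τ in (0 : ℝ)..t, φ₂ τ

/-- Convolution of `h` with the sine. -/
noncomputable def convSin (h : ℝ → ℝ) (l t : ℝ) : ℝ :=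
  ∫ τ in (0 : ℝ)..t, h τ * Real.sin (l * (t - τ))

/-- Convolution of `h` with the cosine. -/
noncomputable def convCos (h : ℝ → ℝ) (l t : ℝ) : ℝ :=
  ∫ τ in (0 : ℝ)..t, h τ * Real.cos (l * (t - τ))

/-- Backward convolution of `h` with the exponential. -/
noncomputable def convExp (h : ℝ → ℝ) (l t : ℝ) : ℝ :=
  ∫ τ in t..(0 : ℝ), h τ * Real.exp (l ^ 2 * (t - τ))

/-- The time factor of the terms of `u⁺`. -/
noncomputable def modeP (φ φ₁ : ℝ → ℝ) (l t : ℝ) : ℝ :=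
  ((1 - l ^ 2) * φ 0 - φ₁ 0) / (l ^ 2 * (l ^ 2 + 1)) * Real.cos (l * t)
    + (2 * φ 0 - φ₁ 0) / (l * (l ^ 2 + 1)) * Real.sin (l * t) + 1 / l * convSin φ l t

/-- The time factor of the terms of `u⁺_t`. -/
noncomputable def modePT (φ φ₁ : ℝ → ℝ) (l t : ℝ) : ℝ :=
  ((l ^ 2 - 1) * φ 0 + φ₁ 0) / (l * (l ^ 2 + 1)) * Real.sin (l * t)
    + (2 * φ 0 - φ₁ 0) / (l ^ 2 + 1) * Real.cos (l * t) + convCos φ l t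

/-- The time factor of the terms of `u⁺_tt`. -/
noncomputable def modePTT (φ φ₁ φ₂ : ℝ → ℝ) (l t : ℝ) : ℝ :=
  (2 * l ^ 2 * φ 0 + φ₁ 0) / (l ^ 2 + 1) * Real.cos (l * t)
    + ((2 * l ^ 2 + 1) * φ₁ 0 - 2 * l ^ 2 * φ 0) / (l * (l ^ 2 + 1)) * Real.sin (l * t)
    + 1 / l * convSin φ₂ l t

/-- The time factor of the terms of `u⁺_xx`. -/
noncomputable def modePXX (φ φ₁ φ₂ : ℝ → ℝ) (l t : ℝ) : ℝ :=
  (2 * l ^ 2 * φ 0 + φ₁ 0) / (l ^ 2 + 1) * Real.cos (l * t) - φ t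
    + ((2 * l ^ 2 + 1) * φ₁ 0 - 2 * l ^ 2 * φ 0) / (l * (l ^ 2 + 1)) * Real.sin (l * t)
    + 1 / l * convSin φ₂ l t

/-- The time factor of the terms of `u⁻`. -/
noncomputable def modeM (φ φ₁ : ℝ → ℝ) (l t : ℝ) : ℝ :=
  ((1 - l ^ 2) * φ 0 - φ₁ 0) / (l ^ 2 * (l ^ 2 + 1)) * Real.exp (l ^ 2 * t) - convExp φ l t

/-- The time factor of the terms of `u⁻_t`. -/
noncomputable def modeMT (φ φ₁ : ℝ → ℝ) (l t : ℝ) : ℝ :=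
  (2 * φ 0 - φ₁ 0) / (l ^ 2 + 1) * Real.exp (l ^ 2 * t) - convExp φ₁ l t

/-- The time factor of the terms of `u⁻_xx`. -/
noncomputable def modeMXX (φ φ₁ : ℝ → ℝ) (l t : ℝ) : ℝ :=
  (φ₁ 0 - 2 * φ 0) / (l ^ 2 + 1) * Real.exp (l ^ 2 * t) + φ t + convExp φ₁ l t

/-- The time factor of the terms of `u⁻_tt`. -/
noncomputable def modeMTT (φ φ₁ φ₂ : ℝ → ℝ) (l t : ℝ) : ℝ :=
  (2 * l ^ 2 * φ 0 + φ₁ 0) / (l ^ 2 + 1) * Real.exp (l ^ 2 * t) - convExp φ₂ l t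

variable {T l : ℝ} {h : ℝ → ℝ}

theorem zero_mem_uIcc_neg (hT : 0 < T) : (0 : ℝ) ∈ uIcc (-T) T := by
  rw [uIcc_of_le (by linarith)]; exact ⟨by linarith, hT.le⟩

theorem IntervalIntegrable.mono_zero (hT : 0 < T) (hh : IntervalIntegrable h volume (-T) T)
    {t : ℝ} (ht : t ∈ Icc (-T) T) : IntervalIntegrable h volume 0 t :=
  hh.mono_set (uIcc_subset_uIcc (zero_mem_uIcc_neg hT) (by rwa [uIcc_of_le (by linarith)]))

/-- The addition theorem separates t from τ. The convolution becomes a combination of ordinary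
primitives, from which its continuity and its derivative follow. -/
theorem convSin_eq {t : ℝ} (hh : IntervalIntegrable h volume 0 t) :
    convSin h l t = Real.sin (l * t) * (∫ τ in (0 : ℝ)..t, h τ * Real.cos (l * τ))
      - Real.cos (l * t) * ∫ τ in (0 : ℝ)..t, h τ * Real.sin (l * τ) := by
  rw [convSin, ← intervalIntegral.integral_const_mul, ← intervalIntegral.integral_const_mul,
    ← intervalIntegral.integral_sub ((hh.mul_continuousOn (by fun_prop)).const_mul _)
      ((hh.mul_continuousOn (by fun_prop)).const_mul _)]
  refine intervalIntegral.integral_congr fun τ _ => ?_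
  simp only [mul_sub, Real.sin_sub]; ring

theorem convCos_eq {t : ℝ} (hh : IntervalIntegrable h volume 0 t) :
    convCos h l t = Real.cos (l * t) * (∫ τ in (0 : ℝ)..t, h τ * Real.cos (l * τ))
      + Real.sin (l * t) * ∫ τ in (0 : ℝ)..t, h τ * Real.sin (l * τ) := by
  rw [convCos, ← intervalIntegral.integral_const_mul, ← intervalIntegral.integral_const_mul,
    ← intervalIntegral.integral_add ((hh.mul_continuousOn (by fun_prop)).const_mul _)
      ((hh.mul_continuousOn (by fun_prop)).const_mul _)]
  refine intervalIntegral.integral_congr fun τ _ => ?_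
  simp only [mul_sub, Real.cos_sub]; ring

theorem convExp_eq (h : ℝ → ℝ) (l t : ℝ) :
    convExp h l t = -(Real.exp (l ^ 2 * t)
      * ∫ τ in (0 : ℝ)..t, h τ * Real.exp (-(l ^ 2 * τ))) := by
  rw [convExp, intervalIntegral.integral_symm, ← intervalIntegral.integral_const_mul]
  congr 1
  refine intervalIntegral.integral_congr fun τ _ => ?_
  rw [show l ^ 2 * (t - τ) = l ^ 2 * t + -(l ^ 2 * τ) by ring, Real.exp_add]
  ring

theorem continuousOn_integral_mul (hT : 0 < T) (hh : IntervalIntegrable h volume (-T) T)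
    {k : ℝ → ℝ} (hk : Continuous k) :
    ContinuousOn (fun t => ∫ τ in (0 : ℝ)..t, h τ * k τ) (Icc (-T) T) := by
  have := intervalIntegral.continuousOn_primitive_interval'
    (hh.mul_continuousOn hk.continuousOn) (zero_mem_uIcc_neg hT)
  rwa [uIcc_of_le (by linarith)] at this

theorem hasDerivAt_integral_mul (hT : 0 < T) (hh : ContinuousOn h (Ioo (-T) T))
    {k : ℝ → ℝ} (hk : Continuous k) {t : ℝ} (ht : t ∈ Ioo (-T) T) :
    HasDerivAt (fun t => ∫ τ in (0 : ℝ)..t, h τ * k τ) (h t * k t) t := by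
  have hc : ContinuousOn (fun τ => h τ * k τ) (Ioo (-T) T) := hh.mul hk.continuousOn
  have h0 : (0 : ℝ) ∈ Ioo (-T) T := ⟨by linarith, hT⟩
  have hsub : uIcc 0 t ⊆ Ioo (-T) T := ordConnected_Ioo.uIcc_subset h0 ht
  exact intervalIntegral.integral_hasDerivAt_right (hc.mono hsub).intervalIntegrable
    (hc.stronglyMeasurableAtFilter isOpen_Ioo t ht) (hc.continuousAt (isOpen_Ioo.mem_nhds ht))

theorem continuousOn_convSin (hT : 0 < T) (hh : IntervalIntegrable h volume (-T) T) :
    ContinuousOn (convSin h l) (Icc (-T) T) := by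
  refine ContinuousOn.congr (ContinuousOn.sub (ContinuousOn.mul
    (by fun_prop : ContinuousOn (fun t => Real.sin (l * t)) _)
    (continuousOn_integral_mul hT hh (k := fun τ => Real.cos (l * τ)) (by fun_prop)))
    (ContinuousOn.mul (by fun_prop : ContinuousOn (fun t => Real.cos (l * t)) _) (continuousOn_integral_mul hT hh
      (k := fun τ => Real.sin (l * τ)) (by fun_prop)))) fun t ht => ?_
  exact convSin_eq (hh.mono_zero hT ht)

theorem continuousOn_convCos (hT : 0 < T) (hh : IntervalIntegrable h volume (-T) T) :
    ContinuousOn (convCos h l) (Icc (-T) T) := by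
  refine ContinuousOn.congr (ContinuousOn.add (ContinuousOn.mul
    (by fun_prop : ContinuousOn (fun t => Real.cos (l * t)) _)
    (continuousOn_integral_mul hT hh (k := fun τ => Real.cos (l * τ)) (by fun_prop)))
    (ContinuousOn.mul (by fun_prop : ContinuousOn (fun t => Real.sin (l * t)) _) (continuousOn_integral_mul hT hh
      (k := fun τ => Real.sin (l * τ)) (by fun_prop)))) fun t ht => ?_
  exact convCos_eq (hh.mono_zero hT ht)

theorem continuousOn_convExp (hT : 0 < T) (hh : IntervalIntegrable h volume (-T) T) :
    ContinuousOn (convExp h l) (Icc (-T) T) := by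
  refine ContinuousOn.congr (ContinuousOn.neg (ContinuousOn.mul
    (by fun_prop : ContinuousOn (fun t => Real.exp (l ^ 2 * t)) _)
    (continuousOn_integral_mul hT hh (k := fun τ => Real.exp (-(l ^ 2 * τ))) (by fun_prop))))
    fun t _ => convExp_eq h l t

theorem hasDerivAt_convSin (hT : 0 < T) (hh : IntervalIntegrable h volume (-T) T)
    (hc : ContinuousOn h (Ioo (-T) T)) {t : ℝ} (ht : t ∈ Ioo (-T) T) :
    HasDerivAt (convSin h l) (l * convCos h l t) t := by
  have hl := (hasDerivAt_id t).const_mul l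
  have := ((hl.sin).mul (hasDerivAt_integral_mul hT hc
    (k := fun τ => Real.cos (l * τ)) (by fun_prop) ht)).sub ((hl.cos).mul
    (hasDerivAt_integral_mul hT hc (k := fun τ => Real.sin (l * τ)) (by fun_prop) ht))
  refine (this.congr_of_eventuallyEq ?_).congr_deriv ?_
  · filter_upwards [isOpen_Ioo.mem_nhds ht] with s hs
    exact convSin_eq (hh.mono_zero hT (Ioo_subset_Icc_self hs))
  · rw [convCos_eq (hh.mono_zero hT (Ioo_subset_Icc_self ht))]
    simp only [id]; ring

theorem hasDerivAt_convCos (hT : 0 < T) (hh : IntervalIntegrable h volume (-T) T)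
    (hc : ContinuousOn h (Ioo (-T) T)) {t : ℝ} (ht : t ∈ Ioo (-T) T) :
    HasDerivAt (convCos h l) (h t - l * convSin h l t) t := by
  have hl := (hasDerivAt_id t).const_mul l
  have := ((hl.cos).mul (hasDerivAt_integral_mul hT hc
    (k := fun τ => Real.cos (l * τ)) (by fun_prop) ht)).add ((hl.sin).mul
    (hasDerivAt_integral_mul hT hc (k := fun τ => Real.sin (l * τ)) (by fun_prop) ht))
  refine (this.congr_of_eventuallyEq ?_).congr_deriv ?_
  · filter_upwards [isOpen_Ioo.mem_nhds ht] with s hs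
    exact convCos_eq (hh.mono_zero hT (Ioo_subset_Icc_self hs))
  · rw [convSin_eq (hh.mono_zero hT (Ioo_subset_Icc_self ht))]
    simp only [id]
    -- The contributions of the upper limit combine to h t (cos² + sin²).
    linear_combination h t * Real.sin_sq_add_cos_sq (l * t)

theorem hasDerivAt_convExp (hT : 0 < T) (hc : ContinuousOn h (Ioo (-T) T)) {t : ℝ}
    (ht : t ∈ Ioo (-T) T) :
    HasDerivAt (convExp h l) (l ^ 2 * convExp h l t - h t) t := by
  have hl := ((hasDerivAt_id t).const_mul (l ^ 2)).exp
  have := (hl.mul (hasDerivAt_integral_mul hT hc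
    (k := fun τ => Real.exp (-(l ^ 2 * τ))) (by fun_prop) ht)).neg
  refine (this.congr_of_eventuallyEq ?_).congr_deriv ?_
  · exact Eventually.of_forall fun s => convExp_eq h l s
  · rw [convExp_eq]
    have : Real.exp (l ^ 2 * t) * Real.exp (-(l ^ 2 * t)) = 1 := by
      rw [← Real.exp_add]; simp
    simp only [id]
    linear_combination (-h t) * this

variable {φ φ₁ φ₂ : ℝ → ℝ}

namespace ModeData

theorem continuousOn₁ (H : ModeData T φ φ₁ φ₂) : ContinuousOn φ₁ (Ioo (-T) T) := by
  have := continuousOn_integral_mul H.pos H.int₂ (k := fun _ => 1) continuous_const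
  simp only [mul_one] at this
  exact ((continuousOn_const.add this).mono Ioo_subset_Icc_self).congr H.prim₁

theorem uIcc_subset (H : ModeData T φ φ₁ φ₂) {t : ℝ} (ht : t ∈ Ioo (-T) T) :
    uIcc 0 t ⊆ Ioo (-T) T :=
  ordConnected_Ioo.uIcc_subset ⟨by linarith [H.pos], H.pos⟩ ht

/-- Two integrations by parts move the factor l² onto φ as two derivatives. This is how f_n'' enters
the series for u⁺_tt and u⁺_xx; the second integration uses only that φ₁ is the primitive of φ₂. -/
theorem mul_convSin (H : ModeData T φ φ₁ φ₂) {t : ℝ} (ht : t ∈ Ioo (-T) T) :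
    l ^ 2 * convSin φ l t
      = l * φ t - l * φ 0 * Real.cos (l * t) - φ₁ 0 * Real.sin (l * t) - convSin φ₂ l t := by
  have ht' := Ioo_subset_Icc_self ht
  have e1 := integral_primitive_mul_deriv (c := 0) (t := t) (ψ := φ) (ψ' := φ₁)
    (S := fun τ => Real.cos (l * (t - τ))) (S' := fun τ => l * Real.sin (l * (t - τ)))
    (H.int₁.mono_zero H.pos ht') (fun s hs => H.prim s (H.uIcc_subset ht hs)) (fun s => by
      have := (((hasDerivAt_id s).const_sub t).const_mul l).cos
      refine this.congr_deriv ?_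
      simp only [id]; ring) (by fun_prop)
  have e2 := integral_primitive_mul_deriv (c := 0) (t := t) (ψ := φ₁) (ψ' := φ₂)
    (S := fun τ => -Real.sin (l * (t - τ))) (S' := fun τ => l * Real.cos (l * (t - τ)))
    (H.int₂.mono_zero H.pos ht') (fun s hs => H.prim₁ s (H.uIcc_subset ht hs)) (fun s => by
      have := (((hasDerivAt_id s).const_sub t).const_mul l).sin.neg
      refine this.congr_deriv ?_
      simp only [id]; ring) (by fun_prop)
  simp only [sub_self, mul_zero, Real.cos_zero, Real.sin_zero, sub_zero, mul_left_comm _ l,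
    intervalIntegral.integral_const_mul, mul_neg, intervalIntegral.integral_neg] at e1 e2
  simp only [convSin]
  linear_combination l * e1 - e2

/-- The derivative of the exponential carries l², so a single integration by parts suffices. Used
for φ it gives the forms of u⁻_t and u⁻_xx with φ₁; used for φ₁, in `mul_convExp₁`, it gives the
form of u⁻_tt with φ₂. -/
theorem mul_convExp (H : ModeData T φ φ₁ φ₂) {t : ℝ} (ht : t ∈ Ioo (-T) T) :
    l ^ 2 * convExp φ l t = φ t - φ 0 * Real.exp (l ^ 2 * t) + convExp φ₁ l t := by
  have ht' := Ioo_subset_Icc_self ht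
  have e1 := integral_primitive_mul_deriv (c := 0) (t := t) (ψ := φ) (ψ' := φ₁)
    (S := fun τ => -Real.exp (l ^ 2 * (t - τ))) (S' := fun τ => l ^ 2 * Real.exp (l ^ 2 * (t - τ)))
    (H.int₁.mono_zero H.pos ht') (fun s hs => H.prim s (H.uIcc_subset ht hs)) (fun s => by
      have := (((hasDerivAt_id s).const_sub t).const_mul (l ^ 2)).exp.neg
      refine this.congr_deriv ?_
      simp only [id]; ring) (by fun_prop)
  simp only [sub_self, mul_zero, Real.exp_zero, sub_zero, mul_left_comm _ (l ^ 2),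
    intervalIntegral.integral_const_mul, mul_neg, intervalIntegral.integral_neg] at e1
  simp only [convExp, intervalIntegral.integral_symm 0 t]
  linear_combination -e1

theorem mul_convExp₁ (H : ModeData T φ φ₁ φ₂) {t : ℝ} (ht : t ∈ Ioo (-T) T) :
    l ^ 2 * convExp φ₁ l t = φ₁ t - φ₁ 0 * Real.exp (l ^ 2 * t) + convExp φ₂ l t := by
  have ht' := Ioo_subset_Icc_self ht
  have e1 := integral_primitive_mul_deriv (c := 0) (t := t) (ψ := φ₁) (ψ' := φ₂)
    (S := fun τ => -Real.exp (l ^ 2 * (t - τ))) (S' := fun τ => l ^ 2 * Real.exp (l ^ 2 * (t - τ)))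
    (H.int₂.mono_zero H.pos ht') (fun s hs => H.prim₁ s (H.uIcc_subset ht hs)) (fun s => by
      have := (((hasDerivAt_id s).const_sub t).const_mul (l ^ 2)).exp.neg
      refine this.congr_deriv ?_
      simp only [id]; ring) (by fun_prop)
  simp only [sub_self, mul_zero, Real.exp_zero, sub_zero, mul_left_comm _ (l ^ 2),
    intervalIntegral.integral_const_mul, mul_neg, intervalIntegral.integral_neg] at e1
  simp only [convExp, intervalIntegral.integral_symm 0 t]
  linear_combination -e1

theorem hasDerivAt_modeP (H : ModeData T φ φ₁ φ₂) (hl : 0 < l) {t : ℝ} (ht : t ∈ Ioo (-T) T) :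
    HasDerivAt (modeP φ φ₁ l) (modePT φ φ₁ l t) t := by
  have hi := H.cont.intervalIntegrable_of_Icc (μ := volume) (by linarith [H.pos])
  have hlt := (hasDerivAt_id t).const_mul l
  have := (((hlt.cos).const_mul (((1 - l ^ 2) * φ 0 - φ₁ 0) / (l ^ 2 * (l ^ 2 + 1)))).add
    ((hlt.sin).const_mul ((2 * φ 0 - φ₁ 0) / (l * (l ^ 2 + 1))))).add
    ((hasDerivAt_convSin (l := l) H.pos hi (H.cont.mono Ioo_subset_Icc_self) ht).const_mul (1 / l))
  refine this.congr_deriv ?_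
  simp only [modePT, id]
  field_simp
  ring

theorem hasDerivAt_modePT (H : ModeData T φ φ₁ φ₂) (hl : 0 < l) {t : ℝ} (ht : t ∈ Ioo (-T) T) :
    HasDerivAt (modePT φ φ₁ l) (modePTT φ φ₁ φ₂ l t) t := by
  have hi := H.cont.intervalIntegrable_of_Icc (μ := volume) (by linarith [H.pos])
  have hlt := (hasDerivAt_id t).const_mul l
  have := (((hlt.sin).const_mul (((l ^ 2 - 1) * φ 0 + φ₁ 0) / (l * (l ^ 2 + 1)))).add
    ((hlt.cos).const_mul ((2 * φ 0 - φ₁ 0) / (l ^ 2 + 1)))).add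
    (hasDerivAt_convCos (l := l) H.pos hi (H.cont.mono Ioo_subset_Icc_self) ht)
  refine this.congr_deriv ?_
  have e : l * convSin φ l t = φ t - φ 0 * Real.cos (l * t) - φ₁ 0 / l * Real.sin (l * t)
      - 1 / l * convSin φ₂ l t := by
    have := H.mul_convSin (l := l) ht
    field_simp
    linear_combination this
  rw [e]
  simp only [modePTT, id]
  field_simp
  ring

/-- X_n'' = -λ_n² X_n makes -l² `modeP` the time factor of u⁺_xx. Rewritten by parts, it has a form
whose summability over n can be seen. -/
theorem modePXX_eq (H : ModeData T φ φ₁ φ₂) (hl : 0 < l) {t : ℝ} (ht : t ∈ Ioo (-T) T) :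
    modePXX φ φ₁ φ₂ l t = -l ^ 2 * modeP φ φ₁ l t := by
  have e : convSin φ₂ l t = l * φ t - l * φ 0 * Real.cos (l * t) - φ₁ 0 * Real.sin (l * t)
      - l ^ 2 * convSin φ l t := by
    linear_combination H.mul_convSin (l := l) ht
  simp only [modePXX, modeP]
  rw [e]
  field_simp
  ring

theorem hasDerivAt_modeM (H : ModeData T φ φ₁ φ₂) (hl : 0 < l) {t : ℝ} (ht : t ∈ Ioo (-T) T) :
    HasDerivAt (modeM φ φ₁ l) (modeMT φ φ₁ l t) t := by
  have hlt := ((hasDerivAt_id t).const_mul (l ^ 2)).exp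
  have := ((hlt).const_mul (((1 - l ^ 2) * φ 0 - φ₁ 0) / (l ^ 2 * (l ^ 2 + 1)))).sub
    (hasDerivAt_convExp (l := l) H.pos (H.cont.mono Ioo_subset_Icc_self) ht)
  refine this.congr_deriv ?_
  rw [H.mul_convExp ht]
  simp only [modeMT, id]
  field_simp
  ring

theorem hasDerivAt_modeMT (H : ModeData T φ φ₁ φ₂) {t : ℝ} (ht : t ∈ Ioo (-T) T) :
    HasDerivAt (modeMT φ φ₁ l) (modeMTT φ φ₁ φ₂ l t) t := by
  have hlt := ((hasDerivAt_id t).const_mul (l ^ 2)).exp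
  have := ((hlt).const_mul ((2 * φ 0 - φ₁ 0) / (l ^ 2 + 1))).sub
    (hasDerivAt_convExp (l := l) H.pos H.continuousOn₁ ht)
  refine this.congr_deriv ?_
  rw [H.mul_convExp₁ ht]
  simp only [modeMTT, id]
  field_simp
  ring

theorem modeMXX_eq (H : ModeData T φ φ₁ φ₂) (hl : 0 < l) {t : ℝ} (ht : t ∈ Ioo (-T) T) :
    modeMXX φ φ₁ l t = -l ^ 2 * modeM φ φ₁ l t := by
  have e : convExp φ₁ l t = l ^ 2 * convExp φ l t - φ t + φ 0 * Real.exp (l ^ 2 * t) := by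
    linear_combination -H.mul_convExp (l := l) ht
  simp only [modeMXX, modeM]
  rw [e]
  field_simp
  ring

end ModeData

end Modes

/-! ### Summable bounds for the time factors -/

section ModeBounds

variable {T l c s : ℝ} {h φ φ₁ φ₂ : ℝ → ℝ}

theorem abs_convSin_le (hT : 0 < T) (hs : ∀ t ∈ Icc (-T) T, |h t| ≤ s) {t : ℝ}
    (ht : t ∈ Icc 0 T) : |convSin h l t| ≤ s * T := by
  have hs0 : 0 ≤ s := (abs_nonneg _).trans (hs 0 ⟨by linarith, hT.le⟩)
  have := intervalIntegral.norm_integral_le_of_norm_le_const (a := 0) (b := t) (C := s)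
    (f := fun τ => h τ * Real.sin (l * (t - τ))) fun τ hτ => by
      rw [uIoc_of_le ht.1] at hτ
      rw [norm_mul]
      exact (mul_le_of_le_one_right (norm_nonneg _) (Real.abs_sin_le_one _)).trans
        (hs τ ⟨by linarith [hτ.1], hτ.2.trans ht.2⟩)
  rw [sub_zero, abs_of_nonneg ht.1] at this
  exact this.trans (by gcongr; exact ht.2)

theorem abs_convCos_le (hT : 0 < T) (hs : ∀ t ∈ Icc (-T) T, |h t| ≤ s) {t : ℝ}
    (ht : t ∈ Icc 0 T) : |convCos h l t| ≤ s * T := by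
  have hs0 : 0 ≤ s := (abs_nonneg _).trans (hs 0 ⟨by linarith, hT.le⟩)
  have := intervalIntegral.norm_integral_le_of_norm_le_const (a := 0) (b := t) (C := s)
    (f := fun τ => h τ * Real.cos (l * (t - τ))) fun τ hτ => by
      rw [uIoc_of_le ht.1] at hτ
      rw [norm_mul]
      exact (mul_le_of_le_one_right (norm_nonneg _) (Real.abs_cos_le_one _)).trans
        (hs τ ⟨by linarith [hτ.1], hτ.2.trans ht.2⟩)
  rw [sub_zero, abs_of_nonneg ht.1] at this
  exact this.trans (by gcongr; exact ht.2)

theorem abs_convExp_le (hT : 0 < T) (hs : ∀ t ∈ Icc (-T) T, |h t| ≤ s) {t : ℝ}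
    (ht : t ∈ Icc (-T) 0) : |convExp h l t| ≤ s * T := by
  have hs0 : 0 ≤ s := (abs_nonneg _).trans (hs 0 ⟨by linarith, hT.le⟩)
  have := intervalIntegral.norm_integral_le_of_norm_le_const (a := t) (b := 0) (C := s)
    (f := fun τ => h τ * Real.exp (l ^ 2 * (t - τ))) fun τ hτ => by
      rw [uIoc_of_le ht.2] at hτ
      rw [norm_mul, Real.norm_of_nonneg (Real.exp_pos _).le]
      refine (mul_le_of_le_one_right (norm_nonneg _) ?_).trans
        (hs τ ⟨by linarith [hτ.1, ht.1], by linarith [hτ.2]⟩)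
      exact Real.exp_le_one_iff.2 (mul_nonpos_of_nonneg_of_nonpos (sq_nonneg _) (by linarith [hτ.1]))
  rw [zero_sub, abs_neg, abs_of_nonpos ht.2] at this
  exact this.trans (by gcongr; linarith [ht.1])

theorem integral_sq_mono (hh2 : IntervalIntegrable (fun t => h t ^ 2) volume (-T) T) {a b : ℝ}
    (ha : -T ≤ a) (hab : a ≤ b) (hb : b ≤ T) :
    ∫ t in a..b, h t ^ 2 ≤ ∫ t in (-T)..T, h t ^ 2 :=
  intervalIntegral.integral_mono_interval ha hab hb
    (Eventually.of_forall fun t => sq_nonneg (h t)) hh2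

/-- Under the integral |h|/l ≤ h² + 1/l², and both terms are summable over the modes. -/
theorem abs_inv_mul_convSin_le (hT : 0 < T) (hl : 0 < l)
    (hh2 : IntervalIntegrable (fun t => h t ^ 2) volume (-T) T) {t : ℝ} (ht : t ∈ Icc 0 T) :
    |1 / l * convSin h l t| ≤ (∫ τ in (-T)..T, h τ ^ 2) + T * (1 / l ^ 2) := by
  have hint : IntervalIntegrable (fun t => h t ^ 2) volume 0 t :=
    hh2.mono_zero hT ⟨by linarith [ht.1], ht.2⟩
  have h1 : |1 / l * convSin h l t| ≤ ∫ τ in (0 : ℝ)..t, (h τ ^ 2 + 1 / l ^ 2) := by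
    rw [convSin, ← intervalIntegral.integral_const_mul, ← Real.norm_eq_abs]
    refine intervalIntegral.norm_integral_le_of_norm_le ht.1 (Eventually.of_forall fun τ _ => ?_)
      (hint.add intervalIntegrable_const)
    rw [norm_mul, norm_mul, Real.norm_of_nonneg (by positivity : (0 : ℝ) ≤ 1 / l)]
    calc 1 / l * (‖h τ‖ * ‖Real.sin (l * (t - τ))‖) ≤ 1 / l * (‖h τ‖ * 1) := by
          gcongr; exact Real.abs_sin_le_one _
      _ ≤ ‖h τ‖ ^ 2 + (1 / l) ^ 2 := by
          nlinarith [sq_nonneg (‖h τ‖ - 1 / l), sq_nonneg ‖h τ‖, sq_nonneg (1 / l)]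
      _ = h τ ^ 2 + 1 / l ^ 2 := by rw [Real.norm_eq_abs, sq_abs, div_pow, one_pow]
  refine h1.trans ?_
  rw [intervalIntegral.integral_add hint intervalIntegrable_const, intervalIntegral.integral_const,
    sub_zero, smul_eq_mul]
  have := integral_sq_mono hh2 (by linarith) ht.1 ht.2
  gcongr
  exact ht.2

/-- No factor 1/l stands in front here; the decay of the kernel e replaces it. Since 0 < e ≤ 1, one
has |h| e ≤ h² + e² ≤ h² + e, and the integral of e is at most 1/l². -/
theorem abs_convExp_le_integral_sq (hl : 0 < l)
    (hh2 : IntervalIntegrable (fun t => h t ^ 2) volume (-T) T) {t : ℝ} (ht : t ∈ Icc (-T) 0) :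
    |convExp h l t| ≤ (∫ τ in (-T)..T, h τ ^ 2) + 1 / l ^ 2 := by
  have hT : 0 ≤ T := by linarith [ht.1, ht.2]
  have hint : IntervalIntegrable (fun t => h t ^ 2) volume t 0 := by
    refine hh2.mono_set ?_
    rw [uIcc_of_le ht.2, uIcc_of_le (by linarith)]
    exact Icc_subset_Icc ht.1 hT
  have h1 : |convExp h l t| ≤ ∫ τ in t..(0 : ℝ), (h τ ^ 2 + Real.exp (l ^ 2 * (t - τ))) := by
    rw [convExp, ← Real.norm_eq_abs]
    refine intervalIntegral.norm_integral_le_of_norm_le ht.2 (Eventually.of_forall fun τ hτ => ?_)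
      (hint.add (Continuous.intervalIntegrable (by fun_prop) _ _))
    have he : Real.exp (l ^ 2 * (t - τ)) ≤ 1 := Real.exp_le_one_iff.2
      (mul_nonpos_of_nonneg_of_nonpos (sq_nonneg _) (by linarith [hτ.1]))
    have he0 := Real.exp_pos (l ^ 2 * (t - τ))
    rw [norm_mul, Real.norm_of_nonneg he0.le]
    have hsq : ‖h τ‖ ^ 2 = h τ ^ 2 := by rw [Real.norm_eq_abs, sq_abs]
    rw [← hsq]
    nlinarith [sq_nonneg (‖h τ‖ - Real.exp (l ^ 2 * (t - τ))), sq_nonneg ‖h τ‖,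
      norm_nonneg (h τ), mul_nonneg he0.le (sub_nonneg.2 he)]
  refine h1.trans ?_
  have hexp : ∫ τ in t..(0 : ℝ), Real.exp (l ^ 2 * (t - τ)) ≤ 1 / l ^ 2 := by
    have hd : ∀ τ ∈ uIcc t 0, HasDerivAt (fun τ => -(1 / l ^ 2 * Real.exp (l ^ 2 * (t - τ))))
        (Real.exp (l ^ 2 * (t - τ))) τ := fun τ _ => by
      have := ((((hasDerivAt_id τ).const_sub t).const_mul (l ^ 2)).exp.const_mul (1 / l ^ 2)).neg
      refine this.congr_deriv ?_
      simp only [id]; field_simp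
    rw [intervalIntegral.integral_eq_sub_of_hasDerivAt hd
      (Continuous.intervalIntegrable (by fun_prop) _ _)]
    have : 0 ≤ 1 / l ^ 2 * Real.exp (l ^ 2 * (t - 0)) := by positivity
    simp only [sub_self, mul_zero, Real.exp_zero] at *
    linarith
  rw [intervalIntegral.integral_add hint (Continuous.intervalIntegrable (by fun_prop) _ _)]
  have := integral_sq_mono hh2 ht.1 ht.2 hT
  linarith

/-- The majorant of the time factors (up to a constant factor). -/
noncomputable def modeMajorant (T l s : ℝ) (φ₁ φ₂ : ℝ → ℝ) : ℝ :=
  s + φ₁ 0 ^ 2 + 1 / l ^ 2 + (∫ t in (-T)..T, φ₁ t ^ 2) + ∫ t in (-T)..T, φ₂ t ^ 2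

theorem abs_coeff_cos_le (hl : 0 < l) (a b : ℝ) :
    |((1 - l ^ 2) * a - b) / (l ^ 2 * (l ^ 2 + 1))| ≤ 1 / l ^ 2 * (|a| + |b| / (l ^ 2 + 1)) := by
  have e : 1 / l ^ 2 * (|a| + |b| / (l ^ 2 + 1))
      = ((l ^ 2 + 1) * |a| + |b|) / (l ^ 2 * (l ^ 2 + 1)) := by field_simp
  rw [e, abs_div, abs_of_pos (by positivity : 0 < l ^ 2 * (l ^ 2 + 1))]
  gcongr
  refine (abs_sub _ _).trans ?_
  rw [abs_mul]
  gcongr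
  rw [abs_le]; constructor <;> nlinarith [sq_nonneg l]

theorem abs_coeff_deriv_le (hl : 0 < l) (a b : ℝ) :
    |(2 * a - b) / (l ^ 2 + 1)| ≤ 2 * |a| + |b| / (l ^ 2 + 1) := by
  rw [sub_div]
  refine (abs_sub _ _).trans ?_
  rw [abs_div, abs_div, abs_of_pos (by positivity : 0 < l ^ 2 + 1), abs_mul, abs_two]
  gcongr
  exact div_le_self (by positivity) (by nlinarith [sq_nonneg l])

theorem abs_coeff_second_cos_le (hl : 0 < l) (a b : ℝ) :
    |(2 * l ^ 2 * a + b) / (l ^ 2 + 1)| ≤ 2 * |a| + |b| / (l ^ 2 + 1) := by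
  have e : 2 * |a| + |b| / (l ^ 2 + 1) = (2 * (l ^ 2 + 1) * |a| + |b|) / (l ^ 2 + 1) := by
    field_simp
  rw [e, abs_div, abs_of_pos (by positivity : 0 < l ^ 2 + 1)]
  gcongr
  refine (abs_add_le _ _).trans ?_
  rw [abs_mul, abs_mul, abs_two, abs_of_nonneg (sq_nonneg l)]
  gcongr
  linarith

theorem abs_coeff_second_sin_le (hl : 0 < l) (a b : ℝ) :
    |((2 * l ^ 2 + 1) * b - 2 * l ^ 2 * a) / (l * (l ^ 2 + 1))| ≤ 2 * (|b| / l) + 2 * (1 / l * |a|) := by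
  have e : 2 * (|b| / l) + 2 * (1 / l * |a|)
      = ((2 * (l ^ 2 + 1)) * |b| + 2 * (l ^ 2 + 1) * |a|) / (l * (l ^ 2 + 1)) := by field_simp
  rw [e, abs_div, abs_of_pos (by positivity : 0 < l * (l ^ 2 + 1))]
  gcongr
  refine (abs_sub _ _).trans ?_
  rw [abs_mul, abs_mul, abs_mul, abs_two, abs_of_nonneg (sq_nonneg l),
    abs_of_pos (by positivity : 0 < 2 * l ^ 2 + 1)]
  gcongr <;> linarith

theorem abs_mul_trig_le {y : ℝ} (hy : |y| ≤ 1) (x : ℝ) : |x * y| ≤ |x| := by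
  rw [abs_mul]; exact mul_le_of_le_one_right (abs_nonneg _) hy

/-- The constant of the majorant estimates. -/
noncomputable def modeConst (T c : ℝ) : ℝ := (1 + c) ^ 2 * (6 + T)

theorem ModeData.nonneg_integral_sq (H : ModeData T φ φ₁ φ₂) :
    (0 ≤ ∫ t in (-T)..T, φ₁ t ^ 2) ∧ 0 ≤ ∫ t in (-T)..T, φ₂ t ^ 2 := by
  have hT := H.pos
  exact ⟨intervalIntegral.integral_nonneg (by linarith) fun t _ => sq_nonneg _,
    intervalIntegral.integral_nonneg (by linarith) fun t _ => sq_nonneg _⟩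

/-- These are the coefficients A, -l A, B/l, B, D, E of the mode. The value φ₁ 0 always comes
divided by at least l, up to constants, and |φ₁ 0|/l ≤ φ₁(0)² + 1/l² is part of the majorant; the
constant c bounds any further powers of 1/l. -/
theorem ModeData.coeff_bounds (H : ModeData T φ φ₁ φ₂) (hl : 0 < l) (hc : 1 / l ≤ c)
    (hs : ∀ t ∈ Icc (-T) T, |φ t| ≤ s) :
    |((1 - l ^ 2) * φ 0 - φ₁ 0) / (l ^ 2 * (l ^ 2 + 1))|
        ≤ c ^ 2 * modeMajorant T l s φ₁ φ₂ ∧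
      |((l ^ 2 - 1) * φ 0 + φ₁ 0) / (l * (l ^ 2 + 1))| ≤ c * modeMajorant T l s φ₁ φ₂ ∧
      |(2 * φ 0 - φ₁ 0) / (l * (l ^ 2 + 1))| ≤ c * (2 * modeMajorant T l s φ₁ φ₂) ∧
      |(2 * φ 0 - φ₁ 0) / (l ^ 2 + 1)| ≤ 2 * modeMajorant T l s φ₁ φ₂ ∧
      |(2 * l ^ 2 * φ 0 + φ₁ 0) / (l ^ 2 + 1)| ≤ 2 * modeMajorant T l s φ₁ φ₂ ∧
      |((2 * l ^ 2 + 1) * φ₁ 0 - 2 * l ^ 2 * φ 0) / (l * (l ^ 2 + 1))|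
        ≤ (2 + 2 * c) * modeMajorant T l s φ₁ φ₂ := by
  have hT := H.pos
  have hl1 : 0 < 1 / l := by positivity
  have hc0 : 0 < c := by linarith
  have e : (1 / l) ^ 2 = 1 / l ^ 2 := by rw [div_pow, one_pow]
  have h1 : |φ₁ 0| / l ≤ φ₁ 0 ^ 2 + 1 / l ^ 2 := by
    rw [← e, ← sq_abs, div_eq_mul_one_div]
    nlinarith [sq_nonneg (|φ₁ 0| - 1 / l), sq_nonneg |φ₁ 0|, sq_nonneg (1 / l)]
  have h2 : |φ₁ 0| / (l ^ 2 + 1) ≤ φ₁ 0 ^ 2 + 1 / l ^ 2 := by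
    refine le_trans ?_ h1
    gcongr
    -- The inequality l ≤ l² + 1.
    nlinarith [sq_nonneg (l - 1)]
  have h3 : 1 / l ^ 2 ≤ c ^ 2 := by rw [← e]; gcongr
  have ha : |φ 0| ≤ s := hs 0 ⟨by linarith, hT.le⟩
  obtain ⟨hI1, hI2⟩ := H.nonneg_integral_sq
  set q := modeMajorant T l s φ₁ φ₂ with hq
  have hq' : q = s + φ₁ 0 ^ 2 + 1 / l ^ 2 + (∫ t in (-T)..T, φ₁ t ^ 2)
    + ∫ t in (-T)..T, φ₂ t ^ 2 := rfl
  have ha0 := abs_nonneg (φ 0)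
  have hr : 0 < 1 / l ^ 2 := by positivity
  have hb2 := sq_nonneg (φ₁ 0)
  have hB : |(2 * φ 0 - φ₁ 0) / (l ^ 2 + 1)| ≤ 2 * q := by
    refine (abs_coeff_deriv_le hl _ _).trans ?_
    linarith
  refine ⟨?_, ?_, ?_, hB, ?_, ?_⟩
  · refine (abs_coeff_cos_le hl _ _).trans ?_
    gcongr
    linarith
  · have e2 : ((l ^ 2 - 1) * φ 0 + φ₁ 0) / (l * (l ^ 2 + 1))
        = -l * (((1 - l ^ 2) * φ 0 - φ₁ 0) / (l ^ 2 * (l ^ 2 + 1))) := by field_simp; ring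
    rw [e2, abs_mul, abs_neg, abs_of_pos hl]
    calc l * |((1 - l ^ 2) * φ 0 - φ₁ 0) / (l ^ 2 * (l ^ 2 + 1))|
        ≤ l * (1 / l ^ 2 * (|φ 0| + |φ₁ 0| / (l ^ 2 + 1))) := by
          gcongr; exact abs_coeff_cos_le hl _ _
      _ = 1 / l * (|φ 0| + |φ₁ 0| / (l ^ 2 + 1)) := by field_simp
      _ ≤ c * q := by gcongr; linarith
  · have e2 : (2 * φ 0 - φ₁ 0) / (l * (l ^ 2 + 1)) = 1 / l * ((2 * φ 0 - φ₁ 0) / (l ^ 2 + 1)) := by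
      field_simp
    rw [e2, abs_mul, abs_of_pos hl1]
    gcongr
  · refine (abs_coeff_second_cos_le hl _ _).trans ?_
    linarith
  · refine (abs_coeff_second_sin_le hl _ _).trans ?_
    have h4 : 1 / l * |φ 0| ≤ c * q := by gcongr; linarith
    linarith

theorem ModeData.majorant_bounds (H : ModeData T φ φ₁ φ₂) (hl : 0 < l)
    (hs : ∀ t ∈ Icc (-T) T, |φ t| ≤ s) :
    0 ≤ modeMajorant T l s φ₁ φ₂ ∧ s ≤ modeMajorant T l s φ₁ φ₂ ∧
      1 / l ^ 2 ≤ modeMajorant T l s φ₁ φ₂ ∧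
      (∫ t in (-T)..T, φ₁ t ^ 2) + 1 / l ^ 2 ≤ modeMajorant T l s φ₁ φ₂ ∧
      (∫ t in (-T)..T, φ₂ t ^ 2) + 1 / l ^ 2 ≤ modeMajorant T l s φ₁ φ₂ ∧
      (∫ t in (-T)..T, φ₂ t ^ 2) ≤ modeMajorant T l s φ₁ φ₂ := by
  have ha := (abs_nonneg _).trans (hs 0 ⟨by linarith [H.pos], H.pos.le⟩)
  obtain ⟨hI1, hI2⟩ := H.nonneg_integral_sq
  have hr : 0 < 1 / l ^ 2 := by positivity
  have hb2 := sq_nonneg (φ₁ 0)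
  unfold modeMajorant
  refine ⟨?_, ?_, ?_, ?_, ?_, ?_⟩ <;> linarith

/-- One constant covers all eight factors: (1 + c)² (6 + T) = (6 + T) + (2c + c²)(6 + T), and the
second summand exceeds 2c + cT + c². -/
theorem le_modeConst_mul {T c q x : ℝ} (hT : 0 < T) (hc : 0 < c) (hq : 0 ≤ q)
    (hx : x ≤ (6 + T) * q + (2 * c + c * T + c ^ 2) * q) : x ≤ modeConst T c * q := by
  refine hx.trans ?_
  unfold modeConst
  rw [← add_mul]
  gcongr
  have : 0 < c * T := by positivity
  have : 0 < c ^ 2 * T := by positivity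
  nlinarith [sq_nonneg c]

/-- Bounds for the time factors of the terms of `u⁺` and its derivatives. -/
theorem ModeData.abs_modeP_le (H : ModeData T φ φ₁ φ₂) (hl : 0 < l) (hc : 1 / l ≤ c)
    (hs : ∀ t ∈ Icc (-T) T, |φ t| ≤ s) {t : ℝ} (ht : t ∈ Icc 0 T) :
    |modeP φ φ₁ l t| ≤ modeConst T c * modeMajorant T l s φ₁ φ₂ ∧
    |modePT φ φ₁ l t| ≤ modeConst T c * modeMajorant T l s φ₁ φ₂ ∧
    |modePTT φ φ₁ φ₂ l t| ≤ modeConst T c * modeMajorant T l s φ₁ φ₂ ∧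
    |modePXX φ φ₁ φ₂ l t| ≤ modeConst T c * modeMajorant T l s φ₁ φ₂ := by
  obtain ⟨hA, hA', hB', hB, hD, hE⟩ := H.coeff_bounds hl hc hs
  obtain ⟨hq0, hsq, hr, h1, h2, h2'⟩ := H.majorant_bounds hl hs
  have hT := H.pos
  have hl1 : 0 < 1 / l := by positivity
  have hc0 : 0 < c := by linarith
  set q := modeMajorant T l s φ₁ φ₂
  have hcos := Real.abs_cos_le_one (l * t)
  have hsin := Real.abs_sin_le_one (l * t)
  have hcs : |1 / l * convSin φ l t| ≤ c * (q * T) := by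
    rw [abs_mul, abs_of_pos hl1]
    gcongr
    exact (abs_convSin_le hT hs ht).trans (by gcongr)
  have hcc : |convCos φ l t| ≤ q * T := (abs_convCos_le hT hs ht).trans (by gcongr)
  have hcs2 : |1 / l * convSin φ₂ l t| ≤ q + T * q :=
    (abs_inv_mul_convSin_le hT hl H.sq₂ ht).trans (by gcongr)
  have hφ : |φ t| ≤ q := (hs t ⟨by linarith [ht.1], ht.2⟩).trans hsq
  refine ⟨?_, ?_, ?_, ?_⟩ <;> apply le_modeConst_mul hT hc0 hq0
  · refine (abs_add_three _ _ _).trans ((add_le_add (add_le_add ((abs_mul_trig_le hcos _).trans hA)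
      ((abs_mul_trig_le hsin _).trans hB')) hcs).trans ?_)
    nlinarith [mul_nonneg hT.le hq0]
  · refine (abs_add_three _ _ _).trans ((add_le_add (add_le_add ((abs_mul_trig_le hsin _).trans hA')
      ((abs_mul_trig_le hcos _).trans hB)) hcc).trans ?_)
    nlinarith [mul_nonneg hc0.le hq0, mul_nonneg (mul_nonneg hc0.le hT.le) hq0,
      mul_nonneg (sq_nonneg c) hq0]
  · refine (abs_add_three _ _ _).trans ((add_le_add (add_le_add ((abs_mul_trig_le hcos _).trans hD)
      ((abs_mul_trig_le hsin _).trans hE)) hcs2).trans ?_)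
    nlinarith [mul_nonneg (mul_nonneg hc0.le hT.le) hq0, mul_nonneg (sq_nonneg c) hq0]
  · refine (abs_add_three _ _ _).trans ((add_le_add (add_le_add ((abs_sub _ _).trans (add_le_add
      ((abs_mul_trig_le hcos _).trans hD) hφ)) ((abs_mul_trig_le hsin _).trans hE)) hcs2).trans ?_)
    nlinarith [mul_nonneg (mul_nonneg hc0.le hT.le) hq0, mul_nonneg (sq_nonneg c) hq0]

/-- Bounds for the time factors of the terms of `u⁻` and its derivatives. -/
theorem ModeData.abs_modeM_le (H : ModeData T φ φ₁ φ₂) (hl : 0 < l) (hc : 1 / l ≤ c)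
    (hs : ∀ t ∈ Icc (-T) T, |φ t| ≤ s) {t : ℝ} (ht : t ∈ Icc (-T) 0) :
    |modeM φ φ₁ l t| ≤ modeConst T c * modeMajorant T l s φ₁ φ₂ ∧
    |modeMT φ φ₁ l t| ≤ modeConst T c * modeMajorant T l s φ₁ φ₂ ∧
    |modeMTT φ φ₁ φ₂ l t| ≤ modeConst T c * modeMajorant T l s φ₁ φ₂ ∧
    |modeMXX φ φ₁ l t| ≤ modeConst T c * modeMajorant T l s φ₁ φ₂ := by
  obtain ⟨hA, hA', hB', hB, hD, hE⟩ := H.coeff_bounds hl hc hs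
  obtain ⟨hq0, hsq, hr, h1, h2, h2'⟩ := H.majorant_bounds hl hs
  have hT := H.pos
  have hl1 : 0 < 1 / l := by positivity
  have hc0 : 0 < c := by linarith
  set q := modeMajorant T l s φ₁ φ₂
  have hexp : |Real.exp (l ^ 2 * t)| ≤ 1 := by
    rw [abs_of_pos (Real.exp_pos _)]
    exact Real.exp_le_one_iff.2 (mul_nonpos_of_nonneg_of_nonpos (sq_nonneg _) ht.2)
  have hce : |convExp φ l t| ≤ q * T := (abs_convExp_le hT hs ht).trans (by gcongr)
  have hce1 : |convExp φ₁ l t| ≤ q := (abs_convExp_le_integral_sq hl H.sq₁ ht).trans h1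
  have hce2 : |convExp φ₂ l t| ≤ q := (abs_convExp_le_integral_sq hl H.sq₂ ht).trans h2
  have hφ : |φ t| ≤ q := (hs t ⟨ht.1, by linarith [ht.2]⟩).trans hsq
  have hBn : |(φ₁ 0 - 2 * φ 0) / (l ^ 2 + 1)| ≤ 2 * q := by
    rwa [← abs_neg, ← neg_div, neg_sub]
  have hp1 := mul_nonneg hc0.le hq0
  have hp2 := mul_nonneg (mul_nonneg hc0.le hT.le) hq0
  have hp3 := mul_nonneg (sq_nonneg c) hq0
  have hp4 := mul_nonneg hT.le hq0
  refine ⟨?_, ?_, ?_, ?_⟩ <;> apply le_modeConst_mul hT hc0 hq0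
  · refine (abs_sub _ _).trans ((add_le_add ((abs_mul_trig_le hexp _).trans hA) hce).trans ?_)
    linarith
  · refine (abs_sub _ _).trans ((add_le_add ((abs_mul_trig_le hexp _).trans hB) hce1).trans ?_)
    linarith
  · refine (abs_sub _ _).trans ((add_le_add ((abs_mul_trig_le hexp _).trans hD) hce2).trans ?_)
    linarith
  · refine (abs_add_three _ _ _).trans ((add_le_add (add_le_add ((abs_mul_trig_le hexp _).trans hBn)
      hφ) hce1).trans ?_)
    linarith

theorem ModeData.continuousOn_modes (H : ModeData T φ φ₁ φ₂) (l : ℝ) :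
    (ContinuousOn (modeP φ φ₁ l) (Icc (-T) T) ∧ ContinuousOn (modePT φ φ₁ l) (Icc (-T) T) ∧
      ContinuousOn (modePTT φ φ₁ φ₂ l) (Icc (-T) T) ∧
      ContinuousOn (modePXX φ φ₁ φ₂ l) (Icc (-T) T)) ∧
    ContinuousOn (modeM φ φ₁ l) (Icc (-T) T) ∧ ContinuousOn (modeMT φ φ₁ l) (Icc (-T) T) ∧
      ContinuousOn (modeMTT φ φ₁ φ₂ l) (Icc (-T) T) ∧
      ContinuousOn (modeMXX φ φ₁ l) (Icc (-T) T) := by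
  have hT := H.pos
  have hi := H.cont.intervalIntegrable_of_Icc (μ := volume) (by linarith)
  have hφ := H.cont
  have h1 := continuousOn_convSin (l := l) hT hi
  have h2 := continuousOn_convCos (l := l) hT hi
  have h3 := continuousOn_convSin (l := l) hT H.int₂
  have h4 := continuousOn_convExp (l := l) hT hi
  have h5 := continuousOn_convExp (l := l) hT H.int₁
  have h6 := continuousOn_convExp (l := l) hT H.int₂
  unfold modeP modePT modePTT modePXX modeM modeMT modeMTT modeMXX
  refine ⟨⟨?_, ?_, ?_, ?_⟩, ?_, ?_, ?_, ?_⟩ <;> fun_prop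

/-- The time factors of `u⁺` and `u⁻`, and of their derivatives, agree at `t = 0`. -/
theorem modes_zero (φ φ₁ φ₂ : ℝ → ℝ) (l : ℝ) :
    modeP φ φ₁ l 0 = modeM φ φ₁ l 0 ∧ modePT φ φ₁ l 0 = modeMT φ φ₁ l 0 ∧
      modePTT φ φ₁ φ₂ l 0 = modeMTT φ φ₁ φ₂ l 0 ∧ modePXX φ φ₁ φ₂ l 0 = modeMXX φ φ₁ l 0 := by
  have h : l ^ 2 + 1 ≠ 0 := by positivity
  simp only [modeP, modePT, modePTT, modePXX, modeM, modeMT, modeMTT, modeMXX, convSin, convCos,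
    convExp, mul_zero, Real.cos_zero, Real.sin_zero, Real.exp_zero,
    intervalIntegral.integral_same]
  refine ⟨by ring, by ring, by ring, ?_⟩
  field_simp
  ring

end ModeBounds

/-! ### The common summable majorant for f -/

section Existence

variable {p T α : ℝ} {f : ℝ → ℝ → ℝ}

/-- The time factors of the eight series have the common summable majorant `m`. -/
structure ModeBounds (p T : ℝ) (f : ℝ → ℝ → ℝ) (m : ℕ → ℝ) : Prop where
  summable : Summable m
  data : ∀ k, ModeData T (fn p f (k + 1)) (fn1 p f (k + 1)) (fn2 p f (k + 1))
  fn_le : ∀ k, ∀ t ∈ Icc (-T) T, |fn p f (k + 1) t| ≤ m k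
  plus : ∀ k, ∀ t ∈ Icc 0 T,
    |modeP (fn p f (k + 1)) (fn1 p f (k + 1)) (lam p (k + 1)) t| ≤ m k ∧
    |modePT (fn p f (k + 1)) (fn1 p f (k + 1)) (lam p (k + 1)) t| ≤ m k ∧
    |modePTT (fn p f (k + 1)) (fn1 p f (k + 1)) (fn2 p f (k + 1)) (lam p (k + 1)) t| ≤ m k ∧
    |modePXX (fn p f (k + 1)) (fn1 p f (k + 1)) (fn2 p f (k + 1)) (lam p (k + 1)) t| ≤ m k
  minus : ∀ k, ∀ t ∈ Icc (-T) 0,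
    |modeM (fn p f (k + 1)) (fn1 p f (k + 1)) (lam p (k + 1)) t| ≤ m k ∧
    |modeMT (fn p f (k + 1)) (fn1 p f (k + 1)) (lam p (k + 1)) t| ≤ m k ∧
    |modeMTT (fn p f (k + 1)) (fn1 p f (k + 1)) (fn2 p f (k + 1)) (lam p (k + 1)) t| ≤ m k ∧
    |modeMXX (fn p f (k + 1)) (fn1 p f (k + 1)) (lam p (k + 1)) t| ≤ m k

/-- `fn2` is a pointwise derivative, with a default value where f_n' is not differentiable.
Lebesgue's differentiation theorem for the primitive in `fn1_eq_integral` identifies it almost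
everywhere with the sine coefficient of the weak derivative. -/
theorem fn2_ae_eq (hp : 0 < p) (hT : 0 < T) (hf : IsC1Closed p T f) {g : ℝ × ℝ → ℝ}
    (hg : MemLp g 2 (volume.restrict (Omega p T))) (hw : IsWeakDTT (Omega p T) f g) (k : ℕ) :
    fn2 p f (k + 1) =ᵐ[volume.restrict (Ioo (-T) T)] fn p (fun x t => g (x, t)) (k + 1) := by
  have hGi : IntervalIntegrable (fn p (fun x t => g (x, t)) (k + 1)) volume (-T) T :=
    (intervalIntegrable_iff_integrableOn_Ioo_of_le (by linarith)).2
      (((memLp_fn_of_memLp hp hg).1 k).integrable (by norm_num))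
  refine (ae_restrict_iff' measurableSet_Ioo).2 ?_
  filter_upwards [hGi.ae_hasDerivAt_integral] with t ht htI
  have hd := (ht (by rw [uIcc_of_le (by linarith)]; exact Ioo_subset_Icc_self htI) 0
    (zero_mem_uIcc_neg hT)).const_add (fn1 p f (k + 1) 0)
  refine (hd.congr_of_eventuallyEq ?_).deriv
  filter_upwards [isOpen_Ioo.mem_nhds htI] with s hs using fn1_eq_integral hp hT hf hg hw k hs

theorem modeData_fn (hp : 0 < p) (hT : 0 < T) (hf : IsC1Closed p T f) {q : ℝ × ℝ → ℝ}
    (hq : ContinuousOn q (ClosedOmega p T)) (hqf : ∀ x t, (x, t) ∈ Omega p T → q (x, t) = dT f x t)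
    {g : ℝ × ℝ → ℝ} (hg : MemLp g 2 (volume.restrict (Omega p T)))
    (hw : IsWeakDTT (Omega p T) f g) (k : ℕ) :
    ModeData T (fn p f (k + 1)) (fn1 p f (k + 1)) (fn2 p f (k + 1)) := by
  have hTT : -T ≤ T := by linarith
  have hqc := continuousOn_fn (g := fun x t => q (x, t)) hp hq (k + 1)
  have h1 : EqOn (fn p (fun x t => q (x, t)) (k + 1)) (fn1 p f (k + 1)) (Ioo (-T) T) :=
    fun t ht => (hasDerivAt_fn hp hf hq hqf (k + 1) ht).deriv.symm
  have hG := (memLp_fn_of_memLp hp hg).1 k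
  have h2 := fn2_ae_eq hp hT hf hg hw k
  have h0 : (0 : ℝ) ∈ Ioo (-T) T := ⟨by linarith, hT⟩
  have hint₁ : IntervalIntegrable (fn1 p f (k + 1)) volume (-T) T :=
    (intervalIntegrable_iff_integrableOn_Ioo_of_le hTT).2
      (((hqc.integrableOn_Icc).mono_set Ioo_subset_Icc_self).congr_fun h1 measurableSet_Ioo)
  refine ⟨hT, continuousOn_fn hp hf.cont (k + 1), hint₁, ?_, ?_, ?_, ?_, ?_⟩
  · exact (intervalIntegrable_iff_integrableOn_Ioo_of_le hTT).2
      ((hG.integrable (by norm_num)).congr h2.symm)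
  · refine (intervalIntegrable_iff_integrableOn_Ioo_of_le hTT).2
      ((((hqc.pow 2).integrableOn_Icc).mono_set Ioo_subset_Icc_self).congr_fun (fun t ht => ?_)
        measurableSet_Ioo)
    simp only [Pi.pow_apply, h1 ht]
  · refine (intervalIntegrable_iff_integrableOn_Ioo_of_le hTT).2 (hG.integrable_sq.congr ?_)
    filter_upwards [h2] with t ht
    rw [ht]
  · intro t ht
    have hsub : uIcc 0 t ⊆ Ioo (-T) T := ordConnected_Ioo.uIcc_subset h0 ht
    rw [intervalIntegral.integral_eq_sub_of_hasDerivAt (f := fn p f (k + 1))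
      (f' := fn1 p f (k + 1))
      (fun s hs => (hasDerivAt_fn hp hf hq hqf (k + 1) (hsub hs)).differentiableAt.hasDerivAt)
      (hint₁.mono_zero hT (Ioo_subset_Icc_self ht))]
    ring
  · intro t ht
    rw [fn1_eq_integral hp hT hf hg hw k ht]
    congr 1
    refine intervalIntegral.integral_congr_ae ?_
    filter_upwards [(ae_restrict_iff' measurableSet_Ioo).1 h2] with s hs hst
    exact (hs (ordConnected_Ioo.uIcc_subset h0 ht (uIoc_subset_uIcc hst))).symm

/-- Each summand of `modeMajorant` is summable: sup |f_n| by the Hölder condition, f_n'(0)² by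
Bessel at t = 0, 1/λ_n² by comparison with 1/n², and the integrals of f_n'² and f_n''² by Bessel
integrated over t. -/
theorem exists_modeBounds (hp : 0 < p) (hT : 0 < T) (hα : 0 < α) (hf : IsC1Closed p T f)
    (hftt : DTTMemL2 p T f) (hf0 : ∀ t ∈ Icc (-T) T, f 0 t = 0 ∧ f p t = 0)
    (hfx : DXHolder p T α f) : ∃ m, ModeBounds p T f m := by
  obtain ⟨s, hs, hsf⟩ := exists_summable_bound_fn hp hT hα hf hf0 hfx
  obtain ⟨g, hg, hw⟩ := hftt
  obtain ⟨q, hq, hqf⟩ := hf.ext_t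
  have hdata := modeData_fn hp hT hf hq hqf hg hw
  have hTT : -T ≤ T := by linarith
  -- The least frequency is λ_1 = π/p, so p/π serves as the constant c for every mode.
  have hc : ∀ k, 1 / lam p (k + 1) ≤ p / Real.pi := fun k => by
    rw [div_le_iff₀ (lam_pos hp k)]
    have := lam_succ_ge hp k
    calc (1 : ℝ) = p / Real.pi * (Real.pi / p) := by field_simp
      _ ≤ _ := by gcongr
  have hcpos : 0 < p / Real.pi := by positivity
  have hI : ∀ h : ℝ → ℝ, ∫ t in (-T)..T, h t = ∫ t in Ioo (-T) T, h t := fun h => by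
    rw [intervalIntegral.integral_of_le hTT, integral_Ioc_eq_integral_Ioo]
  have hb : Summable fun k => fn1 p f (k + 1) 0 ^ 2 := by
    obtain ⟨C, hC⟩ := exists_sum_sq_fn_le (g := fun x t => q (x, t)) hp hq
    refine summable_of_sum_range_le (c := C) (fun _ => sq_nonneg _) fun N => ?_
    have h0 : (0 : ℝ) ∈ Ioo (-T) T := ⟨by linarith, hT⟩
    refine le_trans (le_of_eq ?_) (hC N 0 (Ioo_subset_Icc_self h0))
    exact Finset.sum_congr rfl fun k _ => by
      rw [fn1, (hasDerivAt_fn hp hf hq hqf (k + 1) h0).deriv]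
  have hr : Summable fun k => 1 / lam p (k + 1) ^ 2 := by
    have := ((summable_nat_add_iff 1).2
      (Real.summable_one_div_nat_pow.2 (by norm_num : 1 < 2))).mul_left ((p / Real.pi) ^ 2)
    refine this.congr fun k => ?_
    simp only [lam]
    field_simp
  have hI1 : Summable fun k => ∫ t in (-T)..T, fn1 p f (k + 1) t ^ 2 := by
    obtain ⟨B, hB⟩ := (isCompact_Icc.prod isCompact_Icc).exists_bound_of_continuousOn hq
    have hfin : IsFiniteMeasure (volume.restrict (Omega p T)) := by
      rw [restrict_Omega]; infer_instance
    have hsub : Omega p T ⊆ ClosedOmega p T := prod_mono Ioo_subset_Icc_self Ioo_subset_Icc_self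
    have hmeas : MeasurableSet (Omega p T) := measurableSet_Ioo.prod measurableSet_Ioo
    have hq2 : MemLp q 2 (volume.restrict (Omega p T)) :=
      MemLp.of_bound ((hq.mono hsub).aestronglyMeasurable hmeas) B
        ((ae_restrict_iff' hmeas).2 (Eventually.of_forall fun z hz => hB z (hsub hz)))
    obtain ⟨C, hC⟩ := (memLp_fn_of_memLp hp hq2).2
    refine summable_of_sum_range_le (c := C)
      (fun k => intervalIntegral.integral_nonneg hTT fun t _ => sq_nonneg _) fun N => ?_
    refine le_trans (le_of_eq ?_) (hC N)
    refine Finset.sum_congr rfl fun k _ => ?_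
    rw [hI]
    refine setIntegral_congr_fun measurableSet_Ioo fun t ht => ?_
    simp only [fn1]
    rw [(hasDerivAt_fn hp hf hq hqf (k + 1) ht).deriv]
  have hI2 : Summable fun k => ∫ t in (-T)..T, fn2 p f (k + 1) t ^ 2 := by
    obtain ⟨C, hC⟩ := (memLp_fn_of_memLp hp hg).2
    refine summable_of_sum_range_le (c := C)
      (fun k => intervalIntegral.integral_nonneg hTT fun t _ => sq_nonneg _) fun N => ?_
    refine le_trans (le_of_eq ?_) (hC N)
    refine Finset.sum_congr rfl fun k _ => ?_
    rw [hI]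
    refine integral_congr_ae ?_
    filter_upwards [fn2_ae_eq hp hT hf hg hw k] with t ht
    rw [ht]
  refine ⟨fun k => modeConst T (p / Real.pi) *
    modeMajorant T (lam p (k + 1)) (s k) (fn1 p f (k + 1)) (fn2 p f (k + 1)), ?_, hdata,
    fun k t ht => ?_, fun k t ht => (hdata k).abs_modeP_le (lam_pos hp k) (hc k) (hsf k) ht,
    fun k t ht => (hdata k).abs_modeM_le (lam_pos hp k) (hc k) (hsf k) ht⟩
  · exact Summable.mul_left _ ((((hs.add hb).add hr).add hI1).add hI2)
  · obtain ⟨hq0, hsq, -⟩ := (hdata k).majorant_bounds (lam_pos hp k) (hsf k)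
    refine le_modeConst_mul hT hcpos hq0 (((hsf k t ht).trans hsq).trans ?_)
    have : 0 ≤ (2 * (p / Real.pi) + p / Real.pi * T + (p / Real.pi) ^ 2) *
      modeMajorant T (lam p (k + 1)) (s k) (fn1 p f (k + 1)) (fn2 p f (k + 1)) := by positivity
    nlinarith [mul_nonneg hT.le hq0]

end Existence

/-! ### Gluing along t = 0 -/

section Gluing

/-- The function equal to `a` for `t ≥ 0` and to `b` for `t < 0`. -/
noncomputable def glue (a b : ℝ → ℝ → ℝ) (x t : ℝ) : ℝ := if 0 ≤ t then a x t else b x t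

variable {a b a' b' : ℝ → ℝ → ℝ}

theorem glue_of_nonneg {x t : ℝ} (ht : 0 ≤ t) : glue a b x t = a x t := if_pos ht

theorem glue_of_neg {x t : ℝ} (ht : t < 0) : glue a b x t = b x t := if_neg (not_le.2 ht)

theorem continuousOn_glue {S : Set (ℝ × ℝ)} (h : ∀ x, a x 0 = b x 0)
    (ha : ContinuousOn (fun z : ℝ × ℝ => a z.1 z.2) (S ∩ {z | 0 ≤ z.2}))
    (hb : ContinuousOn (fun z : ℝ × ℝ => b z.1 z.2) (S ∩ {z | z.2 ≤ 0})) :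
    ContinuousOn (fun z : ℝ × ℝ => glue a b z.1 z.2) S := by
  refine ContinuousOn.if (p := fun z : ℝ × ℝ => 0 ≤ z.2) ?_ ?_ ?_
  · rintro ⟨x, t⟩ ⟨-, hz⟩
    have : (0 : ℝ) = t := frontier_le_subset_eq continuous_const continuous_snd hz
    subst this
    exact h x
  · refine ha.mono (inter_subset_inter_right _ ?_)
    rw [(isClosed_le continuous_const continuous_snd).closure_eq]
  · refine hb.mono (inter_subset_inter_right _ ?_)
    refine closure_minimal (fun z hz => ?_) (isClosed_le continuous_snd continuous_const)
    exact (not_le.1 hz).le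

/-- A consequence of the mean value theorem: the one-sided derivatives at x are the limits of the
derivative from either side. It yields differentiability in t at t = 0, where the two series meet.
-/
theorem hasDerivAt_of_hasDerivAt_punctured {U : Set ℝ} (hU : IsOpen U) {f g : ℝ → ℝ} {x : ℝ}
    (hx : x ∈ U) (hd : ∀ y ∈ U, y ≠ x → HasDerivAt f (g y) y) (hf : ContinuousAt f x)
    (hg : ContinuousAt g x) : HasDerivAt f (g x) x := by
  have hUx := hU.mem_nhds hx
  have hdiff : ∀ s : Set ℝ, x ∉ s → DifferentiableOn ℝ f (U ∩ s) := fun s hs y hy =>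
    (hd y hy.1 fun h => hs (h ▸ hy.2)).differentiableAt.differentiableWithinAt
  have hder : ∀ s : Set ℝ, x ∉ s → Tendsto (deriv f) (𝓝[s] x) (𝓝 (g x)) := by
    intro s hs
    refine (hg.tendsto.mono_left nhdsWithin_le_nhds).congr' ?_
    filter_upwards [inter_mem (mem_nhdsWithin_of_mem_nhds hUx) self_mem_nhdsWithin] with y hy
    exact (hd y hy.1 fun h => hs (h ▸ hy.2)).deriv.symm
  have h1 : HasDerivWithinAt f (g x) (Ici x) x :=
    hasDerivWithinAt_Ici_of_tendsto_deriv (hdiff (Ioi x) (by simp)) hf.continuousWithinAt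
      (inter_mem (mem_nhdsWithin_of_mem_nhds hUx) self_mem_nhdsWithin)
      (hder _ (by simp))
  have h2 : HasDerivWithinAt f (g x) (Iic x) x :=
    hasDerivWithinAt_Iic_of_tendsto_deriv (hdiff (Iio x) (by simp)) hf.continuousWithinAt
      (inter_mem (mem_nhdsWithin_of_mem_nhds hUx) self_mem_nhdsWithin)
      (hder _ (by simp))
  simpa using h1.union h2

theorem hasDerivAt_glue {p T : ℝ} (hT : 0 < T)
    (hc : ContinuousOn (fun z : ℝ × ℝ => glue a b z.1 z.2) (Omega p T))
    (hc' : ContinuousOn (fun z : ℝ × ℝ => glue a' b' z.1 z.2) (Omega p T))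
    (ha : ∀ x, ∀ t ∈ Ioo 0 T, HasDerivAt (a x) (a' x t) t)
    (hb : ∀ x, ∀ t ∈ Ioo (-T) 0, HasDerivAt (b x) (b' x t) t) {x t : ℝ} (hz : (x, t) ∈ Omega p T) :
    HasDerivAt (glue a b x) (glue a' b' x t) t := by
  have hne : ∀ s ∈ Ioo (-T) T, s ≠ 0 → HasDerivAt (glue a b x) (glue a' b' x s) s := by
    intro s hs hs0
    rcases lt_or_gt_of_ne hs0 with h | h
    · rw [glue_of_neg h]
      refine (hb x s ⟨hs.1, h⟩).congr_of_eventuallyEq ?_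
      filter_upwards [Iio_mem_nhds h] with r hr using glue_of_neg hr
    · rw [glue_of_nonneg h.le]
      refine (ha x s ⟨h, hs.2⟩).congr_of_eventuallyEq ?_
      filter_upwards [Ioi_mem_nhds h] with r hr using glue_of_nonneg (le_of_lt hr)
  have hslice : ∀ {w : ℝ → ℝ → ℝ}, ContinuousOn (fun z : ℝ × ℝ => w z.1 z.2) (Omega p T) →
      ContinuousAt (w x) t := fun hw =>
    (hw.continuousAt ((isOpen_Ioo.prod isOpen_Ioo).mem_nhds hz)).comp
      (f := fun s : ℝ => (x, s)) (by fun_prop)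
  by_cases h0 : t = 0
  · subst h0
    exact hasDerivAt_of_hasDerivAt_punctured isOpen_Ioo (U := Ioo (-T) T) ⟨by linarith, hT⟩
      hne (hslice hc) (hslice hc')
  · exact hne t hz.2 h0

end Gluing

/-! ### Termwise differentiation of the series -/

section Series

variable {p T : ℝ} {f : ℝ → ℝ → ℝ} {m : ℕ → ℝ}

theorem abs_X_mul_le {a c : ℝ} (h : |a| ≤ c) (n : ℕ) (x : ℝ) : |X p n x * a| ≤ √(2 / p) * c := by
  rw [abs_mul]
  exact mul_le_mul (abs_X_le _ _) h (abs_nonneg _) (Real.sqrt_nonneg _)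

theorem convergesAbsUnif_of_factor {I J : Set ℝ} {F : ℕ → ℝ → ℝ → ℝ} {Q : ℕ → ℝ → ℝ}
    (hm : Summable m) (hF : ∀ n x t, F n x t = X p n x * Q n t)
    (hQ : ∀ k, ∀ t ∈ I, |Q (k + 1) t| ≤ m k) : ConvergesAbsUnif F (J ×ˢ I) :=
  .of_bound (m := fun k => √(2 / p) * m k) (hm.mul_left _) fun k z hz => by
    rw [hF]; exact abs_X_mul_le (hQ k _ hz.2) _ _

theorem continuousOn_of_factor {I : Set ℝ} {F : ℕ → ℝ → ℝ → ℝ} {Q : ℕ → ℝ → ℝ}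
    (hm : Summable m) (hF : ∀ n x t, F n x t = X p n x * Q n t)
    (hQ : ∀ k, ∀ t ∈ I, |Q (k + 1) t| ≤ m k) (hc : ∀ k, ContinuousOn (Q (k + 1)) I) :
    ContinuousOn (fun z : ℝ × ℝ => seriesSum F z.1 z.2) (univ ×ˢ I) := by
  refine continuousOn_seriesSum (m := fun k => √(2 / p) * m k) (hm.mul_left _)
    (fun k z hz => by rw [hF]; exact abs_X_mul_le (hQ k _ hz.2) _ _) fun k => ?_
  simp only [hF]
  exact ContinuousOn.mul (by fun_prop)
    ((hc k).comp continuousOn_snd fun z hz => hz.2)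

theorem hasDerivAt_of_factor {J : Set ℝ} (hJ : IsOpen J) (hJc : IsPreconnected J)
    {F F' : ℕ → ℝ → ℝ → ℝ} {Q Q' : ℕ → ℝ → ℝ}
    (hm : Summable m) (hF : ∀ n x t, F n x t = X p n x * Q n t)
    (hF' : ∀ n x t, F' n x t = X p n x * Q' n t)
    (hQ : ∀ k, ∀ t ∈ J, |Q (k + 1) t| ≤ m k) (hQ' : ∀ k, ∀ t ∈ J, |Q' (k + 1) t| ≤ m k)
    (hd : ∀ k, ∀ t ∈ J, HasDerivAt (Q (k + 1)) (Q' (k + 1) t) t) (x : ℝ) {t : ℝ} (ht : t ∈ J) :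
    HasDerivAt (seriesSum F x) (seriesSum F' x t) t := by
  have hs : Summable fun k => √(2 / p) * m k := hm.mul_left _
  have := hasDerivAt_tsum_of_isPreconnected (g := fun k t => X p (k + 1) x * Q (k + 1) t)
    (g' := fun k t => X p (k + 1) x * Q' (k + 1) t) hs hJ hJc
    (fun k s hs => (hd k s hs).const_mul _) (fun k s hs => abs_X_mul_le (hQ' k s hs) _ _) ht
    (Summable.of_norm_bounded hs fun k => abs_X_mul_le (hQ k t ht) _ _) ht
  simp only [← hF, ← hF'] at this
  exact this

/-- The terms of the series for `u_x`, for the time factors `Q`. -/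
noncomputable def termX (p : ℝ) (Q : ℕ → ℝ → ℝ) (n : ℕ) (x t : ℝ) : ℝ := dXn p n x * Q n t

/-- Since λ_n ≥ π/p, one has λ_n ≤ (p/π) λ_n². The series for u_x therefore needs no estimate of its
own: the majorant for u_xx controls it. -/
theorem abs_termX_le (hp : 0 < p) {Q : ℕ → ℝ → ℝ} {t c : ℝ} {k : ℕ}
    (hQ : |-lam p (k + 1) ^ 2 * Q (k + 1) t| ≤ c) (x : ℝ) :
    |termX p Q (k + 1) x t| ≤ √(2 / p) * (p / Real.pi * c) := by
  have hl := lam_pos hp k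
  have h1 : lam p (k + 1) ≤ p / Real.pi * lam p (k + 1) ^ 2 := by
    have := mul_le_mul_of_nonneg_right (lam_succ_ge hp k)
      (by positivity : 0 ≤ p / Real.pi * lam p (k + 1))
    calc lam p (k + 1) = Real.pi / p * (p / Real.pi * lam p (k + 1)) := by field_simp
      _ ≤ _ := this
      _ = _ := by ring
  have h2 : |-lam p (k + 1) ^ 2 * Q (k + 1) t| = lam p (k + 1) ^ 2 * |Q (k + 1) t| := by
    rw [abs_mul, abs_neg, abs_of_nonneg (sq_nonneg _)]
  rw [termX, abs_mul]
  calc |dXn p (k + 1) x| * |Q (k + 1) t| ≤ √(2 / p) * lam p (k + 1) * |Q (k + 1) t| := by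
        gcongr
        exact abs_dXn_le hp k x
    _ ≤ √(2 / p) * (p / Real.pi * lam p (k + 1) ^ 2) * |Q (k + 1) t| := by gcongr
    _ = √(2 / p) * (p / Real.pi * |-lam p (k + 1) ^ 2 * Q (k + 1) t|) := by rw [h2]; ring
    _ ≤ _ := by gcongr

theorem continuousOn_seriesSum_termX (hp : 0 < p) {I : Set ℝ} {Q : ℕ → ℝ → ℝ} (hm : Summable m)
    (hQ : ∀ k, ∀ t ∈ I, |-lam p (k + 1) ^ 2 * Q (k + 1) t| ≤ m k)
    (hc : ∀ k, ContinuousOn (Q (k + 1)) I) :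
    ContinuousOn (fun z : ℝ × ℝ => seriesSum (termX p Q) z.1 z.2) (univ ×ˢ I) := by
  refine continuousOn_seriesSum (m := fun k => √(2 / p) * (p / Real.pi * m k))
    ((hm.mul_left _).mul_left _) (fun k z hz => abs_termX_le hp (hQ k _ hz.2) _) fun k => ?_
  simp only [termX]
  exact ContinuousOn.mul (by fun_prop)
    ((hc k).comp continuousOn_snd fun z hz => hz.2)

theorem hasDerivAt_x_of_factor (hp : 0 < p) {F F' : ℕ → ℝ → ℝ → ℝ} {Q Q' : ℕ → ℝ → ℝ}
    (hm : Summable m) (hF : ∀ n x t, F n x t = X p n x * Q n t)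
    (hF' : ∀ n x t, F' n x t = X p n x * Q' n t) {t : ℝ}
    (hQQ : ∀ k, Q' (k + 1) t = -lam p (k + 1) ^ 2 * Q (k + 1) t)
    (hQ' : ∀ k, |Q' (k + 1) t| ≤ m k) (x : ℝ) :
    HasDerivAt (fun s => seriesSum F s t) (seriesSum (termX p Q) x t) x ∧
      HasDerivAt (fun s => seriesSum (termX p Q) s t) (seriesSum F' x t) x := by
  have hdX : ∀ k y, ‖termX p Q (k + 1) y t‖ ≤ √(2 / p) * (p / Real.pi * m k) := fun k y =>
    abs_termX_le hp (by rw [← hQQ]; exact hQ' k) y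
  have hs : Summable fun k => √(2 / p) * (p / Real.pi * m k) := (hm.mul_left _).mul_left _
  simp only [seriesSum, hF, hF']
  constructor
  -- Convergence of the undifferentiated series is needed at one point only; at x = 0 every term
  -- vanishes.
  · refine hasDerivAt_tsum (y₀ := 0) hs
      (fun k y => (hasDerivAt_X (k + 1) y).mul_const (Q (k + 1) t)) hdX ?_ x
    simp
  · have hd : ∀ k y, HasDerivAt (fun s => termX p Q (k + 1) s t)
        (X p (k + 1) y * Q' (k + 1) t) y := fun k y =>
      ((hasDerivAt_dXn (k + 1) y).mul_const (Q (k + 1) t)).congr_deriv (by rw [hQQ]; ring)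
    refine hasDerivAt_tsum (y₀ := 0) (u := fun k => √(2 / p) * m k) (hm.mul_left _) hd ?_ ?_ x
    · intro k y
      exact abs_X_mul_le (hQ' k) _ _
    · exact Summable.of_norm_bounded hs fun k => hdX k 0

/-- The time factors of the series for `u⁺`. -/
noncomputable def factorPlus (p : ℝ) (f : ℝ → ℝ → ℝ) (n : ℕ) : ℝ → ℝ :=
  modeP (fn p f n) (fn1 p f n) (lam p n)

/-- The time factors of the series for `u⁻`. -/
noncomputable def factorMinus (p : ℝ) (f : ℝ → ℝ → ℝ) (n : ℕ) : ℝ → ℝ :=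
  modeM (fn p f n) (fn1 p f n) (lam p n)

theorem termPlus_eq (n : ℕ) (x t : ℝ) : termPlus p f n x t = X p n x * factorPlus p f n t := rfl

theorem termMinus_eq (n : ℕ) (x t : ℝ) : termMinus p f n x t = X p n x * factorMinus p f n t := rfl

theorem termPlusT_eq (n : ℕ) (x t : ℝ) :
    termPlusT p f n x t = X p n x * modePT (fn p f n) (fn1 p f n) (lam p n) t := rfl

theorem termMinusT_eq (n : ℕ) (x t : ℝ) :
    termMinusT p f n x t = X p n x * modeMT (fn p f n) (fn1 p f n) (lam p n) t := rfl

theorem termPlusTT_eq (n : ℕ) (x t : ℝ) :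
    termPlusTT p f n x t = X p n x * modePTT (fn p f n) (fn1 p f n) (fn2 p f n) (lam p n) t := rfl

theorem termMinusTT_eq (n : ℕ) (x t : ℝ) :
    termMinusTT p f n x t = X p n x * modeMTT (fn p f n) (fn1 p f n) (fn2 p f n) (lam p n) t := rfl

theorem termPlusXX_eq (n : ℕ) (x t : ℝ) :
    termPlusXX p f n x t = X p n x * modePXX (fn p f n) (fn1 p f n) (fn2 p f n) (lam p n) t := rfl

theorem termMinusXX_eq (n : ℕ) (x t : ℝ) :
    termMinusXX p f n x t = X p n x * modeMXX (fn p f n) (fn1 p f n) (lam p n) t := rfl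

namespace ModeBounds

theorem converges (H : ModeBounds p T f m) :
    ConvergesAbsUnif (termPlus p f) (ClosedOmegaPlus p T) ∧
      ConvergesAbsUnif (termPlusT p f) (ClosedOmegaPlus p T) ∧
      ConvergesAbsUnif (termPlusTT p f) (ClosedOmegaPlus p T) ∧
      ConvergesAbsUnif (termPlusXX p f) (ClosedOmegaPlus p T) ∧
      ConvergesAbsUnif (termMinus p f) (ClosedOmegaMinus p T) ∧
      ConvergesAbsUnif (termMinusT p f) (ClosedOmegaMinus p T) ∧
      ConvergesAbsUnif (termMinusTT p f) (ClosedOmegaMinus p T) ∧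
      ConvergesAbsUnif (termMinusXX p f) (ClosedOmegaMinus p T) :=
  ⟨convergesAbsUnif_of_factor H.summable termPlus_eq fun k t ht => (H.plus k t ht).1,
    convergesAbsUnif_of_factor H.summable termPlusT_eq fun k t ht => (H.plus k t ht).2.1,
    convergesAbsUnif_of_factor H.summable termPlusTT_eq fun k t ht => (H.plus k t ht).2.2.1,
    convergesAbsUnif_of_factor H.summable termPlusXX_eq fun k t ht => (H.plus k t ht).2.2.2,
    convergesAbsUnif_of_factor H.summable termMinus_eq fun k t ht => (H.minus k t ht).1,
    convergesAbsUnif_of_factor H.summable termMinusT_eq fun k t ht => (H.minus k t ht).2.1,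
    convergesAbsUnif_of_factor H.summable termMinusTT_eq fun k t ht => (H.minus k t ht).2.2.1,
    convergesAbsUnif_of_factor H.summable termMinusXX_eq fun k t ht => (H.minus k t ht).2.2.2⟩

end ModeBounds

end Series

/-! ### The glued function solves the problem -/

section Solution

variable {p T : ℝ} {f : ℝ → ℝ → ℝ} {m : ℕ → ℝ}

theorem Omega_subset (p T : ℝ) : Omega p T ⊆ ClosedOmega p T :=
  prod_mono Ioo_subset_Icc_self Ioo_subset_Icc_self

theorem continuousAt_slice {w : ℝ → ℝ → ℝ}
    (hw : ContinuousOn (fun z : ℝ × ℝ => w z.1 z.2) (Omega p T)) {x t : ℝ}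
    (hz : (x, t) ∈ Omega p T) : ContinuousAt (fun s => w x s) t :=
  (hw.continuousAt ((isOpen_Ioo.prod isOpen_Ioo).mem_nhds hz)).comp
    (f := fun s : ℝ => (x, s)) (by fun_prop)

theorem matches_of_continuousOn (hT : 0 < T) {w : ℝ → ℝ → ℝ}
    (hw : ContinuousOn (fun z : ℝ × ℝ => w z.1 z.2) (Omega p T)) : Matches p w := by
  intro x hx
  have h : ContinuousAt (fun s => w x s) 0 := continuousAt_slice hw ⟨hx, by linarith, hT⟩
  exact ⟨w x 0, h.tendsto.mono_left nhdsWithin_le_nhds, h.tendsto.mono_left nhdsWithin_le_nhds⟩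

namespace ModeBounds

theorem T_pos (H : ModeBounds p T f m) : 0 < T := (H.data 0).pos

theorem factorPlus_xx (hp : 0 < p) (H : ModeBounds p T f m) (k : ℕ) {t : ℝ} (ht : t ∈ Ioo (-T) T) :
    modePXX (fn p f (k + 1)) (fn1 p f (k + 1)) (fn2 p f (k + 1)) (lam p (k + 1)) t
      = -lam p (k + 1) ^ 2 * factorPlus p f (k + 1) t :=
  (H.data k).modePXX_eq (lam_pos hp k) ht

theorem factorMinus_xx (hp : 0 < p) (H : ModeBounds p T f m) (k : ℕ) {t : ℝ}
    (ht : t ∈ Ioo (-T) T) :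
    modeMXX (fn p f (k + 1)) (fn1 p f (k + 1)) (lam p (k + 1)) t
      = -lam p (k + 1) ^ 2 * factorMinus p f (k + 1) t :=
  (H.data k).modeMXX_eq (lam_pos hp k) ht

theorem hasDerivAt_plus (hp : 0 < p) (H : ModeBounds p T f m) (x : ℝ) {t : ℝ} (ht : t ∈ Ioo 0 T) :
    HasDerivAt (uPlus p f x) (seriesSum (termPlusT p f) x t) t ∧
      HasDerivAt (seriesSum (termPlusT p f) x) (seriesSum (termPlusTT p f) x t) t := by
  have hT := H.T_pos
  have hI : Ioo 0 T ⊆ Icc 0 T := Ioo_subset_Icc_self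
  have hI' : Ioo 0 T ⊆ Ioo (-T) T := Ioo_subset_Ioo_left (by linarith)
  exact ⟨hasDerivAt_of_factor isOpen_Ioo isPreconnected_Ioo H.summable termPlus_eq termPlusT_eq
      (fun k s hs => (H.plus k s (hI hs)).1) (fun k s hs => (H.plus k s (hI hs)).2.1)
      (fun k s hs => (H.data k).hasDerivAt_modeP (lam_pos hp k) (hI' hs)) x ht,
    hasDerivAt_of_factor isOpen_Ioo isPreconnected_Ioo H.summable termPlusT_eq termPlusTT_eq
      (fun k s hs => (H.plus k s (hI hs)).2.1) (fun k s hs => (H.plus k s (hI hs)).2.2.1)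
      (fun k s hs => (H.data k).hasDerivAt_modePT (lam_pos hp k) (hI' hs)) x ht⟩

theorem hasDerivAt_minus (hp : 0 < p) (H : ModeBounds p T f m) (x : ℝ) {t : ℝ}
    (ht : t ∈ Ioo (-T) 0) :
    HasDerivAt (uMinus p f x) (seriesSum (termMinusT p f) x t) t ∧
      HasDerivAt (seriesSum (termMinusT p f) x) (seriesSum (termMinusTT p f) x t) t := by
  have hT := H.T_pos
  have hI : Ioo (-T) 0 ⊆ Icc (-T) 0 := Ioo_subset_Icc_self
  have hI' : Ioo (-T) 0 ⊆ Ioo (-T) T := Ioo_subset_Ioo_right hT.le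
  exact ⟨hasDerivAt_of_factor isOpen_Ioo isPreconnected_Ioo H.summable termMinus_eq termMinusT_eq
      (fun k s hs => (H.minus k s (hI hs)).1) (fun k s hs => (H.minus k s (hI hs)).2.1)
      (fun k s hs => (H.data k).hasDerivAt_modeM (lam_pos hp k) (hI' hs)) x ht,
    hasDerivAt_of_factor isOpen_Ioo isPreconnected_Ioo H.summable termMinusT_eq termMinusTT_eq
      (fun k s hs => (H.minus k s (hI hs)).2.1) (fun k s hs => (H.minus k s (hI hs)).2.2.1)
      (fun k s hs => (H.data k).hasDerivAt_modeMT (hI' hs)) x ht⟩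

theorem hasDerivAt_plus_x (hp : 0 < p) (H : ModeBounds p T f m) (x : ℝ) {t : ℝ}
    (ht : t ∈ Ico 0 T) :
    HasDerivAt (fun s => uPlus p f s t) (seriesSum (termX p (factorPlus p f)) x t) x ∧
      HasDerivAt (fun s => seriesSum (termX p (factorPlus p f)) s t)
        (seriesSum (termPlusXX p f) x t) x :=
  hasDerivAt_x_of_factor hp H.summable termPlus_eq termPlusXX_eq
    (fun k => H.factorPlus_xx hp k ⟨by linarith [H.T_pos, ht.1], ht.2⟩)
    (fun k => (H.plus k t (Ico_subset_Icc_self ht)).2.2.2) x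

theorem hasDerivAt_minus_x (hp : 0 < p) (H : ModeBounds p T f m) (x : ℝ) {t : ℝ}
    (ht : t ∈ Ioc (-T) 0) :
    HasDerivAt (fun s => uMinus p f s t) (seriesSum (termX p (factorMinus p f)) x t) x ∧
      HasDerivAt (fun s => seriesSum (termX p (factorMinus p f)) s t)
        (seriesSum (termMinusXX p f) x t) x :=
  hasDerivAt_x_of_factor hp H.summable termMinus_eq termMinusXX_eq
    (fun k => H.factorMinus_xx hp k ⟨ht.1, by linarith [H.T_pos, ht.2]⟩)
    (fun k => (H.minus k t (Ioc_subset_Icc_self ht)).2.2.2) x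

theorem hasDerivatives_plus (hp : 0 < p) (H : ModeBounds p T f m) :
    HasDerivatives (OmegaPlus p T) (uPlus p f) (seriesSum (termPlusT p f))
      (seriesSum (termPlusTT p f)) (seriesSum (termPlusXX p f)) := by
  rintro x t ⟨hz, ht : 0 < t⟩
  have htI : t ∈ Ioo 0 T := ⟨ht, hz.2.2⟩
  have hx := fun y => H.hasDerivAt_plus_x hp y (Ioo_subset_Ico_self htI)
  have hdX : (fun s => dX (uPlus p f) s t) = fun s => seriesSum (termX p (factorPlus p f)) s t :=
    funext fun s => (hx s).1.deriv
  refine ⟨(H.hasDerivAt_plus hp x htI).1, (H.hasDerivAt_plus hp x htI).2,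
    (hx x).1.differentiableAt, ?_⟩
  rw [hdX]
  exact (hx x).2

theorem hasDerivatives_minus (hp : 0 < p) (H : ModeBounds p T f m) :
    HasDerivatives (OmegaMinus p T) (uMinus p f) (seriesSum (termMinusT p f))
      (seriesSum (termMinusTT p f)) (seriesSum (termMinusXX p f)) := by
  rintro x t ⟨hz, ht : t < 0⟩
  have htI : t ∈ Ioo (-T) 0 := ⟨hz.2.1, ht⟩
  have hx := fun y => H.hasDerivAt_minus_x hp y (Ioo_subset_Ioc_self htI)
  have hdX : (fun s => dX (uMinus p f) s t)
      = fun s => seriesSum (termX p (factorMinus p f)) s t :=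
    funext fun s => (hx s).1.deriv
  refine ⟨(H.hasDerivAt_minus hp x htI).1, (H.hasDerivAt_minus hp x htI).2,
    (hx x).1.differentiableAt, ?_⟩
  rw [hdX]
  exact (hx x).2

theorem uSol_eq_glue (p : ℝ) (f : ℝ → ℝ → ℝ) : uSol p f = glue (uPlus p f) (uMinus p f) := rfl

theorem seriesSum_congr_zero {F G : ℕ → ℝ → ℝ → ℝ} {Q R : ℕ → ℝ → ℝ}
    (hF : ∀ n x t, F n x t = X p n x * Q n t) (hG : ∀ n x t, G n x t = X p n x * R n t)
    (h : ∀ n, Q n 0 = R n 0) (x : ℝ) : seriesSum F x 0 = seriesSum G x 0 := by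
  simp only [seriesSum, hF, hG, h]

theorem continuousOn_closed (H : ModeBounds p T f m) {F G : ℕ → ℝ → ℝ → ℝ} {Q R : ℕ → ℝ → ℝ}
    (hF : ∀ n x t, F n x t = X p n x * Q n t) (hG : ∀ n x t, G n x t = X p n x * R n t)
    (h0 : ∀ n, Q n 0 = R n 0)
    (hQ : ∀ k, ∀ t ∈ Icc 0 T, |Q (k + 1) t| ≤ m k) (hR : ∀ k, ∀ t ∈ Icc (-T) 0, |R (k + 1) t| ≤ m k)
    (hQc : ∀ k, ContinuousOn (Q (k + 1)) (Icc (-T) T))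
    (hRc : ∀ k, ContinuousOn (R (k + 1)) (Icc (-T) T)) :
    ContinuousOn (fun z : ℝ × ℝ => glue (seriesSum F) (seriesSum G) z.1 z.2) (ClosedOmega p T) := by
  have hT := H.T_pos
  refine continuousOn_glue (seriesSum_congr_zero hF hG h0) ?_ ?_
  · refine (continuousOn_of_factor H.summable hF hQ fun k =>
      (hQc k).mono (Icc_subset_Icc_left (by linarith))).mono ?_
    rintro z ⟨hz, hz0⟩
    exact ⟨mem_univ _, hz0, hz.2.2⟩
  · refine (continuousOn_of_factor H.summable hG hR fun k =>
      (hRc k).mono (Icc_subset_Icc_right hT.le)).mono ?_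
    rintro z ⟨hz, hz0⟩
    exact ⟨mem_univ _, hz.2.1, hz0⟩

theorem continuousOn_uSol (H : ModeBounds p T f m) :
    ContinuousOn (fun z : ℝ × ℝ => uSol p f z.1 z.2) (ClosedOmega p T) :=
  -- The argument `0` fills the place of φ₂, which does not occur in this component of `modes_zero`.
  H.continuousOn_closed termPlus_eq termMinus_eq (fun _ => (modes_zero _ _ 0 _).1)
    (fun k t ht => (H.plus k t ht).1) (fun k t ht => (H.minus k t ht).1)
    (fun k => ((H.data k).continuousOn_modes _).1.1)
    (fun k => ((H.data k).continuousOn_modes _).2.1)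

theorem continuousOn_uSol_t (H : ModeBounds p T f m) :
    ContinuousOn (fun z : ℝ × ℝ => glue (seriesSum (termPlusT p f)) (seriesSum (termMinusT p f))
      z.1 z.2) (ClosedOmega p T) :=
  H.continuousOn_closed termPlusT_eq termMinusT_eq (fun _ => (modes_zero _ _ 0 _).2.1)
    (fun k t ht => (H.plus k t ht).2.1) (fun k t ht => (H.minus k t ht).2.1)
    (fun k => ((H.data k).continuousOn_modes _).1.2.1)
    (fun k => ((H.data k).continuousOn_modes _).2.2.1)

theorem continuousOn_uSol_tt (H : ModeBounds p T f m) :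
    ContinuousOn (fun z : ℝ × ℝ => glue (seriesSum (termPlusTT p f)) (seriesSum (termMinusTT p f))
      z.1 z.2) (ClosedOmega p T) :=
  H.continuousOn_closed termPlusTT_eq termMinusTT_eq (fun _ => (modes_zero _ _ _ _).2.2.1)
    (fun k t ht => (H.plus k t ht).2.2.1) (fun k t ht => (H.minus k t ht).2.2.1)
    (fun k => ((H.data k).continuousOn_modes _).1.2.2.1)
    (fun k => ((H.data k).continuousOn_modes _).2.2.2.1)

theorem continuousOn_uSol_xx (H : ModeBounds p T f m) :
    ContinuousOn (fun z : ℝ × ℝ => glue (seriesSum (termPlusXX p f)) (seriesSum (termMinusXX p f))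
      z.1 z.2) (ClosedOmega p T) :=
  H.continuousOn_closed termPlusXX_eq termMinusXX_eq (fun n => (modes_zero _ _ (fn2 p f n) _).2.2.2)
    (fun k t ht => (H.plus k t ht).2.2.2) (fun k t ht => (H.minus k t ht).2.2.2)
    (fun k => ((H.data k).continuousOn_modes _).1.2.2.2)
    (fun k => ((H.data k).continuousOn_modes _).2.2.2.2)

/-- Continuity for all real x, the sides x = 0 and x = p included, is what gives the edge condition.
The time interval is open because -λ_n² times the time factor is identified with the estimated one
only for |t| < T. -/
theorem continuousOn_uSol_x (hp : 0 < p) (H : ModeBounds p T f m) :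
    ContinuousOn (fun z : ℝ × ℝ => glue (seriesSum (termX p (factorPlus p f)))
      (seriesSum (termX p (factorMinus p f))) z.1 z.2) (univ ×ˢ Ioo (-T) T) := by
  have hT := H.T_pos
  have h0 : ∀ n, factorPlus p f n 0 = factorMinus p f n 0 := fun n => (modes_zero _ _ 0 _).1
  refine continuousOn_glue (fun x => by simp only [seriesSum, termX, h0]) ?_ ?_
  · refine (continuousOn_seriesSum_termX hp (I := Ico 0 T) H.summable (fun k t ht => ?_) fun k =>
      ((H.data k).continuousOn_modes _).1.1.mono ?_).mono ?_
    · rw [← H.factorPlus_xx hp k ⟨by linarith [ht.1], ht.2⟩]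
      exact (H.plus k t (Ico_subset_Icc_self ht)).2.2.2
    · exact fun t ht => ⟨by linarith [ht.1], ht.2.le⟩
    · rintro z ⟨hz, hz0⟩
      exact ⟨mem_univ _, hz0, hz.2.2⟩
  · refine (continuousOn_seriesSum_termX hp (I := Ioc (-T) 0) H.summable (fun k t ht => ?_) fun k =>
      ((H.data k).continuousOn_modes _).2.1.mono ?_).mono ?_
    · rw [← H.factorMinus_xx hp k ⟨ht.1, by linarith [ht.2]⟩]
      exact (H.minus k t (Ioc_subset_Icc_self ht)).2.2.2
    · exact fun t ht => ⟨ht.1.le, by linarith [ht.2]⟩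
    · rintro z ⟨hz, hz0⟩
      exact ⟨mem_univ _, hz.2.1, hz0⟩

theorem hasDerivAt_uSol (hp : 0 < p) (H : ModeBounds p T f m) {x t : ℝ} (hz : (x, t) ∈ Omega p T) :
    HasDerivAt (uSol p f x)
      (glue (seriesSum (termPlusT p f)) (seriesSum (termMinusT p f)) x t) t :=
  hasDerivAt_glue H.T_pos (H.continuousOn_uSol.mono (Omega_subset p T))
    (H.continuousOn_uSol_t.mono (Omega_subset p T)) (fun x _ ht => (H.hasDerivAt_plus hp x ht).1)
    (fun x _ ht => (H.hasDerivAt_minus hp x ht).1) hz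

theorem hasDerivAt_uSol_t (hp : 0 < p) (H : ModeBounds p T f m) {x t : ℝ}
    (hz : (x, t) ∈ Omega p T) :
    HasDerivAt (glue (seriesSum (termPlusT p f)) (seriesSum (termMinusT p f)) x)
      (glue (seriesSum (termPlusTT p f)) (seriesSum (termMinusTT p f)) x t) t :=
  hasDerivAt_glue H.T_pos (H.continuousOn_uSol_t.mono (Omega_subset p T))
    (H.continuousOn_uSol_tt.mono (Omega_subset p T)) (fun x _ ht => (H.hasDerivAt_plus hp x ht).2)
    (fun x _ ht => (H.hasDerivAt_minus hp x ht).2) hz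

theorem hasDerivAt_uSol_x (hp : 0 < p) (H : ModeBounds p T f m) (x : ℝ) {t : ℝ}
    (ht : t ∈ Ioo (-T) T) :
    HasDerivAt (fun s => uSol p f s t) (glue (seriesSum (termX p (factorPlus p f)))
        (seriesSum (termX p (factorMinus p f))) x t) x ∧
      HasDerivAt (fun s => glue (seriesSum (termX p (factorPlus p f)))
        (seriesSum (termX p (factorMinus p f))) s t)
        (glue (seriesSum (termPlusXX p f)) (seriesSum (termMinusXX p f)) x t) x := by
  rw [uSol_eq_glue]
  rcases le_or_gt 0 t with h | h
  · simp only [glue_of_nonneg h]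
    exact H.hasDerivAt_plus_x hp x ⟨h, ht.2⟩
  · simp only [glue_of_neg h]
    exact H.hasDerivAt_minus_x hp x ⟨ht.1, h.le⟩

theorem dX_uSol (hp : 0 < p) (H : ModeBounds p T f m) (x : ℝ) {t : ℝ} (ht : t ∈ Ioo (-T) T) :
    dX (uSol p f) x t = glue (seriesSum (termX p (factorPlus p f)))
        (seriesSum (termX p (factorMinus p f))) x t :=
  (H.hasDerivAt_uSol_x hp x ht).1.deriv

theorem hasDerivAt_dX_uSol (hp : 0 < p) (H : ModeBounds p T f m) (x : ℝ) {t : ℝ}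
    (ht : t ∈ Ioo (-T) T) :
    HasDerivAt (fun s => dX (uSol p f) s t)
      (glue (seriesSum (termPlusXX p f)) (seriesSum (termMinusXX p f)) x t) x := by
  have e : (fun s => dX (uSol p f) s t) = fun s => glue (seriesSum (termX p (factorPlus p f)))
        (seriesSum (termX p (factorMinus p f))) s t := funext fun s => H.dX_uSol hp s ht
  rw [e]
  exact (H.hasDerivAt_uSol_x hp x ht).2

theorem dT_uSol (hp : 0 < p) (H : ModeBounds p T f m) {x t : ℝ} (hz : (x, t) ∈ Omega p T) :
    dT (uSol p f) x t = glue (seriesSum (termPlusT p f)) (seriesSum (termMinusT p f)) x t :=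
  (H.hasDerivAt_uSol hp hz).deriv

theorem hasDerivAt_dT_uSol (hp : 0 < p) (H : ModeBounds p T f m) {x t : ℝ}
    (hz : (x, t) ∈ Omega p T) :
    HasDerivAt (fun s => dT (uSol p f) x s)
      (glue (seriesSum (termPlusTT p f)) (seriesSum (termMinusTT p f)) x t) t := by
  refine (H.hasDerivAt_uSol_t hp hz).congr_of_eventuallyEq ?_
  filter_upwards [isOpen_Ioo.mem_nhds hz.2] with s hs using H.dT_uSol hp ⟨hz.1, hs⟩

theorem isC22_uSol (hp : 0 < p) (H : ModeBounds p T f m) : IsC22 (Omega p T) (uSol p f) where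
  diff_x x _ hz := (H.hasDerivAt_uSol_x hp x hz.2).1.differentiableAt
  diff_xx x _ hz := (H.hasDerivAt_dX_uSol hp x hz.2).differentiableAt
  diff_t _ _ hz := (H.hasDerivAt_uSol hp hz).differentiableAt
  diff_tt _ _ hz := (H.hasDerivAt_dT_uSol hp hz).differentiableAt
  cont := H.continuousOn_uSol.mono (Omega_subset p T)
  cont_x := ((H.continuousOn_uSol_x hp).mono (prod_mono_left (subset_univ _))).congr
    fun _ hz => H.dX_uSol hp _ hz.2
  cont_xx := (H.continuousOn_uSol_xx.mono (Omega_subset p T)).congr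
    fun _ hz => (H.hasDerivAt_dX_uSol hp _ hz.2).deriv
  cont_t := (H.continuousOn_uSol_t.mono (Omega_subset p T)).congr fun _ hz => H.dT_uSol hp hz
  cont_tt := (H.continuousOn_uSol_tt.mono (Omega_subset p T)).congr
    fun _ hz => (H.hasDerivAt_dT_uSol hp hz).deriv

theorem hasSum_fn (hp : 0 < p) (H : ModeBounds p T f m)
    (hc : ContinuousOn (fun z : ℝ × ℝ => f z.1 z.2) (ClosedOmega p T))
    (hf0 : ∀ t ∈ Icc (-T) T, f 0 t = 0 ∧ f p t = 0) {x t : ℝ} (hx : x ∈ Icc 0 p)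
    (ht : t ∈ Icc (-T) T) : HasSum (fun k => X p (k + 1) x * fn p f (k + 1) t) (f x t) := by
  have := hasSum_sineSeries hp (h := fun y => f y t) (slice_continuousOn hc ht) (hf0 t ht).1
    (hf0 t ht).2
    (Summable.of_nonneg_of_le (fun _ => abs_nonneg _) (fun k => H.fn_le k t ht) H.summable) hx
  have e : (fun k => X p (k + 1) x * fn p f (k + 1) t)
      = fun k => (∫ y in (0 : ℝ)..p, f y t * X p (k + 1) y) * X p (k + 1) x :=
    funext fun k => mul_comm _ _
  rw [e]
  exact this

theorem summable_factor (H : ModeBounds p T f m) {F : ℕ → ℝ → ℝ → ℝ} {Q : ℕ → ℝ → ℝ}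
    (hF : ∀ n x t, F n x t = X p n x * Q n t) {t : ℝ} (hQ : ∀ k, |Q (k + 1) t| ≤ m k) (x : ℝ) :
    Summable fun k => F (k + 1) x t :=
  Summable.of_norm_bounded (g := fun k => √(2 / p) * m k) (H.summable.mul_left _) fun k => by
    rw [hF]; exact abs_X_mul_le (hQ k) _ _

theorem isSolution_uSol (hp : 0 < p) (H : ModeBounds p T f m)
    (hc : ContinuousOn (fun z : ℝ × ℝ => f z.1 z.2) (ClosedOmega p T))
    (hf0 : ∀ t ∈ Icc (-T) T, f 0 t = 0 ∧ f p t = 0) : IsSolution p T f (uSol p f) where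
  cont := H.continuousOn_uSol
  c22 := H.isC22_uSol hp
  eq_plus := by
    rintro x t ⟨hz, ht : 0 < t⟩
    have htI : t ∈ Icc 0 T := ⟨ht.le, hz.2.2.le⟩
    have h1 : dT (dT (uSol p f)) x t = _ := (H.hasDerivAt_dT_uSol hp hz).deriv
    have h2 : dX (dX (uSol p f)) x t = _ := (H.hasDerivAt_dX_uSol hp x hz.2).deriv
    -- Termwise, the difference of the two series leaves X_n f_n, and the sine series of f sums to
    -- f.
    rw [h1, h2, glue_of_nonneg ht.le, glue_of_nonneg ht.le, seriesSum, seriesSum,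
      ← Summable.tsum_sub (H.summable_factor termPlusTT_eq (fun k => (H.plus k t htI).2.2.1) x)
        (H.summable_factor termPlusXX_eq (fun k => (H.plus k t htI).2.2.2) x),
      ← (H.hasSum_fn hp hc hf0 (Ioo_subset_Icc_self hz.1) (Ioo_subset_Icc_self hz.2)).tsum_eq]
    refine tsum_congr fun k => ?_
    rw [termPlusTT_eq, termPlusXX_eq, modePTT, modePXX]
    ring
  eq_minus := by
    rintro x t ⟨hz, ht : t < 0⟩
    have htI : t ∈ Icc (-T) 0 := ⟨hz.2.1.le, ht.le⟩
    have h2 : dX (dX (uSol p f)) x t = _ := (H.hasDerivAt_dX_uSol hp x hz.2).deriv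
    rw [H.dT_uSol hp hz, h2, glue_of_neg ht, glue_of_neg ht, seriesSum, seriesSum,
      ← Summable.tsum_add (H.summable_factor termMinusT_eq (fun k => (H.minus k t htI).2.1) x)
        (H.summable_factor termMinusXX_eq (fun k => (H.minus k t htI).2.2.2) x),
      ← (H.hasSum_fn hp hc hf0 (Ioo_subset_Icc_self hz.1) (Ioo_subset_Icc_self hz.2)).tsum_eq]
    refine tsum_congr fun k => ?_
    rw [termMinusT_eq, termMinusXX_eq, modeMT, modeMXX]
    ring
  left _ _ := by
    simp only [uSol, uPlus, uMinus, seriesSum, termPlus_eq, termMinus_eq, X_zero, zero_mul,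
      tsum_zero, ite_self]
  right _ _ := by
    simp only [uSol, uPlus, uMinus, seriesSum, termPlus_eq, termMinus_eq, X_right hp, zero_mul,
      tsum_zero, ite_self]
  conj_u := matches_of_continuousOn H.T_pos (H.isC22_uSol hp).cont
  conj_ut := matches_of_continuousOn H.T_pos (H.isC22_uSol hp).cont_t
  conj_utt := matches_of_continuousOn H.T_pos (H.isC22_uSol hp).cont_tt

/-- For fixed t the function u_x is continuous on the whole line, so it stays bounded near the edges
and the vanishing factor wins. -/
theorem edgeCondition_uSol (hp : 0 < p) (H : ModeBounds p T f m) :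
    EdgeCondition p T (uSol p f) := by
  intro t ht
  have hc : Continuous fun x => dX (uSol p f) x t := by
    refine ContinuousOn.congr ((H.continuousOn_uSol_x hp).comp (f := fun x => (x, t))
      (s := univ) (by fun_prop) fun x _ => ⟨mem_univ _, ht⟩) (fun x _ => H.dX_uSol hp x ht)
      |> continuousOn_univ.1
  have h1 : Tendsto (fun x => x * dX (uSol p f) x t) (𝓝 0) (𝓝 0) := by
    have : Continuous fun x => x * dX (uSol p f) x t := by fun_prop
    simpa using this.tendsto 0
  have h2 : Tendsto (fun x => (p - x) * dX (uSol p f) x t) (𝓝 p) (𝓝 0) := by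
    have : Continuous fun x => (p - x) * dX (uSol p f) x t := by fun_prop
    simpa using this.tendsto p
  exact ⟨h1.mono_left nhdsWithin_le_nhds, h2.mono_left nhdsWithin_le_nhds⟩

end ModeBounds

end Solution

/-! ### The homogeneous problem for the difference of two solutions -/

section NullSolution

variable {p T : ℝ}

/-- `w`, with derivatives `wx`, `wxx`, `wt`, `wtt`, solves the homogeneous boundary value problem;
the equations then hold up to the line `t = 0`. -/
structure IsNullSolution (p T : ℝ) (w wx wxx wt wtt : ℝ → ℝ → ℝ) : Prop where
  cont : ContinuousOn (fun z : ℝ × ℝ => w z.1 z.2) (ClosedOmega p T)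
  hasDerivAt_x : ∀ {x t}, (x, t) ∈ Omega p T → HasDerivAt (fun s => w s t) (wx x t) x
  hasDerivAt_xx : ∀ {x t}, (x, t) ∈ Omega p T → HasDerivAt (fun s => wx s t) (wxx x t) x
  hasDerivAt_t : ∀ {x t}, (x, t) ∈ Omega p T → HasDerivAt (w x) (wt x t) t
  hasDerivAt_tt : ∀ {x t}, (x, t) ∈ Omega p T → HasDerivAt (wt x) (wtt x t) t
  cont_x : ContinuousOn (fun z : ℝ × ℝ => wx z.1 z.2) (Omega p T)
  cont_xx : ContinuousOn (fun z : ℝ × ℝ => wxx z.1 z.2) (Omega p T)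
  cont_t : ContinuousOn (fun z : ℝ × ℝ => wt z.1 z.2) (Omega p T)
  cont_tt : ContinuousOn (fun z : ℝ × ℝ => wtt z.1 z.2) (Omega p T)
  wave : ∀ {x t}, (x, t) ∈ Omega p T → 0 ≤ t → wtt x t = wxx x t
  heat : ∀ {x t}, (x, t) ∈ Omega p T → t ≤ 0 → wt x t = -wxx x t
  left : ∀ {t}, t ∈ Ioo (-T) T → w 0 t = 0
  right : ∀ {t}, t ∈ Ioo (-T) T → w p t = 0

theorem isOpen_Omega (p T : ℝ) : IsOpen (Omega p T) := isOpen_Ioo.prod isOpen_Ioo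

theorem eq_of_eqOn_Ioo_right {g h : ℝ → ℝ} {b : ℝ} (hb : 0 < b) (hg : ContinuousAt g 0)
    (hh : ContinuousAt h 0) (e : ∀ t ∈ Ioo 0 b, g t = h t) : g 0 = h 0 := by
  have hg' : Tendsto g (𝓝[>] 0) (𝓝 (g 0)) := hg.tendsto.mono_left nhdsWithin_le_nhds
  have hh' : Tendsto h (𝓝[>] 0) (𝓝 (h 0)) := hh.tendsto.mono_left nhdsWithin_le_nhds
  refine tendsto_nhds_unique (hg'.congr' ?_) hh'
  filter_upwards [Ioo_mem_nhdsGT hb] with t ht using e t ht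

theorem eq_of_eqOn_Ioo_left {g h : ℝ → ℝ} {a : ℝ} (ha : a < 0) (hg : ContinuousAt g 0)
    (hh : ContinuousAt h 0) (e : ∀ t ∈ Ioo a 0, g t = h t) : g 0 = h 0 := by
  have hg' : Tendsto g (𝓝[<] 0) (𝓝 (g 0)) := hg.tendsto.mono_left nhdsWithin_le_nhds
  have hh' : Tendsto h (𝓝[<] 0) (𝓝 (h 0)) := hh.tendsto.mono_left nhdsWithin_le_nhds
  refine tendsto_nhds_unique (hg'.congr' ?_) hh'
  filter_upwards [Ioo_mem_nhdsLT ha] with t ht using e t ht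

/-- The derivatives are continuous across t = 0, so each equation extends to that line as a limit
from its own side. Both equations at t = 0 are used later. -/
theorem IsSolution.sub {f v u : ℝ → ℝ → ℝ} (hT : 0 < T) (hv : IsSolution p T f v)
    (hu : IsSolution p T f u) :
    IsNullSolution p T (fun x t => v x t - u x t) (fun x t => dX v x t - dX u x t)
      (fun x t => dX (dX v) x t - dX (dX u) x t) (fun x t => dT v x t - dT u x t)
      (fun x t => dT (dT v) x t - dT (dT u) x t) where
  cont := hv.cont.sub hu.cont
  hasDerivAt_x hz := (hv.c22.diff_x _ _ hz).hasDerivAt.sub (hu.c22.diff_x _ _ hz).hasDerivAt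
  hasDerivAt_xx hz := (hv.c22.diff_xx _ _ hz).hasDerivAt.sub (hu.c22.diff_xx _ _ hz).hasDerivAt
  hasDerivAt_t hz := (hv.c22.diff_t _ _ hz).hasDerivAt.sub (hu.c22.diff_t _ _ hz).hasDerivAt
  hasDerivAt_tt hz := (hv.c22.diff_tt _ _ hz).hasDerivAt.sub (hu.c22.diff_tt _ _ hz).hasDerivAt
  cont_x := hv.c22.cont_x.sub hu.c22.cont_x
  cont_xx := hv.c22.cont_xx.sub hu.c22.cont_xx
  cont_t := hv.c22.cont_t.sub hu.c22.cont_t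
  cont_tt := hv.c22.cont_tt.sub hu.c22.cont_tt
  wave {x t} hz ht := by
    have key : ∀ s ∈ Ioo 0 T, dT (dT v) x s - dT (dT u) x s = dX (dX v) x s - dX (dX u) x s := by
      intro s hs
      have hz' : (x, s) ∈ OmegaPlus p T := ⟨⟨hz.1, by linarith [hs.1], hs.2⟩, hs.1⟩
      linarith [hv.eq_plus x s hz', hu.eq_plus x s hz']
    rcases ht.eq_or_lt with rfl | ht
    · exact eq_of_eqOn_Ioo_right hT
        (continuousAt_slice (w := fun x t => dT (dT v) x t - dT (dT u) x t)
          (hv.c22.cont_tt.sub hu.c22.cont_tt) hz)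
        (continuousAt_slice (w := fun x t => dX (dX v) x t - dX (dX u) x t)
          (hv.c22.cont_xx.sub hu.c22.cont_xx) hz) key
    · exact key t ⟨ht, hz.2.2⟩
  heat {x t} hz ht := by
    have key : ∀ s ∈ Ioo (-T) 0, dT v x s - dT u x s = -(dX (dX v) x s - dX (dX u) x s) := by
      intro s hs
      have hz' : (x, s) ∈ OmegaMinus p T := ⟨⟨hz.1, hs.1, by linarith [hs.2]⟩, hs.2⟩
      linarith [hv.eq_minus x s hz', hu.eq_minus x s hz']
    rcases ht.eq_or_lt with rfl | ht
    · exact eq_of_eqOn_Ioo_left (neg_lt_zero.2 hT)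
        (continuousAt_slice (w := fun x t => dT v x t - dT u x t)
          (hv.c22.cont_t.sub hu.c22.cont_t) hz)
        (continuousAt_slice (w := fun x t => -(dX (dX v) x t - dX (dX u) x t))
          (hv.c22.cont_xx.sub hu.c22.cont_xx).neg hz) key
    · exact key t ⟨hz.2.1, ht⟩
  left ht := by rw [hv.left _ ht, hu.left _ ht, sub_self]
  right ht := by rw [hv.right _ ht, hu.right _ ht, sub_self]

namespace IsNullSolution

variable {w wx wxx wt wtt : ℝ → ℝ → ℝ}

theorem reflect_mem {x t : ℝ} (hz : (x, t) ∈ Omega p T) : (p - x, t) ∈ Omega p T :=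
  ⟨⟨by linarith [hz.1.2], by linarith [hz.1.1]⟩, hz.2⟩

theorem continuousOn_reflect {g : ℝ → ℝ → ℝ}
    (hg : ContinuousOn (fun z : ℝ × ℝ => g z.1 z.2) (Omega p T)) :
    ContinuousOn (fun z : ℝ × ℝ => g (p - z.1) z.2) (Omega p T) :=
  hg.comp (f := fun z : ℝ × ℝ => (p - z.1, z.2)) (by fun_prop) fun _ hz => reflect_mem hz

/-- The problem is invariant under x ↦ p - x, w_x changing sign, so the corner at x = p reduces to
the corner at x = 0. -/
theorem reflect (H : IsNullSolution p T w wx wxx wt wtt) :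
    IsNullSolution p T (fun x => w (p - x)) (fun x t => -wx (p - x) t) (fun x => wxx (p - x))
      (fun x => wt (p - x)) (fun x => wtt (p - x)) where
  cont := H.cont.comp (f := fun z : ℝ × ℝ => (p - z.1, z.2)) (by fun_prop)
    fun z hz => ⟨⟨by linarith [hz.1.2], by linarith [hz.1.1]⟩, hz.2⟩
  hasDerivAt_x hz := (H.hasDerivAt_x (reflect_mem hz)).comp_const_sub p _
  hasDerivAt_xx hz := by
    simpa only [neg_neg] using ((H.hasDerivAt_xx (reflect_mem hz)).comp_const_sub p _).fun_neg
  hasDerivAt_t hz := H.hasDerivAt_t (reflect_mem hz)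
  hasDerivAt_tt hz := H.hasDerivAt_tt (reflect_mem hz)
  cont_x := (continuousOn_reflect H.cont_x).neg
  cont_xx := continuousOn_reflect H.cont_xx
  cont_t := continuousOn_reflect H.cont_t
  cont_tt := continuousOn_reflect H.cont_tt
  wave hz ht := H.wave (reflect_mem hz) ht
  heat hz ht := H.heat (reflect_mem hz) ht
  left ht := by simpa using H.right ht
  right ht := by simpa using H.left ht

end IsNullSolution

end NullSolution

/-! ### Differentiation along straight lines -/

section Characteristics

/-- Continuous partial derivatives give strict differentiability, hence the chain rule. The mixed
and second derivatives of E play no role. -/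
theorem hasDerivAt_along_line {S : Set (ℝ × ℝ)} (hS : IsOpen S) {E Ex Et : ℝ → ℝ → ℝ}
    (hx : ∀ {x t}, (x, t) ∈ S → HasDerivAt (fun s => E s t) (Ex x t) x)
    (ht : ∀ {x t}, (x, t) ∈ S → HasDerivAt (E x) (Et x t) t)
    (hcx : ContinuousOn (fun z : ℝ × ℝ => Ex z.1 z.2) S)
    (hct : ContinuousOn (fun z : ℝ × ℝ => Et z.1 z.2) S) {x t a b τ : ℝ}
    (hz : (x + a * τ, t + b * τ) ∈ S) :
    HasDerivAt (fun τ => E (x + a * τ) (t + b * τ))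
      (a * Ex (x + a * τ) (t + b * τ) + b * Et (x + a * τ) (t + b * τ)) τ := by
  have hm := hS.mem_nhds hz
  have key := hasStrictFDerivAt_uncurry_coprod (𝕜 := ℝ) (f := E)
    (f₁ := fun x t => (1 : ℝ →L[ℝ] ℝ).smulRight (Ex x t))
    (f₂ := fun x t => (1 : ℝ →L[ℝ] ℝ).smulRight (Et x t))
    (u := (x + a * τ, t + b * τ))
    (by filter_upwards [hm] with v hv using (hx hv).hasFDerivAt)
    (by filter_upwards [hm] with v hv using (ht hv).hasFDerivAt)
    (((ContinuousLinearMap.smulRightL ℝ ℝ ℝ 1).continuous.continuousAt).comp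
      (hcx.continuousAt hm))
    (((ContinuousLinearMap.smulRightL ℝ ℝ ℝ 1).continuous.continuousAt).comp
      (hct.continuousAt hm))
  have hline : HasDerivAt (fun τ : ℝ => (x + a * τ, t + b * τ)) (a, b) τ := by
    simpa using (((hasDerivAt_id τ).const_mul a).const_add x).prodMk
      (((hasDerivAt_id τ).const_mul b).const_add t)
  refine (key.hasFDerivAt.comp_hasDerivAt τ hline).congr_deriv ?_
  exact ContinuousLinearMap.coprod_apply _ _ _

theorem eq_along_line {S : Set (ℝ × ℝ)} (hS : IsOpen S) {E Ex Et : ℝ → ℝ → ℝ}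
    (hx : ∀ {x t}, (x, t) ∈ S → HasDerivAt (fun s => E s t) (Ex x t) x)
    (ht : ∀ {x t}, (x, t) ∈ S → HasDerivAt (E x) (Et x t) t)
    (hcx : ContinuousOn (fun z : ℝ × ℝ => Ex z.1 z.2) S)
    (hct : ContinuousOn (fun z : ℝ × ℝ => Et z.1 z.2) S) {x t a b l : ℝ} (hl : 0 ≤ l)
    (hz : ∀ τ ∈ Icc 0 l, (x + a * τ, t + b * τ) ∈ S)
    (h0 : ∀ τ ∈ Icc 0 l, a * Ex (x + a * τ) (t + b * τ) + b * Et (x + a * τ) (t + b * τ) = 0) :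
    E (x + a * l) (t + b * l) = E x t := by
  have hd : ∀ τ ∈ Icc 0 l, HasDerivAt (fun τ => E (x + a * τ) (t + b * τ)) 0 τ := fun τ hτ =>
    h0 τ hτ ▸ hasDerivAt_along_line hS hx ht hcx hct (hz τ hτ)
  have := constant_of_has_deriv_right_zero (fun τ hτ => (hd τ hτ).continuousAt.continuousWithinAt)
    (fun τ hτ => (hd τ (Ico_subset_Icc_self hτ)).hasDerivWithinAt) l (right_mem_Icc.2 hl)
  simpa using this

end Characteristics

/-! ### The conjugate function, and w_t at the corners -/

namespace IsNullSolution

variable {p T : ℝ} {w wx wxx wt wtt : ℝ → ℝ → ℝ}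

theorem slice_x {g : ℝ → ℝ → ℝ} (hg : ContinuousOn (fun z : ℝ × ℝ => g z.1 z.2) (Omega p T))
    {t : ℝ} (ht : t ∈ Ioo (-T) T) : ContinuousOn (fun x => g x t) (Ioo 0 p) :=
  hg.comp (f := fun x => (x, t)) (by fun_prop) fun _ hx => ⟨hx, ht⟩

theorem slice_t {g : ℝ → ℝ → ℝ} (hg : ContinuousOn (fun z : ℝ × ℝ => g z.1 z.2) (Omega p T))
    {x : ℝ} (hx : x ∈ Ioo 0 p) : ContinuousOn (g x) (Ioo (-T) T) :=
  hg.comp (f := fun t => (x, t)) (by fun_prop) fun _ ht => ⟨hx, ht⟩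

theorem uIcc_zero_subset {t : ℝ} (ht : t ∈ Ioo (-T) T) : uIcc 0 t ⊆ Ioo (-T) T := by
  have hT : 0 < T := by linarith [ht.1, ht.2]
  exact ordConnected_Ioo.uIcc_subset ⟨by linarith, hT⟩ ht

theorem hasDerivAt_integral_x (H : IsNullSolution p T w wx wxx wt wtt) {x t : ℝ}
    (hz : (x, t) ∈ Omega p T) :
    HasDerivAt (fun y => ∫ τ in (0 : ℝ)..t, wx y τ) (∫ τ in (0 : ℝ)..t, wxx x τ) x := by
  have hsub := uIcc_zero_subset hz.2
  have hswap : ∀ {a b : ℝ}, Icc a b ⊆ Ioo (-T) T → ∀ {g : ℝ → ℝ → ℝ},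
      ContinuousOn (fun z : ℝ × ℝ => g z.1 z.2) (Omega p T) →
      ContinuousOn (fun z : ℝ × ℝ => g z.2 z.1) (Icc a b ×ˢ Ioo 0 p) := fun hab g hg =>
    hg.comp (f := fun z : ℝ × ℝ => (z.2, z.1)) (by fun_prop) fun z hz => ⟨hz.2, hab hz.1⟩
  rcases le_total 0 t with ht | ht
  · rw [uIcc_of_le ht] at hsub
    exact hasDerivAt_intervalIntegral_param ht isOpen_Ioo (F := fun τ y => wx y τ)
      (G := fun τ y => wxx y τ) (hswap hsub H.cont_x) (hswap hsub H.cont_xx)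
      (fun τ hτ y hy => H.hasDerivAt_xx ⟨hy, hsub (Ioo_subset_Icc_self hτ)⟩) hz.1
  · rw [uIcc_of_ge ht] at hsub
    simp only [intervalIntegral.integral_symm t 0]
    exact (hasDerivAt_intervalIntegral_param ht isOpen_Ioo (F := fun τ y => wx y τ)
      (G := fun τ y => wxx y τ) (hswap hsub H.cont_x) (hswap hsub H.cont_xx)
      (fun τ hτ y hy => H.hasDerivAt_xx ⟨hy, hsub (Ioo_subset_Icc_self hτ)⟩) hz.1).fun_neg

/-- The `x`-derivative of a conjugate function of `w`. -/
noncomputable def conjX (w wt : ℝ → ℝ → ℝ) : ℝ → ℝ → ℝ :=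
  glue wt fun x t => w x 0 - w x t + wt x 0

/-- This explains the two branches of `conjX`: w_xx is w_tt above t = 0 and -w_t below, and either
one integrates in t explicitly. -/
theorem integral_wxx (H : IsNullSolution p T w wx wxx wt wtt) {x t : ℝ}
    (hz : (x, t) ∈ Omega p T) :
    (∫ τ in (0 : ℝ)..t, wxx x τ) + wt x 0 = conjX w wt x t := by
  have hsub : uIcc 0 t ⊆ Ioo (-T) T := uIcc_zero_subset hz.2
  rcases le_or_gt 0 t with ht | ht
  · have e : ∫ τ in (0 : ℝ)..t, wxx x τ = ∫ τ in (0 : ℝ)..t, wtt x τ :=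
      intervalIntegral.integral_congr fun τ hτ => by
        have hm : (x, τ) ∈ Omega p T := ⟨hz.1, hsub hτ⟩
        rw [uIcc_of_le ht] at hτ
        exact (H.wave hm hτ.1).symm
    rw [e, intervalIntegral.integral_eq_sub_of_hasDerivAt
      (fun τ hτ => H.hasDerivAt_tt ⟨hz.1, hsub hτ⟩)
      ((slice_t H.cont_tt hz.1).mono hsub).intervalIntegrable, conjX, glue_of_nonneg ht]
    ring
  · have e : ∫ τ in (0 : ℝ)..t, wxx x τ = ∫ τ in (0 : ℝ)..t, -wt x τ :=
      intervalIntegral.integral_congr fun τ hτ => by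
        have hm : (x, τ) ∈ Omega p T := ⟨hz.1, hsub hτ⟩
        have hτ' : τ ≤ 0 := by rw [uIcc_of_ge ht.le] at hτ; exact hτ.2
        simp only [H.heat hm hτ', neg_neg]
    rw [e, intervalIntegral.integral_neg, intervalIntegral.integral_eq_sub_of_hasDerivAt
      (fun τ hτ => H.hasDerivAt_t ⟨hz.1, hsub hτ⟩)
      ((slice_t H.cont_t hz.1).mono hsub).intervalIntegrable, conjX, glue_of_neg ht]
    ring

theorem continuousOn_conjX (hT : 0 < T) (H : IsNullSolution p T w wx wxx wt wtt) :
    ContinuousOn (fun z : ℝ × ℝ => conjX w wt z.1 z.2) (Omega p T) := by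
  have h0 : (0 : ℝ) ∈ Ioo (-T) T := ⟨by linarith, hT⟩
  have hmap : ContinuousOn (fun z : ℝ × ℝ => (z.1, (0 : ℝ))) (Omega p T) := by fun_prop
  have hmem : MapsTo (fun z : ℝ × ℝ => (z.1, (0 : ℝ))) (Omega p T) (Omega p T) :=
    fun z hz => ⟨hz.1, h0⟩
  have hw := H.cont.mono (Omega_subset p T)
  refine continuousOn_glue (fun x => by ring) (H.cont_t.mono inter_subset_left) ?_
  exact ((((hw.comp hmap hmem)).sub hw).add (H.cont_t.comp hmap hmem)).mono inter_subset_left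

/-- For t ≥ 0 the system Q_x = w_t, Q_t = w_x makes w ± Q constant along characteristics. Defining Q
for t < 0 as well puts the line t = 0 inside the open set where Q has continuous partial
derivatives, so characteristics can be followed down to it. -/
theorem exists_conjugate (hp : 0 < p) (hT : 0 < T) (H : IsNullSolution p T w wx wxx wt wtt) :
    ∃ Q : ℝ → ℝ → ℝ, (∀ {x t}, (x, t) ∈ Omega p T → HasDerivAt (fun s => Q s t) (conjX w wt x t) x) ∧
      ∀ {x t}, (x, t) ∈ Omega p T → HasDerivAt (Q x) (wx x t) t := by
  have h0 : (0 : ℝ) ∈ Ioo (-T) T := ⟨by linarith, hT⟩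
  have hc : p / 2 ∈ Ioo 0 p := ⟨by linarith, by linarith⟩
  refine ⟨fun x t => (∫ τ in (0 : ℝ)..t, wx x τ) + ∫ y in (p / 2)..x, wt y 0, ?_, ?_⟩
  · intro x t hz
    rw [← H.integral_wxx hz]
    refine (H.hasDerivAt_integral_x hz).add ?_
    have hs := slice_x H.cont_t h0
    exact intervalIntegral.integral_hasDerivAt_right
      (hs.mono (ordConnected_Ioo.uIcc_subset hc hz.1)).intervalIntegrable
      (hs.stronglyMeasurableAtFilter isOpen_Ioo x hz.1) (hs.continuousAt (isOpen_Ioo.mem_nhds hz.1))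
  · intro x t hz
    have hs := slice_t H.cont_x hz.1
    exact (intervalIntegral.integral_hasDerivAt_right
      (hs.mono (uIcc_zero_subset hz.2)).intervalIntegrable
      (hs.stronglyMeasurableAtFilter isOpen_Ioo t hz.2)
      (hs.continuousAt (isOpen_Ioo.mem_nhds hz.2))).add_const _

/-- `w_t(x, 0) → 0` at the corner, by d'Alembert's formula in `t ≥ 0`. -/
theorem tendsto_wt_zero_left (hp : 0 < p) (hT : 0 < T) (H : IsNullSolution p T w wx wxx wt wtt) :
    Tendsto (fun x => wt x 0) (𝓝[>] 0) (𝓝 0) := by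
  obtain ⟨Q, hQx, hQt⟩ := H.exists_conjugate hp hT
  obtain ⟨c, hc0, hcp, hcT⟩ : ∃ c, 0 < c ∧ 2 * c < p ∧ 2 * c < T :=
    ⟨min p T / 4, by positivity, by linarith [min_le_left p T], by linarith [min_le_right p T]⟩
  have hwx : ∀ {x t}, (x, t) ∈ Omega p T → HasDerivAt (fun s => w s t) (wx x t) x := H.hasDerivAt_x
  have hwt : ∀ {x t}, (x, t) ∈ Omega p T → HasDerivAt (w x) (wt x t) t := H.hasDerivAt_t
  have hconj : ∀ x {t}, 0 ≤ t → conjX w wt x t = wt x t := fun x t ht => glue_of_nonneg ht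
  have hcc := H.continuousOn_conjX hT
  have hmem : ∀ {x t}, 0 < x → x < 2 * c → -(2 * c) < t → t < 2 * c → (x, t) ∈ Omega p T :=
    fun h1 h2 h3 h4 => ⟨⟨h1, by linarith⟩, by linarith, by linarith⟩
  -- the two Riemann invariants
  have hminus : ∀ {x t l}, 0 < x → 0 ≤ t → 0 ≤ l → x + l < 2 * c → t + l < 2 * c →
      w (x + l) (t + l) - Q (x + l) (t + l) = w x t - Q x t := by
    intro x t l hx ht hl h1 h2
    have hz : ∀ τ ∈ Icc 0 l, (x + 1 * τ, t + 1 * τ) ∈ Omega p T := fun τ hτ =>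
      hmem (by linarith [hτ.1]) (by linarith [hτ.2]) (by linarith [hτ.1]) (by linarith [hτ.2])
    have := eq_along_line (isOpen_Omega p T) (E := fun x t => w x t - Q x t)
      (fun hz => (hwx hz).fun_sub (hQx hz)) (fun hz => (hwt hz).fun_sub (hQt hz))
      (H.cont_x.sub hcc) (H.cont_t.sub H.cont_x) hl hz (fun τ hτ => by
        rw [hconj _ (by linarith [hτ.1])]; ring)
    simpa only [one_mul] using this
  have hplus : ∀ {x t}, 0 < x → 0 ≤ t → x + t < 2 * c →
      w (x + t) 0 + Q (x + t) 0 = w x t + Q x t := by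
    intro x t hx ht h1
    have hz : ∀ τ ∈ Icc 0 t, (x + 1 * τ, t + -1 * τ) ∈ Omega p T := fun τ hτ =>
      hmem (by linarith [hτ.1]) (by linarith [hτ.2]) (by linarith [hτ.2]) (by linarith [hτ.1])
    have := eq_along_line (isOpen_Omega p T) (E := fun x t => w x t + Q x t)
      (fun hz => (hwx hz).fun_add (hQx hz)) (fun hz => (hwt hz).fun_add (hQt hz))
      (H.cont_x.add hcc) (H.cont_t.add H.cont_x) ht hz (fun τ hτ => by
        rw [hconj _ (by linarith [hτ.2])]; ring)
    simpa using this
  -- The invariant w - Q as a function of s = x - t, read off on the interior line x = c. There it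
  -- is differentiable also for s near 0, which is how regularity reaches the corner.
  let Ψ : ℝ → ℝ := fun s => w c (c - s) - Q c (c - s)
  have hΨ : ∀ {s}, s ∈ Ioo (-c) c → HasDerivAt Ψ (-(wt c (c - s) - wx c (c - s))) s := by
    intro s hs
    have hz : (c, c - s) ∈ Omega p T :=
      hmem hc0 (by linarith) (by linarith [hs.2]) (by linarith [hs.1])
    exact ((H.hasDerivAt_t hz).fun_sub (hQt hz)).comp_const_sub c s
  have hQ0 : ∀ s ∈ Ioo 0 c, 2 * Q s 0 = -Ψ (-s) - Ψ s := by
    intro s hs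
    have e1 : Ψ s = w s 0 - Q s 0 := by
      have := hminus (x := s) (t := 0) (l := c - s) hs.1 le_rfl (by linarith [hs.2])
        (by linarith) (by linarith [hs.1])
      simpa [Ψ] using this
    -- From (x, x + s), near the side x = 0, one characteristic leads to (c, c + s) on the line x =
    -- c and the other to (2x + s, 0). Adding the two invariants isolates w at the starting point.
    have e2 : ∀ x ∈ Ioo 0 ((c - s) / 2),
        2 * w x (x + s) = Ψ (-s) + (w (2 * x + s) 0 + Q (2 * x + s) 0) := by
      intro x hx
      have hs1 := hs.1
      have hs2 := hs.2
      have hx1 := hx.1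
      have hx2 := hx.2
      have h1 := hminus (x := x) (t := x + s) (l := c - x) hx1 (by linarith) (by linarith)
        (by linarith) (by linarith)
      have h2 := hplus (x := x) (t := x + s) hx1 (by linarith) (by linarith)
      rw [show x + (c - x) = c by ring, show x + s + (c - x) = c - -s by ring] at h1
      rw [show x + (x + s) = 2 * x + s by ring] at h2
      simp only [Ψ]
      linarith
    have hsz : (s, (0 : ℝ)) ∈ Omega p T :=
      hmem hs.1 (by linarith [hs.2]) (by linarith) (by linarith)
    -- As x → 0 the starting point tends to (0, s), where w vanishes; this is the reflection at the
    -- boundary.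
    have l1 : Tendsto (fun x => 2 * w x (x + s)) (𝓝[>] 0) (𝓝 0) := by
      have h1 := H.cont (0, s) ⟨⟨le_rfl, hp.le⟩, by linarith [hs.1], by linarith [hs.2]⟩
      have h2 : Tendsto (fun x : ℝ => (x, x + s)) (𝓝[>] 0) (𝓝[ClosedOmega p T] (0, s)) := by
        refine tendsto_nhdsWithin_iff.2 ⟨?_, ?_⟩
        · have : Continuous fun x : ℝ => (x, x + s) := by fun_prop
          simpa using (this.tendsto 0).mono_left nhdsWithin_le_nhds
        · filter_upwards [Ioo_mem_nhdsGT hc0] with x hx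
          exact Omega_subset p T (hmem hx.1 (by linarith [hx.2])
            (by linarith [hx.1, hs.1]) (by linarith [hx.2, hs.2]))
      have h3 := (h1.tendsto.comp h2).const_mul 2
      rw [show w (0, s).1 (0, s).2 = 0 from H.left ⟨by linarith [hs.1], by linarith [hs.2]⟩,
        mul_zero] at h3
      exact h3
    have l2 : Tendsto (fun x => Ψ (-s) + (w (2 * x + s) 0 + Q (2 * x + s) 0)) (𝓝[>] 0)
        (𝓝 (Ψ (-s) + (w s 0 + Q s 0))) := by
      have hlin : Tendsto (fun x : ℝ => 2 * x + s) (𝓝[>] 0) (𝓝 s) := by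
        have : Continuous fun x : ℝ => 2 * x + s := by fun_prop
        simpa using (this.tendsto 0).mono_left nhdsWithin_le_nhds
      exact (((hwx hsz).continuousAt.tendsto.comp hlin).add
        ((hQx hsz).continuousAt.tendsto.comp hlin)).const_add _
    have e3 := tendsto_nhds_unique (l1.congr' (by
      filter_upwards [Ioo_mem_nhdsGT (show 0 < (c - s) / 2 by linarith [hs.2])] with x hx
        using e2 x hx)) l2
    linarith
  let D : ℝ → ℝ := fun s => wt c (c - s) - wx c (c - s)
  -- Differentiating 2 Q(s, 0) = -Ψ(-s) - Ψ(s), with Q_x = w_t at t = 0 and Ψ' = -D. As D is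
  -- continuous at 0, the difference D(s) - D(-s) tends to 0.
  have hwt0 : ∀ s ∈ Ioo 0 c, wt s 0 = (D s - D (-s)) / 2 := by
    intro s hs
    have hsz : (s, (0 : ℝ)) ∈ Omega p T :=
      hmem hs.1 (by linarith [hs.2]) (by linarith) (by linarith)
    have h1 : HasDerivAt (fun s => 2 * Q s 0) (2 * wt s 0) s := by
      have := (hQx hsz).const_mul 2
      rwa [hconj _ le_rfl] at this
    have h2 : HasDerivAt (fun s => -Ψ (-s) - Ψ s) (-(-(-D (-s))) - -D s) s := by
      have a1 := hΨ (s := s) ⟨by linarith [hs.1], hs.2⟩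
      have a2 : HasDerivAt Ψ (-D (-s)) (-s) := hΨ ⟨by linarith [hs.2], by linarith [hs.1]⟩
      have a3 := (HasDerivAt.comp_const_sub 0 s (f := Ψ) (by simpa using a2))
      simp only [zero_sub] at a3
      exact a3.fun_neg.fun_sub a1
    have h3 := h1.unique (h2.congr_of_eventuallyEq (by
      filter_upwards [isOpen_Ioo.mem_nhds hs] with r hr using hQ0 r hr))
    linarith
  have hD : ContinuousAt D 0 := by
    have hz : (c, c - 0) ∈ Omega p T := hmem hc0 (by linarith) (by linarith) (by linarith)
    have hsub : ContinuousAt (fun s : ℝ => c - s) 0 := by fun_prop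
    exact ((continuousAt_slice H.cont_t hz).comp hsub).sub
      ((continuousAt_slice H.cont_x hz).comp hsub)
  have hlim : Tendsto (fun s => (D s - D (-s)) / 2) (𝓝[>] 0) (𝓝 0) := by
    have hn : Tendsto (fun s : ℝ => -s) (𝓝 0) (𝓝 0) := by simpa using (continuous_neg.tendsto (0 : ℝ))
    have := ((hD.tendsto.sub (hD.tendsto.comp hn)).div_const 2).mono_left
      (nhdsWithin_le_nhds (s := Ioi 0))
    simpa using this
  refine hlim.congr' ?_
  filter_upwards [Ioo_mem_nhdsGT hc0] with s hs using (hwt0 s hs).symm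

theorem tendsto_wt_zero_right (hp : 0 < p) (hT : 0 < T) (H : IsNullSolution p T w wx wxx wt wtt) :
    Tendsto (fun x => wt (p - x) 0) (𝓝[>] 0) (𝓝 0) :=
  H.reflect.tendsto_wt_zero_left hp hT

end IsNullSolution

/-! ### Sine moments on [ε, p - ε] and uniqueness -/

section Moments

variable {p T ν : ℝ} {w wx wxx wt wtt : ℝ → ℝ → ℝ}

/-- The sine moment of `g(·, t)` over the interval `[ε, p - ε]`, rescaled to `[0, 1]`. -/
noncomputable def moment (p ν : ℝ) (g : ℝ → ℝ → ℝ) (ε t : ℝ) : ℝ :=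
  ∫ y in (0 : ℝ)..1, g (ε + (p - 2 * ε) * y) t * Real.sin (ν * y)

/-- The boundary term in the equation for the sine moment over `[ε, p - ε]`. -/
noncomputable def edgeTerm (p ν : ℝ) (g : ℝ → ℝ → ℝ) (ε t : ℝ) : ℝ :=
  ν / (p - 2 * ε) ^ 2 * (Real.cos ν * g (p - ε) t - g ε t)

namespace IsNullSolution

theorem rescale_mem {ε y : ℝ} (hε : ε ∈ Ioo 0 (p / 2)) (hy : y ∈ Icc (0 : ℝ) 1) :
    ε + (p - 2 * ε) * y ∈ Ioo 0 p := by
  have h1 : 0 < p - 2 * ε := by linarith [hε.2]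
  constructor
  · nlinarith [hε.1, mul_nonneg h1.le hy.1]
  · nlinarith [hε.1, mul_le_mul_of_nonneg_left hy.2 h1.le]

theorem rescale_mem_Icc {ε y : ℝ} (hε : ε ∈ Icc 0 (p / 3)) (hy : y ∈ Icc (0 : ℝ) 1) :
    ε + (p - 2 * ε) * y ∈ Icc 0 p := by
  have h1 : 0 ≤ p - 2 * ε := by linarith [hε.1, hε.2]
  constructor
  · nlinarith [hε.1, mul_nonneg h1 hy.1]
  · nlinarith [hε.1, mul_le_mul_of_nonneg_left hy.2 h1]

theorem continuousOn_rescale {g : ℝ → ℝ → ℝ}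
    (hg : ContinuousOn (fun z : ℝ × ℝ => g z.1 z.2) (Omega p T)) {ε : ℝ}
    (hε : ε ∈ Ioo 0 (p / 2)) :
    ContinuousOn (fun z : ℝ × ℝ => g (ε + (p - 2 * ε) * z.1) z.2 * Real.sin (ν * z.1))
      (Icc 0 1 ×ˢ Ioo (-T) T) := by
  refine ContinuousOn.mul ?_ (by fun_prop)
  exact hg.comp (f := fun z : ℝ × ℝ => (ε + (p - 2 * ε) * z.1, z.2)) (by fun_prop)
    fun z hz => ⟨rescale_mem hε hz.1, hz.2⟩

theorem hasDerivAt_moment {g gt : ℝ → ℝ → ℝ}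
    (hg : ContinuousOn (fun z : ℝ × ℝ => g z.1 z.2) (Omega p T))
    (hgt : ContinuousOn (fun z : ℝ × ℝ => gt z.1 z.2) (Omega p T))
    (hd : ∀ {x t}, (x, t) ∈ Omega p T → HasDerivAt (g x) (gt x t) t) {ε t : ℝ}
    (hε : ε ∈ Ioo 0 (p / 2)) (ht : t ∈ Ioo (-T) T) :
    HasDerivAt (moment p ν g ε) (moment p ν gt ε t) t :=
  hasDerivAt_intervalIntegral_param zero_le_one isOpen_Ioo
    (F := fun y t => g (ε + (p - 2 * ε) * y) t * Real.sin (ν * y))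
    (continuousOn_rescale hg hε) (continuousOn_rescale hgt hε)
    (fun _ hy _ hs => (hd ⟨rescale_mem hε (Ioo_subset_Icc_self hy), hs⟩).mul_const _) ht

/-- Two integrations by parts. The rescaled sine vanishes at both moving end points, so w_x, over
which nothing is known near the sides, drops out and only values of w remain. -/
theorem moment_wxx (H : IsNullSolution p T w wx wxx wt wtt) (hν : Real.sin ν = 0) {ε t : ℝ}
    (hε : ε ∈ Ioo 0 (p / 2)) (ht : t ∈ Ioo (-T) T) :
    moment p ν wxx ε t = -edgeTerm p ν w ε t - (ν / (p - 2 * ε)) ^ 2 * moment p ν w ε t := by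
  have hl : p - 2 * ε ≠ 0 := by linarith [hε.2]
  set l := p - 2 * ε with hldef
  have hmem : ∀ y ∈ uIcc (0 : ℝ) 1, (ε + l * y, t) ∈ Omega p T := fun y hy =>
    ⟨rescale_mem hε (by rwa [uIcc_of_le zero_le_one] at hy), ht⟩
  have hlin : ∀ y, HasDerivAt (fun y => ε + l * y) l y := fun y => by
    simpa using ((hasDerivAt_id y).const_mul l).const_add ε
  have hsin : ∀ y, HasDerivAt (fun y => Real.sin (ν * y)) (Real.cos (ν * y) * ν) y := fun y =>
    (hasDerivAt_const_mul ν).sin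
  have hcos : ∀ y, HasDerivAt (fun y => Real.cos (ν * y)) (-Real.sin (ν * y) * ν) y := fun y =>
    (hasDerivAt_const_mul ν).cos
  have hint : ∀ {g : ℝ → ℝ → ℝ}, ContinuousOn (fun z : ℝ × ℝ => g z.1 z.2) (Omega p T) →
      IntervalIntegrable (fun y => g (ε + l * y) t * Real.sin (ν * y)) volume 0 1 := fun hg => by
    refine ContinuousOn.intervalIntegrable ?_
    rw [uIcc_of_le zero_le_one]
    exact (continuousOn_rescale hg hε).comp (f := fun y => (y, t)) (by fun_prop)
      fun y hy => ⟨hy, ht⟩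
  have hw := H.cont.mono (Omega_subset p T)
  have key := intervalIntegral.integral_eq_sub_of_hasDerivAt (a := 0) (b := 1)
    (f := fun y => wx (ε + l * y) t * Real.sin (ν * y) / l
      - ν / l ^ 2 * (w (ε + l * y) t * Real.cos (ν * y)))
    (f' := fun y => wxx (ε + l * y) t * Real.sin (ν * y)
      + (ν / l) ^ 2 * (w (ε + l * y) t * Real.sin (ν * y)))
    (fun y hy => by
      have h1 := ((H.hasDerivAt_xx (hmem y hy)).comp y (hlin y)).fun_mul (hsin y)
      have h2 := ((H.hasDerivAt_x (hmem y hy)).comp y (hlin y)).fun_mul (hcos y)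
      refine ((h1.div_const l).fun_sub (h2.const_mul (ν / l ^ 2))).congr_deriv ?_
      simp only [Function.comp]
      field_simp
      ring)
    ((hint H.cont_xx).add ((hint hw).const_mul _))
  rw [intervalIntegral.integral_add (hint H.cont_xx) ((hint hw).const_mul _),
    intervalIntegral.integral_const_mul] at key
  simp only [mul_one, mul_zero, hν, Real.sin_zero, Real.cos_zero, add_zero, zero_div] at key
  rw [show ε + l = p - ε by rw [hldef]; ring] at key
  simp only [moment, edgeTerm, ← hldef]
  linear_combination key

theorem moment_wt_of_nonpos (H : IsNullSolution p T w wx wxx wt wtt) (hν : Real.sin ν = 0)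
    {ε t : ℝ} (hε : ε ∈ Ioo 0 (p / 2)) (ht : t ∈ Ioo (-T) T) (h0 : t ≤ 0) :
    moment p ν wt ε t = edgeTerm p ν w ε t + (ν / (p - 2 * ε)) ^ 2 * moment p ν w ε t := by
  have e : moment p ν wt ε t = -moment p ν wxx ε t := by
    rw [moment, moment, ← intervalIntegral.integral_neg]
    refine intervalIntegral.integral_congr fun y hy => ?_
    rw [uIcc_of_le zero_le_one] at hy
    simp only [H.heat ⟨rescale_mem hε hy, ht⟩ h0]
    ring
  rw [e, H.moment_wxx hν hε ht]
  ring

theorem moment_wtt_of_nonneg (H : IsNullSolution p T w wx wxx wt wtt) (hν : Real.sin ν = 0)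
    {ε t : ℝ} (hε : ε ∈ Ioo 0 (p / 2)) (ht : t ∈ Ioo (-T) T) (h0 : 0 ≤ t) :
    moment p ν wtt ε t = -edgeTerm p ν w ε t - (ν / (p - 2 * ε)) ^ 2 * moment p ν w ε t := by
  rw [← H.moment_wxx hν hε ht]
  refine intervalIntegral.integral_congr fun y hy => ?_
  rw [uIcc_of_le zero_le_one] at hy
  simp only [H.wave ⟨rescale_mem hε hy, ht⟩ h0]

theorem hasDerivAt_edgeTerm (H : IsNullSolution p T w wx wxx wt wtt) {ε t : ℝ}
    (hε : ε ∈ Ioo 0 (p / 2)) (ht : t ∈ Ioo (-T) T) :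
    HasDerivAt (edgeTerm p ν w ε) (edgeTerm p ν wt ε t) t := by
  have h1 : (p - ε, t) ∈ Omega p T := ⟨⟨by linarith [hε.1, hε.2], by linarith [hε.1]⟩, ht⟩
  have h2 : (ε, t) ∈ Omega p T := ⟨⟨hε.1, by linarith [hε.1, hε.2]⟩, ht⟩
  exact (((H.hasDerivAt_t h1).const_mul _).fun_sub (H.hasDerivAt_t h2)).const_mul _

/-- The derivative of the moment of w_t at t = 0 is computed twice: from the wave equation, and as a
left derivative of the expression that the heat equation gives for t ≤ 0. Equating the two is the
third matching condition, up to edge terms. -/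
theorem moment_zero_identity (hT : 0 < T) (H : IsNullSolution p T w wx wxx wt wtt)
    (hν : Real.sin ν = 0) {ε : ℝ} (hε : ε ∈ Ioo 0 (p / 2)) :
    ((ν / (p - 2 * ε)) ^ 2 + (ν / (p - 2 * ε)) ^ 4) * moment p ν w ε 0
      = -(1 + (ν / (p - 2 * ε)) ^ 2) * edgeTerm p ν w ε 0 - edgeTerm p ν wt ε 0 := by
  have h0 : (0 : ℝ) ∈ Ioo (-T) T := ⟨by linarith, hT⟩
  have hw := H.cont.mono (Omega_subset p T)
  have h1 : HasDerivAt (moment p ν wt ε) (moment p ν wtt ε 0) 0 :=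
    hasDerivAt_moment H.cont_t H.cont_tt H.hasDerivAt_tt hε h0
  have h2 := (H.hasDerivAt_edgeTerm (ν := ν) hε h0).fun_add
    ((hasDerivAt_moment (ν := ν) hw H.cont_t H.hasDerivAt_t hε h0).const_mul
      ((ν / (p - 2 * ε)) ^ 2))
  have h3 : HasDerivWithinAt (moment p ν wt ε) _ (Iic 0) 0 :=
    h2.hasDerivWithinAt.congr_of_eventuallyEq (by
      filter_upwards [self_mem_nhdsWithin, nhdsWithin_le_nhds (isOpen_Ioo.mem_nhds h0)] with t h ht
        using H.moment_wt_of_nonpos hν hε ht h)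
      (H.moment_wt_of_nonpos hν hε h0 le_rfl)
  have h4 := (uniqueDiffWithinAt_Iic (0 : ℝ)).eq_deriv _ h1.hasDerivWithinAt h3
  rw [H.moment_wtt_of_nonneg hν hε h0 le_rfl, H.moment_wt_of_nonpos hν hε h0 le_rfl] at h4
  linear_combination -h4

/-- The first-order equation for t ≤ 0 is integrated with its exponential integrating factor. -/
theorem moment_backward (H : IsNullSolution p T w wx wxx wt wtt) (hν : Real.sin ν = 0)
    {ε t : ℝ} (hε : ε ∈ Ioo 0 (p / 2)) (ht : t ∈ Ioc (-T) 0) (hT : 0 < T) :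
    moment p ν w ε t * Real.exp (-(ν / (p - 2 * ε)) ^ 2 * t)
      = moment p ν w ε 0
        - ∫ τ in t..(0 : ℝ), edgeTerm p ν w ε τ * Real.exp (-(ν / (p - 2 * ε)) ^ 2 * τ) := by
  have hw := H.cont.mono (Omega_subset p T)
  have hsub : Icc t 0 ⊆ Ioo (-T) T := fun τ hτ => ⟨by linarith [hτ.1, ht.1], by linarith [hτ.2]⟩
  have hexp : ∀ c τ : ℝ, HasDerivAt (fun τ => Real.exp (c * τ)) (Real.exp (c * τ) * c) τ :=
    fun c τ => (hasDerivAt_const_mul c).exp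
  rw [intervalIntegral.integral_eq_sub_of_hasDerivAt
    (f := fun τ => moment p ν w ε τ * Real.exp (-(ν / (p - 2 * ε)) ^ 2 * τ))]
  · simp
  · intro τ hτ
    rw [uIcc_of_le ht.2] at hτ
    refine ((hasDerivAt_moment hw H.cont_t H.hasDerivAt_t hε (hsub hτ)).fun_mul
      (hexp _ τ)).congr_deriv ?_
    rw [H.moment_wt_of_nonpos hν hε (hsub hτ) hτ.2]
    ring
  · refine ContinuousOn.intervalIntegrable fun τ hτ => ?_
    rw [uIcc_of_le ht.2] at hτ
    exact ((H.hasDerivAt_edgeTerm hε (hsub hτ)).continuousAt.mul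
      (hexp _ τ).continuousAt).continuousWithinAt

theorem moment_forward (H : IsNullSolution p T w wx wxx wt wtt) (hν : Real.sin ν = 0)
    (hν0 : ν ≠ 0) {ε t : ℝ} (hε : ε ∈ Ioo 0 (p / 2)) (ht : t ∈ Ico 0 T) :
    moment p ν w ε t
      = (edgeTerm p ν w ε 0 + (ν / (p - 2 * ε)) ^ 2 * moment p ν w ε 0)
          * Real.sin (ν / (p - 2 * ε) * t) / (ν / (p - 2 * ε))
        + moment p ν w ε 0 * Real.cos (ν / (p - 2 * ε) * t)
        - (∫ τ in (0 : ℝ)..t, edgeTerm p ν w ε τ * Real.sin (ν / (p - 2 * ε) * (t - τ)))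
          / (ν / (p - 2 * ε)) := by
  have hw := H.cont.mono (Omega_subset p T)
  have hT : 0 < T := ht.1.trans_lt ht.2
  have h0 : (0 : ℝ) ∈ Ioo (-T) T := ⟨by linarith, hT⟩
  have hl : 0 < p - 2 * ε := by linarith [hε.2]
  rw [← H.moment_wt_of_nonpos hν hε h0 le_rfl]
  have hsub : Icc 0 t ⊆ Ioo (-T) T := fun τ hτ => ⟨by linarith [hτ.1], by linarith [hτ.2, ht.2]⟩
  have hμ : ν / (p - 2 * ε) ≠ 0 := div_ne_zero hν0 hl.ne'
  set μ := ν / (p - 2 * ε)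
  have harg : ∀ τ : ℝ, HasDerivAt (fun τ => μ * (t - τ)) (-μ) τ := fun τ => by
    simpa using ((hasDerivAt_id τ).const_sub t).const_mul μ
  have hsin : ∀ τ, HasDerivAt (fun τ => Real.sin (μ * (t - τ))) (Real.cos (μ * (t - τ)) * -μ) τ :=
    fun τ => (Real.hasDerivAt_sin _).comp τ (harg τ)
  have hcos : ∀ τ, HasDerivAt (fun τ => Real.cos (μ * (t - τ))) (-Real.sin (μ * (t - τ)) * -μ) τ :=
    fun τ => (Real.hasDerivAt_cos _).comp τ (harg τ)
  -- Variation of constants: with M'' + μ² M = -edge, the derivative in τ of -(M' sin + μ M cos),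
  -- taken at μ(t - τ), is edge · sin.
  rw [intervalIntegral.integral_eq_sub_of_hasDerivAt (f := fun τ =>
    -(moment p ν wt ε τ * Real.sin (μ * (t - τ)) + μ * (moment p ν w ε τ * Real.cos (μ * (t - τ)))))]
  · simp only [sub_self, mul_zero, Real.sin_zero, Real.cos_zero, sub_zero, mul_one, zero_add]
    field_simp
    ring
  · intro τ hτ
    rw [uIcc_of_le ht.1] at hτ
    refine ((((hasDerivAt_moment H.cont_t H.cont_tt H.hasDerivAt_tt hε (hsub hτ)).fun_mul
      (hsin τ)).fun_add (((hasDerivAt_moment hw H.cont_t H.hasDerivAt_t hε (hsub hτ)).fun_mul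
        (hcos τ)).const_mul μ)).fun_neg).congr_deriv ?_
    rw [H.moment_wtt_of_nonneg hν hε (hsub hτ) hτ.1]
    ring
  · refine ContinuousOn.intervalIntegrable fun τ hτ => ?_
    rw [uIcc_of_le ht.1] at hτ
    exact ((H.hasDerivAt_edgeTerm hε (hsub hτ)).continuousAt.mul
      (hsin τ).continuousAt).continuousWithinAt

theorem tendsto_of_continuousOn (hp : 0 < p) {g : ℝ → ℝ} (hg : ContinuousOn g (Icc 0 (p / 3))) :
    Tendsto g (𝓝[>] 0) (𝓝 (g 0)) :=
  (hg 0 ⟨le_rfl, by positivity⟩).tendsto.mono_left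
    (nhdsWithin_le_iff.2 (Icc_mem_nhdsGT (by positivity)))

theorem tendsto_moment (hp : 0 < p) (H : IsNullSolution p T w wx wxx wt wtt) {t : ℝ}
    (ht : t ∈ Icc (-T) T) :
    Tendsto (fun ε => moment p ν w ε t) (𝓝[>] 0) (𝓝 (moment p ν w 0 t)) := by
  refine tendsto_of_continuousOn hp (continuousOn_intervalIntegral_param zero_le_one
    (F := fun y ε => w (ε + (p - 2 * ε) * y) t * Real.sin (ν * y)) ?_)
  refine ContinuousOn.mul ?_ (by fun_prop)
  exact H.cont.comp (f := fun z : ℝ × ℝ => (z.2 + (p - 2 * z.2) * z.1, t)) (by fun_prop)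
    fun z hz => ⟨rescale_mem_Icc hz.2 hz.1, ht⟩

theorem continuousOn_edgeTerm (hp : 0 < p) (H : IsNullSolution p T w wx wxx wt wtt) {a b : ℝ}
    (hab : Icc a b ⊆ Ioo (-T) T) :
    ContinuousOn (fun z : ℝ × ℝ => edgeTerm p ν w z.2 z.1) (Icc a b ×ˢ Icc 0 (p / 3)) := by
  have h : ∀ z ∈ Icc a b ×ˢ Icc 0 (p / 3), (p - 2 * z.2) ^ 2 ≠ 0 := fun z hz =>
    pow_ne_zero _ (by linarith [hz.2.2])
  have h1 : ContinuousOn (fun z : ℝ × ℝ => w (p - z.2) z.1) (Icc a b ×ˢ Icc 0 (p / 3)) :=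
    H.cont.comp (f := fun z : ℝ × ℝ => (p - z.2, z.1)) (by fun_prop) fun z hz =>
      ⟨⟨by linarith [hz.2.2], by linarith [hz.2.1]⟩, Ioo_subset_Icc_self (hab hz.1)⟩
  have h2 : ContinuousOn (fun z : ℝ × ℝ => w z.2 z.1) (Icc a b ×ˢ Icc 0 (p / 3)) :=
    H.cont.comp (f := fun z : ℝ × ℝ => (z.2, z.1)) (by fun_prop) fun z hz =>
      ⟨⟨hz.2.1, by linarith [hz.2.2]⟩, Ioo_subset_Icc_self (hab hz.1)⟩
  exact (ContinuousOn.div (by fun_prop) (by fun_prop) h).mul ((continuousOn_const.mul h1).sub h2)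

theorem edgeTerm_zero (H : IsNullSolution p T w wx wxx wt wtt) {t : ℝ} (ht : t ∈ Ioo (-T) T) :
    edgeTerm p ν w 0 t = 0 := by
  simp [edgeTerm, H.left ht, H.right ht]

theorem tendsto_edgeTerm (hp : 0 < p) (H : IsNullSolution p T w wx wxx wt wtt) {t : ℝ}
    (ht : t ∈ Ioo (-T) T) : Tendsto (fun ε => edgeTerm p ν w ε t) (𝓝[>] 0) (𝓝 0) := by
  have hs : Icc t t ⊆ Ioo (-T) T := by rw [Icc_self]; exact singleton_subset_iff.2 ht
  have := tendsto_of_continuousOn hp ((H.continuousOn_edgeTerm (ν := ν) hp hs).comp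
    (f := fun ε => (t, ε)) (by fun_prop) fun ε hε => ⟨⟨le_rfl, le_rfl⟩, hε⟩)
  simpa only [Function.comp_def, H.edgeTerm_zero ht] using this

/-- The edge term is jointly continuous up to ε = 0, where it vanishes by the boundary conditions.
-/
theorem tendsto_integral_edgeTerm (hp : 0 < p) (H : IsNullSolution p T w wx wxx wt wtt) {a b : ℝ}
    (h : a ≤ b) (hab : Icc a b ⊆ Ioo (-T) T) {κ : ℝ → ℝ → ℝ}
    (hκ : ContinuousOn (fun z : ℝ × ℝ => κ z.2 z.1) (Icc a b ×ˢ Icc 0 (p / 3))) :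
    Tendsto (fun ε => ∫ τ in a..b, edgeTerm p ν w ε τ * κ ε τ) (𝓝[>] 0) (𝓝 0) := by
  have h0 : ∫ τ in a..b, edgeTerm p ν w 0 τ * κ 0 τ = 0 := by
    rw [intervalIntegral.integral_congr (g := fun _ => 0) fun τ hτ => ?_]
    · simp
    · rw [uIcc_of_le h] at hτ
      simp only [H.edgeTerm_zero (hab hτ), zero_mul]
  have := tendsto_of_continuousOn hp (continuousOn_intervalIntegral_param h
    (F := fun τ ε => edgeTerm p ν w ε τ * κ ε τ) ((H.continuousOn_edgeTerm hp hab).mul hκ))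
  rwa [h0] at this

theorem tendsto_freq (hp : 0 < p) :
    Tendsto (fun ε => ν / (p - 2 * ε)) (𝓝[>] 0) (𝓝 (ν / p)) := by
  have : ContinuousAt (fun ε : ℝ => ν / (p - 2 * ε)) 0 :=
    ContinuousAt.div (by fun_prop) (by fun_prop) (by simpa using hp.ne')
  simpa using this.tendsto.mono_left nhdsWithin_le_nhds

theorem tendsto_edgeTerm_wt (hp : 0 < p) (hT : 0 < T) (H : IsNullSolution p T w wx wxx wt wtt) :
    Tendsto (fun ε => edgeTerm p ν wt ε 0) (𝓝[>] 0) (𝓝 0) := by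
  have h1 : ContinuousAt (fun ε : ℝ => ν / (p - 2 * ε) ^ 2) 0 :=
    ContinuousAt.div (by fun_prop) (by fun_prop) (by simpa using hp.ne')
  simpa [edgeTerm] using (h1.tendsto.mono_left nhdsWithin_le_nhds).mul
    (((H.tendsto_wt_zero_right hp hT).const_mul (Real.cos ν)).sub (H.tendsto_wt_zero_left hp hT))

theorem eventually_mem_Ioo (hp : 0 < p) : ∀ᶠ ε in 𝓝[>] (0 : ℝ), ε ∈ Ioo 0 (p / 2) :=
  Ioo_mem_nhdsGT (by positivity)

/-- As ε → 0 both edge terms in `moment_zero_identity` vanish, the one with w_t by the corner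
limits, and (ν/p)² + (ν/p)⁴ is positive. -/
theorem moment_zero_zero (hp : 0 < p) (hT : 0 < T) (H : IsNullSolution p T w wx wxx wt wtt)
    (hν : Real.sin ν = 0) (hν0 : ν ≠ 0) : moment p ν w 0 0 = 0 := by
  have h0 : (0 : ℝ) ∈ Ioo (-T) T := ⟨by linarith, hT⟩
  have hf := tendsto_freq (ν := ν) hp
  have hl := ((hf.pow 2).add (hf.pow 4)).mul
    (H.tendsto_moment (ν := ν) hp (Ioo_subset_Icc_self h0))
  have hr := ((((hf.pow 2).const_add 1).neg).mul (H.tendsto_edgeTerm (ν := ν) hp h0)).sub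
    (H.tendsto_edgeTerm_wt (ν := ν) hp hT)
  have h := tendsto_nhds_unique (hl.congr' ((eventually_mem_Ioo hp).mono fun ε hε =>
    H.moment_zero_identity hT hν hε)) hr
  have hpos : 0 < ν / p * (ν / p) := mul_self_pos.2 (div_ne_zero hν0 hp.ne')
  have hne : (ν / p) ^ 2 + (ν / p) ^ 4 ≠ 0 := by positivity
  simpa [hne] using h

theorem moment_zero (hp : 0 < p) (hT : 0 < T) (H : IsNullSolution p T w wx wxx wt wtt)
    (hν : Real.sin ν = 0) (hν0 : ν ≠ 0) {t : ℝ} (ht : t ∈ Ioo (-T) T) : moment p ν w 0 t = 0 := by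
  have h0 : (0 : ℝ) ∈ Ioo (-T) T := ⟨by linarith, hT⟩
  have hf := tendsto_freq (ν := ν) hp
  have hμ : ν / p ≠ 0 := div_ne_zero hν0 hp.ne'
  have hm := H.tendsto_moment (ν := ν) hp (Ioo_subset_Icc_self ht)
  have hm0 := H.tendsto_moment (ν := ν) hp (Ioo_subset_Icc_self h0)
  rw [H.moment_zero_zero hp hT hν hν0] at hm0
  have hfc : ∀ {a b : ℝ}, ContinuousOn (fun z : ℝ × ℝ => ν / (p - 2 * z.2))
      (Icc a b ×ˢ Icc 0 (p / 3)) := fun {a b} =>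
    ContinuousOn.div (by fun_prop) (by fun_prop) fun z hz => by linarith [hz.2.2]
  rcases le_total 0 t with h | h
  · have hi := H.tendsto_integral_edgeTerm (ν := ν) hp h
      (fun τ hτ => ⟨by linarith [hτ.1], hτ.2.trans_lt ht.2⟩)
      (κ := fun ε τ => Real.sin (ν / (p - 2 * ε) * (t - τ)))
      (Real.continuous_sin.comp_continuousOn (hfc.mul (by fun_prop)))
    have hs := (Real.continuous_sin.tendsto _).comp (hf.mul_const t)
    have hc := (Real.continuous_cos.tendsto _).comp (hf.mul_const t)
    have hr := (((((H.tendsto_edgeTerm (ν := ν) hp h0).add ((hf.pow 2).mul hm0)).mul hs).div hf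
      hμ).add (hm0.mul hc)).sub (hi.div hf hμ)
    have := tendsto_nhds_unique (hm.congr' ((eventually_mem_Ioo hp).mono fun ε hε =>
      H.moment_forward hν hν0 hε ⟨h, ht.2⟩)) hr
    simpa using this
  · have hi := H.tendsto_integral_edgeTerm (ν := ν) hp h
      (fun τ hτ => ⟨ht.1.trans_le hτ.1, by linarith [hτ.2]⟩)
      (κ := fun ε τ => Real.exp (-(ν / (p - 2 * ε)) ^ 2 * τ))
      (Real.continuous_exp.comp_continuousOn (((hfc.pow 2).neg).mul (by fun_prop)))
    have he := (Real.continuous_exp.tendsto _).comp ((hf.pow 2).neg.mul_const t)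
    have := tendsto_nhds_unique ((hm.mul he).congr' ((eventually_mem_Ioo hp).mono fun ε hε =>
      H.moment_backward hν hε ⟨ht.1, h⟩ hT)) (hm0.sub hi)
    simpa [(Real.exp_pos _).ne'] using this

theorem sineCoeff_eq_zero (hp : 0 < p) (hT : 0 < T) (H : IsNullSolution p T w wx wxx wt wtt)
    (k : ℕ) {t : ℝ} (ht : t ∈ Ioo (-T) T) : ∫ x in (0 : ℝ)..p, w x t * X p (k + 1) x = 0 := by
  have hν0 : ((k + 1 : ℕ) : ℝ) * Real.pi ≠ 0 := by positivity
  have h := H.moment_zero hp hT (Real.sin_nat_mul_pi (k + 1)) hν0 ht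
  have e : ∀ y : ℝ, w (0 + (p - 2 * 0) * y) t * Real.sin (((k + 1 : ℕ) : ℝ) * Real.pi * y)
      = (fun x => w x t * Real.sin (lam p (k + 1) * x)) (p * y) := fun y => by
    simp only [lam, mul_zero, sub_zero, zero_add]
    congr 2
    field_simp
  rw [moment, intervalIntegral.integral_congr fun y _ => e y,
    intervalIntegral.integral_comp_mul_left (fun x => w x t * Real.sin (lam p (k + 1) * x)) hp.ne',
    mul_zero, mul_one, smul_eq_mul, mul_eq_zero, or_iff_right (inv_ne_zero hp.ne')] at h
  simp only [X, mul_left_comm _ (√(2 / p)), intervalIntegral.integral_const_mul, h, mul_zero]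

/-- For |t| < T all sine coefficients of w(·, t) are zero, in particular summable, so w(·, t) is the
sum of its zero series. Continuity gives t = ±T. -/
theorem eq_zero (hp : 0 < p) (hT : 0 < T) (H : IsNullSolution p T w wx wxx wt wtt) {x t : ℝ}
    (hz : (x, t) ∈ ClosedOmega p T) : w x t = 0 := by
  have hin : EqOn (fun z : ℝ × ℝ => w z.1 z.2) (fun _ => 0) (Icc 0 p ×ˢ Ioo (-T) T) := by
    rintro ⟨y, s⟩ ⟨hy, hs⟩
    have hcoeff : ∀ k : ℕ, ∫ x in (0 : ℝ)..p, w x s * X p (k + 1) x = 0 := fun k =>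
      H.sineCoeff_eq_zero hp hT k hs
    have := hasSum_sineSeries hp (slice_continuousOn H.cont (Ioo_subset_Icc_self hs)) (H.left hs)
      (H.right hs) (by simp only [hcoeff, abs_zero]; exact summable_zero) hy
    simp only [hcoeff, zero_mul] at this
    exact this.unique hasSum_zero
  refine hin.of_subset_closure H.cont continuousOn_const
    (prod_mono_right Ioo_subset_Icc_self) ?_ hz
  rw [closure_prod_eq, closure_Icc, closure_Ioo (by linarith)]
  exact subset_rfl

end IsNullSolution

end Moments

end MixedProblem

theorem theorem2 (p T α : ℝ) (hp : 0 < p) (hT : 0 < T) (hα : 0 < α) (hα1 : α ≤ 1)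
    (f : ℝ → ℝ → ℝ)
    (hf : IsC1Closed p T f)
    (hftt : DTTMemL2 p T f)
    (hf0 : ∀ t ∈ Icc (-T) T, f 0 t = 0 ∧ f p t = 0)
    (hfx : DXHolder p T α f) :
    -- absolute and uniform convergence of the eight series
    (ConvergesAbsUnif (termPlus p f) (ClosedOmegaPlus p T) ∧
      ConvergesAbsUnif (termPlusT p f) (ClosedOmegaPlus p T) ∧
      ConvergesAbsUnif (termPlusTT p f) (ClosedOmegaPlus p T) ∧
      ConvergesAbsUnif (termPlusXX p f) (ClosedOmegaPlus p T) ∧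
      ConvergesAbsUnif (termMinus p f) (ClosedOmegaMinus p T) ∧
      ConvergesAbsUnif (termMinusT p f) (ClosedOmegaMinus p T) ∧
      ConvergesAbsUnif (termMinusTT p f) (ClosedOmegaMinus p T) ∧
      ConvergesAbsUnif (termMinusXX p f) (ClosedOmegaMinus p T)) ∧
    -- the derivative series are the derivatives of the sums
    HasDerivatives (OmegaPlus p T) (uPlus p f) (seriesSum (termPlusT p f))
      (seriesSum (termPlusTT p f)) (seriesSum (termPlusXX p f)) ∧
    HasDerivatives (OmegaMinus p T) (uMinus p f) (seriesSum (termMinusT p f))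
      (seriesSum (termMinusTT p f)) (seriesSum (termMinusXX p f)) ∧
    -- the function made of the two sums solves the problem
    IsSolution p T f (uSol p f) ∧
    -- and it is the unique solution that satisfies the edge condition
    EdgeCondition p T (uSol p f) ∧
    ∀ v : ℝ → ℝ → ℝ, IsSolution p T f v → EdgeCondition p T v →
      ∀ x t, (x, t) ∈ ClosedOmega p T → v x t = uSol p f x t := by
  obtain ⟨m, H⟩ := exists_modeBounds hp hT hα hf hftt hf0 hfx
  have hu := H.isSolution_uSol hp hf.cont hf0
  exact ⟨H.converges, H.hasDerivatives_plus hp, H.hasDerivatives_minus hp, hu,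
    H.edgeCondition_uSol hp, fun v hv _ x t hz => sub_eq_zero.1 ((hv.sub hT hu).eq_zero hp hT hz)⟩
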